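/- Let $\mathbb{K}$ be an algebraically closed field of characteristic zero, let $n\ge 2$, and let $H=(1,n,2,2,1)$. Let $R=\mathbb{K}[\alpha_1,\dots,\alpha_n]$ act on $S=\mathbb{K}[x_1,\dots,x_n]$ by partial differentiation ($\alpha_i$ acts as $\partial/\partial x_i$). For an ideal $I\subseteq R$, let $I^{\perp}=\{g\in S: f\lrcorner g=0 \text{ for all } f\in I\}$ be its inverse system; we say that $I$ is orthogonal to the elements of $I^\perp$. Let $\mathrm{Hilb}_H^{\mathbb{G}_m}(\mathbb{A}^n,0)$ be the graded Hilbert scheme, which represents the functor of flat families of homogeneous ideals with Hilbert function $H$, so that its closed points are the homogeneous ideals $I\subseteq R$ with $\dim_{\mathbb{K}}(R/I)_d=H(d)$ for all $d$ (where $H(d)=0$ for $d\ge 5$). Loci of closed points carry the Zariski topology. Then $\mathrm{Hilb}_H^{\mathbb{G}_m}(\mathbb{A}^n,0)$ is the union of the following four loci, where $x,y\in S$ denote arbitrary linearly independent linear forms: - (i) the ideals orthogonal to $x^4$ and $x^2y$ for some such $x,y$; this locus is irreducible of dimension $2(n-2)+1$; - (ii) the ideals orthogonal to a quartic of the form $x^3y$;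 this locus is irreducible of dimension $2(n-2)+2$; - (iii) the ideals orthogonal to $x^4$ and $y^3$ for some such $x,y$; this locus is irreducible of dimension $2(n-2)+2$; - (iv) the ideals orthogonal to a quartic of the form $x^4+y^4$; this locus is irreducible of dimension $2(n-2)+3$. Moreover, locus (iv) degenerates to (ii) and to (iii), and each of (ii) and (iii) degenerates to (i); that is, loci (ii) and (iii) are contained in the closure of (iv), and locus (i) is contained in the closure of (ii) and in the closure of (iii). In particular the scheme $\mathrm{Hilb}_H^{\mathbb{G}_m}(\mathbb{A}^n,0)$ is irreducible. -/

import Mathlib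

open CategoryTheory AlgebraicGeometry

universe u

namespace GradedHilbert

open MvPolynomial TensorProduct

noncomputable section

/-! ### The graded Hilbert functor -/

section Family

variable {A : Type u} [CommRing A] {n : ℕ}

/-- The degree `d` piece `A[α₁,…,αₙ]_d / J_d` of the quotient by an ideal `J`,
where `J_d = J ∩ A[α₁,…,αₙ]_d`. -/
abbrev piece (J : Ideal (MvPolynomial (Fin n) A)) (d : ℕ) : Type u :=
  homogeneousSubmodule (Fin n) A d ⧸
    (J.restrictScalars A).comap (homogeneousSubmodule (Fin n) A d).subtype

/-- `J ⊆ A[α₁,…,αₙ]` is a flat family, over `Spec A`, of homogeneous ideals with Hilbert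
function `H`: it is homogeneous for the standard grading and its degree `d` quotient is a
(finite) projective `A`-module of constant rank `H d`, for all `d`. -/
structure IsFamily (H : ℕ → ℕ) (J : Ideal (MvPolynomial (Fin n) A)) : Prop where
  homogeneous : ∀ f ∈ J, ∀ d, homogeneousComponent d f ∈ J
  projective : ∀ d, Module.Projective A (piece J d)
  rank_eq : ∀ d, ∀ p : PrimeSpectrum A, Module.rankAtStalk (piece J d) p = H d

instance finite_homogeneousSubmodule (d : ℕ) :
    Module.Finite A (homogeneousSubmodule (Fin n) A d) :=
  Module.Finite.iff_fg.mpr (homogeneousSubmodule_fg (σ := Fin n) (R := A) d)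

/-- Over a field, a family is a homogeneous ideal with Hilbert function `H`. -/
theorem isFamily_iff_of_field {K : Type u} [Field K] {n : ℕ} (H : ℕ → ℕ)
    (I : Ideal (MvPolynomial (Fin n) K)) :
    IsFamily H I ↔ (∀ f ∈ I, ∀ d, homogeneousComponent d f ∈ I) ∧
      ∀ d, Module.finrank K (piece I d) = H d := by
  constructor
  · rintro ⟨h1, h2, h3⟩
    refine ⟨h1, fun d => ?_⟩
    rw [← h3 d ⊥, Module.rankAtStalk_eq_finrank_of_free]
    simp
  · rintro ⟨h1, h2⟩
    refine ⟨h1, fun d => inferInstance, fun d p => ?_⟩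
    rw [Module.rankAtStalk_eq_finrank_of_free, ← h2 d]
    simp

variable {B : Type u} [CommRing B]

section BaseChange

variable [Algebra A B] (J : Ideal (MvPolynomial (Fin n) A)) (d : ℕ)

/-- The base change of polynomials, on degree `d` quotients. -/
def pieceMap : piece J d →ₗ[A] piece (J.map (MvPolynomial.map (algebraMap A B))) d :=
  Submodule.liftQ _
    { toFun := fun p => Submodule.Quotient.mk
        ⟨MvPolynomial.map (algebraMap A B) p.1, p.2.map (algebraMap A B)⟩
      map_add' := fun p q => by
        rw [← Submodule.Quotient.mk_add]; congr 1; ext1; simp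
      map_smul' := fun a p => by
        rw [RingHom.id_apply, ← Submodule.Quotient.mk_smul]
        congr 1; ext1
        change MvPolynomial.map (algebraMap A B) (a • p.1)
          = a • MvPolynomial.map (algebraMap A B) p.1
        rw [MvPolynomial.smul_eq_C_mul, map_mul, map_C, ← algebraMap_smul B a,
          MvPolynomial.smul_eq_C_mul] }
    (by
      intro p hp
      rw [LinearMap.mem_ker]
      refine (Submodule.Quotient.mk_eq_zero _).2 ?_
      exact Ideal.mem_map_of_mem _ hp)

theorem pieceMap_mk (p : homogeneousSubmodule (Fin n) A d) :
    pieceMap (B := B) J d (Submodule.Quotient.mk p) = Submodule.Quotient.mk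
        ⟨MvPolynomial.map (algebraMap A B) p.1, p.2.map (algebraMap A B)⟩ := rfl

/-- The class of the degree `d` component of a polynomial. -/
def toPiece : MvPolynomial (Fin n) A →ₗ[A] piece J d :=
  (Submodule.mkQ _).comp
    ((homogeneousComponent d).codRestrict (homogeneousSubmodule (Fin n) A d)
      (fun p => homogeneousComponent_isHomogeneous d p))

theorem toPiece_of_mem (p : homogeneousSubmodule (Fin n) A d) :
    toPiece J d p.1 = Submodule.Quotient.mk p := by
  simp only [toPiece, LinearMap.comp_apply, Submodule.mkQ_apply]
  congr 1
  ext1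
  exact homogeneousComponent_eq_self p.2

variable (B) in
/-- The inverse of the base change map, before passing to the quotient. -/
def backMap : MvPolynomial (Fin n) B →ₗ[B] B ⊗[A] piece J d :=
  (basisMonomials (Fin n) B).constr B
    (fun m => (1 : B) ⊗ₜ[A] toPiece J d (monomial m (1 : A)))

theorem backMap_map (p : MvPolynomial (Fin n) A) :
    backMap B J d (MvPolynomial.map (algebraMap A B) p) = (1 : B) ⊗ₜ[A] toPiece J d p := by
  induction p using MvPolynomial.induction_on' with
  | monomial m a =>
    have h1 : MvPolynomial.map (algebraMap A B) (monomial m a)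
        = (algebraMap A B a) • basisMonomials (Fin n) B m := by
      rw [MvPolynomial.map_monomial, coe_basisMonomials, MvPolynomial.smul_monomial,
        smul_eq_mul, mul_one]
    have h2 : (monomial m a : MvPolynomial (Fin n) A) = a • monomial m (1 : A) := by
      rw [MvPolynomial.smul_monomial, smul_eq_mul, mul_one]
    rw [h1, map_smul, backMap, Module.Basis.constr_basis, h2, map_smul,
      TensorProduct.tmul_smul, algebraMap_smul]
  | add p q hp hq => rw [map_add, map_add, map_add, hp, hq, TensorProduct.tmul_add]

theorem span_map_eq : Submodule.span B
      (Set.range (fun p : J => MvPolynomial.map (algebraMap A B) p.1))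
    = (J.map (MvPolynomial.map (algebraMap A B))).restrictScalars B := by
  apply le_antisymm
  · rw [Submodule.span_le]
    rintro _ ⟨p, rfl⟩
    exact Ideal.mem_map_of_mem _ p.2
  · intro f hf
    refine Submodule.span_induction (p := fun f _ => f ∈ Submodule.span B
      (Set.range (fun p : J => MvPolynomial.map (algebraMap A B) p.1))) ?_ ?_ ?_ ?_ hf
    · rintro _ ⟨p, hp, rfl⟩
      exact Submodule.subset_span ⟨⟨p, hp⟩, rfl⟩
    · exact Submodule.zero_mem _
    · intro x y _ _ hx hy
      exact Submodule.add_mem _ hx hy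
    · intro g x _ hx
      induction g using MvPolynomial.induction_on' with
      | add p q hp hq => rw [add_smul]; exact Submodule.add_mem _ hp hq
      | monomial m b =>
        refine Submodule.span_induction (p := fun x _ => (monomial m b) • x ∈ Submodule.span B
          (Set.range (fun p : J => MvPolynomial.map (algebraMap A B) p.1))) ?_ ?_ ?_ ?_ hx
        · rintro _ ⟨p, rfl⟩
          have : (monomial m b) • MvPolynomial.map (algebraMap A B) p.1
              = b • MvPolynomial.map (algebraMap A B) (monomial m 1 * p.1) := by
            rw [map_mul, MvPolynomial.map_monomial, map_one, ← smul_mul_assoc,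
              MvPolynomial.smul_monomial, smul_eq_mul, smul_eq_mul, mul_one]
          rw [this]
          exact Submodule.smul_mem _ _
            (Submodule.subset_span ⟨⟨_, J.mul_mem_left _ p.2⟩, rfl⟩)
        · rw [smul_zero]; exact Submodule.zero_mem _
        · intro x y _ _ hx hy
          rw [smul_add]; exact Submodule.add_mem _ hx hy
        · intro c x _ hx
          rw [smul_comm]; exact Submodule.smul_mem _ _ hx

theorem map_homogeneous (hJ : ∀ f ∈ J, ∀ d, homogeneousComponent d f ∈ J) :
    ∀ f ∈ J.map (MvPolynomial.map (algebraMap A B)), ∀ d,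
      homogeneousComponent d f ∈ J.map (MvPolynomial.map (algebraMap A B)) := by
  intro f hf d
  have hf' : f ∈ (J.map (MvPolynomial.map (algebraMap A B))).restrictScalars B := hf
  rw [← span_map_eq] at hf'
  suffices homogeneousComponent d f ∈
    (J.map (MvPolynomial.map (algebraMap A B))).restrictScalars B from this
  refine Submodule.span_induction (p := fun f _ => homogeneousComponent d f ∈
    (J.map (MvPolynomial.map (algebraMap A B))).restrictScalars B) ?_ ?_ ?_ ?_ hf'
  · rintro _ ⟨p, rfl⟩
    have : homogeneousComponent d (MvPolynomial.map (algebraMap A B) p.1)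
        = MvPolynomial.map (algebraMap A B) (homogeneousComponent d p.1) := by
      ext m
      simp only [coeff_homogeneousComponent, coeff_map]
      split_ifs <;> simp
    simp only [this]
    exact Ideal.mem_map_of_mem _ (hJ _ p.2 _)
  · rw [map_zero]; exact Submodule.zero_mem _
  · intro x y _ _ hx hy
    rw [map_add]; exact Submodule.add_mem _ hx hy
  · intro c x _ hx
    rw [map_smul]; exact Submodule.smul_mem _ _ hx

theorem pieceMap_isBaseChange (hJ : ∀ f ∈ J, ∀ d, homogeneousComponent d f ∈ J) :
    IsBaseChange B (pieceMap (B := B) J d) := by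
  have hker : ∀ f ∈ J.map (MvPolynomial.map (algebraMap A B)), backMap B J d f = 0 := by
    intro f hf
    have hf' : f ∈ (J.map (MvPolynomial.map (algebraMap A B))).restrictScalars B := hf
    rw [← span_map_eq] at hf'
    refine Submodule.span_induction (p := fun f _ => backMap B J d f = 0) ?_ ?_ ?_ ?_ hf'
    · rintro _ ⟨p, rfl⟩
      simp only [backMap_map]
      have : toPiece J d p.1 = 0 := by
        refine (Submodule.Quotient.mk_eq_zero _).2 ?_
        exact hJ _ p.2 _
      rw [this, TensorProduct.tmul_zero]
    · rw [map_zero]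
    · intro x y _ _ hx hy
      rw [map_add, hx, hy, add_zero]
    · intro c x _ hx
      rw [map_smul, hx, smul_zero]
  let back : piece (J.map (MvPolynomial.map (algebraMap A B))) d →ₗ[B] B ⊗[A] piece J d :=
    Submodule.liftQ _ ((backMap B J d).comp (homogeneousSubmodule (Fin n) B d).subtype)
      (fun p hp => hker p.1 hp)
  suffices h : ∀ F : B ⊗[A] piece J d →ₗ[A]
      piece (J.map (MvPolynomial.map (algebraMap A B))) d,
      (∀ (b : B) (q : piece J d), F (b ⊗ₜ[A] q) = b • pieceMap J d q) → Function.Bijective F from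
    h _ (fun _ _ => rfl)
  intro F hF'
  constructor
  · refine Function.LeftInverse.injective (g := back) fun x => ?_
    induction x using TensorProduct.induction_on with
    | zero => simp
    | add x y hx hy => rw [map_add, map_add, hx, hy]
    | tmul b q =>
      obtain ⟨p, rfl⟩ := Submodule.Quotient.mk_surjective _ q
      have h1 : back (pieceMap J d (Submodule.Quotient.mk p))
          = backMap B J d (MvPolynomial.map (algebraMap A B) p.1) := rfl
      rw [hF', map_smul, h1, backMap_map, toPiece_of_mem, TensorProduct.smul_tmul', smul_eq_mul,
        mul_one]
  · intro q
    obtain ⟨⟨f, hf⟩, rfl⟩ := Submodule.Quotient.mk_surjective _ q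
    have key : ∀ m ∈ f.support, m.degree = d := fun m hm => by
      by_contra h
      exact (mem_support_iff.1 hm) (hf.coeff_eq_zero h)
    refine ⟨∑ m ∈ f.support.attach, (f.coeff m.1) ⊗ₜ[A] Submodule.Quotient.mk
      ⟨monomial m.1 (1 : A), isHomogeneous_monomial _ (key m.1 m.2)⟩, ?_⟩
    rw [map_sum]
    have h2 : ∀ m : f.support,
        F ((f.coeff m.1) ⊗ₜ[A] Submodule.Quotient.mk
          ⟨monomial m.1 (1 : A), isHomogeneous_monomial _ (key m.1 m.2)⟩)
        = Submodule.mkQ _ ((f.coeff m.1) •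
            (⟨monomial m.1 (1 : B), isHomogeneous_monomial _ (key m.1 m.2)⟩ :
              homogeneousSubmodule (Fin n) B d)) := by
      intro m
      rw [hF', pieceMap_mk, map_smul, Submodule.mkQ_apply]
      congr 3
      simp [MvPolynomial.map_monomial]
    refine (Finset.sum_congr rfl (fun m _ => h2 m)).trans ?_
    rw [← map_sum, Submodule.mkQ_apply]
    congr 1
    ext1
    rw [AddSubmonoidClass.coe_finsetSum]
    change _ = f
    refine Eq.trans ?_ (MvPolynomial.support_sum_monomial_coeff f)
    rw [← Finset.sum_attach f.support]
    refine Finset.sum_congr rfl fun m _ => ?_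
    simp [MvPolynomial.smul_monomial]

end BaseChange

/-- Flat families of homogeneous ideals with Hilbert function `H` pull back along every ring
homomorphism. -/
theorem IsFamily.map {H : ℕ → ℕ} {J : Ideal (MvPolynomial (Fin n) A)} (hJ : IsFamily H J)
    (φ : A →+* B) : IsFamily H (J.map (MvPolynomial.map φ)) := by
  let _ : Algebra A B := φ.toAlgebra
  have hφ : φ = algebraMap A B := rfl
  rw [hφ]
  have := hJ.projective
  refine ⟨map_homogeneous J hJ.homogeneous, fun d => ?_, fun d p => ?_⟩
  · exact Module.Projective.of_equiv (pieceMap_isBaseChange J d hJ.homogeneous).equiv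
  · rw [Module.rankAtStalk_isBaseChange (pieceMap_isBaseChange J d hJ.homogeneous) p,
      hJ.rank_eq]

variable (A n) in
/-- The `A`-points of the graded Hilbert scheme `Hilb_H^{𝔾ₘ}(𝔸ⁿ, 0)`: flat families over
`Spec A` of homogeneous ideals of `A[α₁,…,αₙ]` with Hilbert function `H`. -/
@[ext] structure Points (H : ℕ → ℕ) : Type u where
  /-- The ideal defining the family. -/
  ideal : Ideal (MvPolynomial (Fin n) A)
  isFamily : IsFamily H ideal

/-- Pull-back of families along a ring homomorphism. -/
def Points.map {H : ℕ → ℕ} (φ : A →+* B) (J : Points A n H) : Points B n H :=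
  ⟨J.ideal.map (MvPolynomial.map φ), J.isFamily.map φ⟩

end Family

/-! ### The graded Hilbert scheme -/

section Hilb

variable (K : Type u) [Field K] (n : ℕ) (H : ℕ → ℕ)

/-- The functor of points `A ↦ Hilb_H^{𝔾ₘ}(𝔸ⁿ, 0)(A)` on commutative `K`-algebras. -/
def functor : CommAlgCat.{u} K ⥤ Type u where
  obj A := Points A n H
  map φ := ↾(Points.map φ.hom.toRingHom)
  map_id A := by
    refine ConcreteCategory.hom_ext _ _ fun J => Points.ext ?_
    change Ideal.map (MvPolynomial.map (RingHom.id A)) (Points.ideal J) = Points.ideal J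
    have : MvPolynomial.map (σ := Fin n) (RingHom.id A) = RingHom.id _ := by ext <;> simp
    rw [this, Ideal.map_id]
  map_comp φ ψ := by
    refine ConcreteCategory.hom_ext _ _ fun J => Points.ext ?_
    change Ideal.map (MvPolynomial.map (ψ.hom.toRingHom.comp φ.hom.toRingHom)) (Points.ideal J)
      = Ideal.map (MvPolynomial.map ψ.hom.toRingHom)
        (Ideal.map (MvPolynomial.map φ.hom.toRingHom) (Points.ideal J))
    rw [Ideal.map_map]
    congr 1
    ext <;> simp

/-- `X` is a graded Hilbert scheme `Hilb_H^{𝔾ₘ}(𝔸ⁿ, 0)` over `K`: maps `Spec A ⟶ X` over `K`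
are, naturally in the `K`-algebra `A`, the flat families over `Spec A` of homogeneous ideals
with Hilbert function `H`. This determines the `K`-scheme `X` up to unique isomorphism. -/
def IsGradedHilbertScheme (X : Over (Spec (.of K))) : Prop :=
  Nonempty ((algSpec (.of K)).rightOp ⋙ yoneda.obj X ≅ functor K n H)

/-- The closed points of the graded Hilbert scheme over an algebraically closed field `K`: the
homogeneous ideals `I ⊆ K[α₁,…,αₙ]` with Hilbert function `H`. -/
abbrev GradedHilb : Type u := Points K n H

variable {K n H}

/-- The Zariski topology on the closed points of the graded Hilbert scheme: a set `Z` of ideals is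
closed if and only if for every flat family `J` over `Spec A`, the set of `K`-points `φ` of `Spec A`
whose fibre `J_φ` belongs to `Z` is Zariski closed, i.e. is the zero locus of some `s ⊆ A`. -/
instance : TopologicalSpace (GradedHilb K n H) :=
  TopologicalSpace.ofClosed
    {Z | ∀ (A : Type u) [CommRing A] [Algebra K A] (J : Points A n H), ∃ s : Set A,
      ∀ φ : A →ₐ[K] K, J.map φ.toRingHom ∈ Z ↔ ∀ a ∈ s, φ a = 0}
    (by
      intro A _ _ J
      exact ⟨{1}, fun φ => by simp [Set.mem_empty_iff_false]⟩)
    (by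
      intro S hS A _ _ J
      choose! s hs using fun (Z : Set (GradedHilb K n H)) (hZ : Z ∈ S) => hS hZ A J
      refine ⟨⋃ Z ∈ S, s Z, fun φ => ?_⟩
      simp only [Set.mem_sInter, Set.mem_iUnion]
      constructor
      · rintro h a ⟨Z, hZ, ha⟩
        exact (hs Z hZ φ).1 (h Z hZ) a ha
      · intro h Z hZ
        exact (hs Z hZ φ).2 fun a ha => h a ⟨Z, hZ, ha⟩)
    (by
      intro Z hZ W hW A _ _ J
      obtain ⟨s, hs⟩ := hZ A J
      obtain ⟨t, ht⟩ := hW A J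
      refine ⟨Set.image2 (· * ·) s t, fun φ => ?_⟩
      rw [Set.mem_union, hs φ, ht φ]
      constructor
      · rintro (h | h) _ ⟨a, ha, b, hb, rfl⟩
        · simp [h a ha]
        · simp [h b hb]
      · intro h
        by_contra! hc
        obtain ⟨⟨a, ha, ha'⟩, ⟨b, hb, hb'⟩⟩ := hc
        have := h _ ⟨a, ha, b, hb, rfl⟩
        rw [map_mul] at this
        exact (mul_ne_zero ha' hb') this)

theorem isClosed_iff {Z : Set (GradedHilb K n H)} : IsClosed Z ↔
    ∀ (A : Type u) [CommRing A] [Algebra K A] (J : Points A n H), ∃ s : Set A,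
      ∀ φ : A →ₐ[K] K, J.map φ.toRingHom ∈ Z ↔ ∀ a ∈ s, φ a = 0 :=
  isOpen_compl_iff.symm.trans (by
    change Zᶜᶜ ∈ _ ↔ _
    rw [compl_compl]; rfl)

end Hilb

/-! ### Comparison of the two topologies -/

section Compare

open Opposite
variable {K : Type u} [Field K] {n : ℕ} {H : ℕ → ℕ} {X : Over (Spec (.of K))}

/-- The `A`-valued point `Spec A ⟶ X` of a graded Hilbert scheme given by a family. -/
def classify (e : (algSpec (.of K)).rightOp ⋙ yoneda.obj X ≅ functor K n H) (A : Type u)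
    [CommRing A] [Algebra K A] (J : Points A n H) : Spec (.of A) ⟶ X.left :=
  (show (algSpec (.of K)).obj (op (.of K A)) ⟶ X from e.inv.app (CommAlgCat.of K A) J).left

theorem classify_comp_hom (e : (algSpec (.of K)).rightOp ⋙ yoneda.obj X ≅ functor K n H)
    {A : Type u} [CommRing A] [Algebra K A] (J : Points A n H) :
    classify e A J ≫ X.hom = Spec.map (CommRingCat.ofHom (algebraMap K A)) :=
  Over.w (show (algSpec (.of K)).obj (op (.of K A)) ⟶ X from e.inv.app (CommAlgCat.of K A) J)

theorem classify_map (e : (algSpec (.of K)).rightOp ⋙ yoneda.obj X ≅ functor K n H) {A B : Type u}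
    [CommRing A] [Algebra K A] [CommRing B] [Algebra K B] (φ : A →ₐ[K] B) (J : Points A n H) :
    classify e B (J.map φ.toRingHom)
      = Spec.map (CommRingCat.ofHom φ.toRingHom) ≫ classify e A J :=
  congrArg Over.Hom.left congr($(e.inv.naturality (CommAlgCat.ofHom φ)) J)

theorem exists_classify (e : (algSpec (.of K)).rightOp ⋙ yoneda.obj X ≅ functor K n H) {A : Type u}
    [CommRing A] [Algebra K A] (f : Spec (.of A) ⟶ X.left)
    (hf : f ≫ X.hom = Spec.map (CommRingCat.ofHom (algebraMap K A))) :
    ∃ J, classify e A J = f := by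
  let f' : (algSpec (.of K)).obj (op (.of K A)) ⟶ X := Over.homMk f hf
  exact ⟨e.hom.app (CommAlgCat.of K A) f',
    congrArg Over.Hom.left congr($(e.hom_inv_id_app (CommAlgCat.of K A)) f')⟩

theorem classify_injective (e : (algSpec (.of K)).rightOp ⋙ yoneda.obj X ≅ functor K n H)
    (A : Type u) [CommRing A] [Algebra K A] : Function.Injective (classify e A) := by
  intro I J h
  have h' : (show (algSpec (.of K)).obj (op (.of K A)) ⟶ X from e.inv.app (CommAlgCat.of K A) I)
      = (show (algSpec (.of K)).obj (op (.of K A)) ⟶ X from e.inv.app (CommAlgCat.of K A) J) :=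
    Over.OverMorphism.ext h
  have h'' := congrArg (fun f => e.hom.app (CommAlgCat.of K A) f) h'
  exact (congr($(e.inv_hom_id_app (CommAlgCat.of K A)) I)).symm.trans
    (h''.trans congr($(e.inv_hom_id_app (CommAlgCat.of K A)) J))

/-- The point of a graded Hilbert scheme `X` given by an ideal. -/
def toScheme (e : (algSpec (.of K)).rightOp ⋙ yoneda.obj X ≅ functor K n H)
    (I : GradedHilb K n H) : X.left :=
  classify e K I (⊥ : PrimeSpectrum K)

theorem toScheme_map (e : (algSpec (.of K)).rightOp ⋙ yoneda.obj X ≅ functor K n H)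
    {A : Type u} [CommRing A] [Algebra K A] (φ : A →ₐ[K] K) (J : Points A n H) :
    toScheme e (J.map φ.toRingHom) = classify e A J (PrimeSpectrum.comap φ.toRingHom ⊥) := by
  rw [toScheme, classify_map]; rfl

theorem exists_fibre (e : (algSpec (.of K)).rightOp ⋙ yoneda.obj X ≅ functor K n H)
    {A : Type u} [CommRing A] [Algebra K A] (J : Points A n H)
    [IsOpenImmersion (classify e A J)] (I : GradedHilb K n H) (p : PrimeSpectrum A)
    (hp : toScheme e I = classify e A J p) :
    ∃ φ : A →ₐ[K] K, J.map φ.toRingHom = I ∧ p = PrimeSpectrum.comap φ.toRingHom ⊥ := by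
  have hr : Set.range (classify e K I) ⊆ Set.range (classify e A J) := by
    rintro _ ⟨x, rfl⟩
    have : x = (⊥ : PrimeSpectrum K) := Subsingleton.elim (α := PrimeSpectrum K) _ _
    subst this
    exact ⟨p, hp.symm⟩
  obtain ⟨ψ, hψ⟩ := Spec.map_surjective
    (IsOpenImmersion.lift (classify e A J) (classify e K I) hr)
  have h1 : Spec.map ψ ≫ classify e A J = classify e K I := by
    rw [hψ]; exact IsOpenImmersion.lift_fac _ _ hr
  have h2 : CommRingCat.ofHom (algebraMap K A) ≫ ψ = CommRingCat.ofHom (algebraMap K K) := by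
    apply Spec.map_injective
    rw [Spec.map_comp, ← classify_comp_hom e J, ← classify_comp_hom e I, ← Category.assoc, h1]
  let φ : A →ₐ[K] K :=
    { ψ.hom with commutes' := fun r => congr($h2 r) }
  have h3 : CommRingCat.ofHom φ.toRingHom = ψ := rfl
  have h4 : J.map φ.toRingHom = I := by
    apply classify_injective e K
    rw [classify_map, h3, h1]
  refine ⟨φ, h4, ?_⟩
  apply (classify e A J).isOpenEmbedding.injective
  rw [← hp, ← h4]
  exact toScheme_map e φ J

/-- The topology on `GradedHilb K n H` is the one induced from any graded Hilbert scheme. -/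
theorem isInducing_toScheme
    (e : (algSpec (.of K)).rightOp ⋙ yoneda.obj X ≅ functor K n H) :
    Topology.IsInducing (toScheme e) := by
  rw [Topology.isInducing_iff]
  refine TopologicalSpace.ext_isClosed fun Z => ?_
  rw [isClosed_induced_iff, isClosed_iff]
  constructor
  · intro hZ
    refine ⟨closure (toScheme e '' Z), isClosed_closure, ?_⟩
    refine Set.Subset.antisymm (fun I hI => ?_)
      (fun I hI => subset_closure (Set.mem_image_of_mem _ hI))
    obtain ⟨U, hU, hIU, -⟩ := X.left.isBasis_affineOpens.exists_subset_of_mem_open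
      (Set.mem_univ (toScheme e I)) isOpen_univ
    obtain ⟨U, hU', rfl⟩ := hU
    have hU : IsAffineOpen U := hU'
    let A : Type u := Γ(X.left, U)
    obtain ⟨g, hg⟩ := Spec.map_surjective (hU.fromSpec ≫ X.hom)
    let _ : Algebra K A := g.hom.toAlgebra
    obtain ⟨J, hJ⟩ := exists_classify e (A := A) hU.fromSpec hg.symm
    have : IsOpenImmersion (classify e A J) := by rw [hJ]; exact hU.isOpenImmersion_fromSpec
    have hr : Set.range (classify e A J) = U := by rw [hJ]; exact hU.range_fromSpec
    obtain ⟨s, hs⟩ := hZ A J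
    have hIU' : toScheme e I ∈ Set.range (classify e A J) := by rw [hr]; exact hIU
    obtain ⟨p, hp⟩ := hIU'
    have hsub : (classify e A J) ⁻¹' (toScheme e '' Z)
        ⊆ (PrimeSpectrum.zeroLocus s : Set (PrimeSpectrum A)) := by
      rintro q ⟨I', hI', hq⟩
      obtain ⟨φ, hφ, rfl⟩ := exists_fibre e J I' q hq
      rw [← hφ] at hI'
      intro a ha
      exact (hs φ).1 hI' a ha
    have hpc : p ∈ closure ((classify e A J) ⁻¹' (toScheme e '' Z)) := by
      rw [← (classify e A J).isOpenEmbedding.isOpenMap.preimage_closure_eq_closure_preimage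
        (classify e A J).continuous, Set.mem_preimage, hp]
      exact hI
    have hpz := closure_minimal hsub (PrimeSpectrum.isClosed_zeroLocus s) hpc
    obtain ⟨φ, hφ, rfl⟩ := exists_fibre e J I p hp.symm
    rw [← hφ]
    exact (hs φ).2 fun a ha => hpz ha
  · rintro ⟨W, hW, rfl⟩ A _ _ J
    obtain ⟨s, hs⟩ := (PrimeSpectrum.isClosed_iff_zeroLocus _).1
      (hW.preimage (classify e A J).continuous)
    refine ⟨s, fun φ => ?_⟩
    rw [Set.mem_preimage, toScheme_map]
    change PrimeSpectrum.comap φ.toRingHom ⊥ ∈ classify e A J ⁻¹' W ↔ _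
    rw [hs]
    exact Iff.rfl

end Compare

/-! ### Inverse systems and the four loci -/

section InverseSystem

variable {K : Type u} [Field K] {n : ℕ}

/-- The action `f ⌟ g` of `f ∈ R = K[α₁,…,αₙ]` on `g ∈ S = K[x₁,…,xₙ]` by partial derivation: it is
bilinear, and `α^a ⌟ x^b` is `b! / (b - a)! • x^(b - a)` if `a ≤ b` and `0` otherwise. -/
def contract (f g : MvPolynomial (Fin n) K) : MvPolynomial (Fin n) K :=
  ∑ a ∈ f.support, ∑ b ∈ g.support,
    monomial (b - a) (f.coeff a * g.coeff b * ((∏ i, (b i).descFactorial (a i) : ℕ) : K))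

/-- The inverse system `I^⊥ = {g ∈ S | I ⌟ g = 0}`. -/
def inverseSystem (I : Ideal (MvPolynomial (Fin n) K)) : Set (MvPolynomial (Fin n) K) :=
  {g | ∀ f ∈ I, contract f g = 0}

/-- `x` and `y` are linearly independent linear forms in `S`. -/
def IndepForms (x y : MvPolynomial (Fin n) K) : Prop :=
  x.IsHomogeneous 1 ∧ y.IsHomogeneous 1 ∧ LinearIndependent K ![x, y]

variable (K n) (H : ℕ → ℕ)

/-- Ideals orthogonal to `x⁴` and `x²y`, with `x`, `y` linearly independent linear forms. -/
def locusI : Set (GradedHilb K n H) :=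
  {I | ∃ x y, IndepForms x y ∧ x ^ 4 ∈ inverseSystem I.ideal ∧ x ^ 2 * y ∈ inverseSystem I.ideal}

/-- Ideals orthogonal to `x³y`, with `x`, `y` linearly independent linear forms. -/
def locusII : Set (GradedHilb K n H) :=
  {I | ∃ x y, IndepForms x y ∧ x ^ 3 * y ∈ inverseSystem I.ideal}

/-- Ideals orthogonal to `x⁴` and `y³`, with `x`, `y` linearly independent linear forms. -/
def locusIII : Set (GradedHilb K n H) :=
  {I | ∃ x y, IndepForms x y ∧ x ^ 4 ∈ inverseSystem I.ideal ∧ y ^ 3 ∈ inverseSystem I.ideal}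

/-- Ideals orthogonal to `x⁴ + y⁴`, with `x`, `y` linearly independent linear forms. -/
def locusIV : Set (GradedHilb K n H) :=
  {I | ∃ x y, IndepForms x y ∧ x ^ 4 + y ^ 4 ∈ inverseSystem I.ideal}

end InverseSystem

/-- The Hilbert function `(1, n, 2, 2, 1)`. -/
def hilb1n221 (n : ℕ) : ℕ → ℕ
  | 0 => 1
  | 1 => n
  | 2 => 2
  | 3 => 2
  | 4 => 1
  | _ => 0

end

end GradedHilbert

/-! Geometrically, an ideal with Hilbert function `(1, n, 2, 2, 1)` is a length-two subscheme `Z` of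
projective space together with a hyperplane of quartics containing those that vanish on `Z`. Write
`Z = Spec Q` with `Q = K[ω]/(ω² - s ω - r)`, embedded by the point `u + ω v`. In degrees 2 and 3 the
ideal consists of the forms vanishing at `u + ω v`; in degree 4 it is the kernel of evaluation
followed by a functional `1 ↦ 1`, `ω ↦ t` on `Q`. A `Datum` records `u, v, r, s, t` and linear forms
`a, b` dual to `u, v`; it makes sense over every ring and always yields a flat family
(`Datum.isFamily`).

In characteristic zero every ideal arises in this way, over any field (`exists_fam_eq`): there are
linear forms `l, m` with `l³, l²m` independent modulo the ideal and `l⁴` outside it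
(`exists_isAdapted`), and the structure constants of the quotient in these bases form a datum
(`IsAdapted.exists_datum`).

Two functions of `(r, s, t)` separate the loci: the discriminant `s² + 4r`, which vanishes when `Z`
is non-reduced, and `t² - s t - r`, which vanishes when the functional on `Q` kills a nonzero ideal.
Both conditions are intrinsic to the ideal (`disc_eq_zero_iff`, `nrm_eq_zero_iff`). Over an
algebraically closed field a change of generator makes `r = 0`, and the dual forms can be read off:
neither vanishes in (iv), only the second in (iii), only the first in (ii), both in (i).

For fixed `a, b` the ideals form an open chart, with coordinates `r, s, t` and the `2(n - 2)`
remaining coordinates of `u` and `v`. These coordinates are ratios of values of functionals on the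
graded pieces, and polynomial conditions on such values are closed (`isClosed_forall_functionals`),
so the chart carries the Zariski topology (`Frame.isInducing_fam_chartAt`). Each locus is given by a
`Stratum`: `(r, s, t)` is a polynomial function of `k` free parameters off a hypersurface. This
yields the dimension `2(n - 2) + k`, and the closure relations by density of the complement of the
hypersurface.

For irreducibility, a universal datum lives over a localization of a polynomial ring, a domain whose
`K`-points sweep out the locus. Since `exists_fam_eq` also applies over residue fields, the spectrum
of the domain with all `(r, s, t)` surjects onto any scheme representing the functor. -/

namespace GradedHilbert

open MvPolynomial

noncomputable section

/-! ### Linear forms -/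

section LinearForms

variable {A : Type u} [CommRing A] {n : ℕ}

/-- The linear form with coefficients `c`. -/
def lform (c : Fin n → A) : MvPolynomial (Fin n) A := ∑ i, C (c i) * X i

theorem lform_isHomogeneous (c : Fin n → A) : (lform c).IsHomogeneous 1 :=
  IsHomogeneous.sum _ _ _ fun i _ => isHomogeneous_C_mul_X _ i

theorem lform_pow_isHomogeneous (c : Fin n → A) (d : ℕ) : (lform c ^ d).IsHomogeneous d := by
  simpa using (lform_isHomogeneous c).pow d

theorem coeff_single_lform (c : Fin n → A) (i : Fin n) :
    coeff (Finsupp.single i 1) (lform c) = c i := by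
  rw [lform, coeff_sum]
  simp [coeff_C_mul, coeff_X, Finsupp.single_left_inj]

theorem lform_add (c d : Fin n → A) : lform (c + d) = lform c + lform d := by
  simp [lform, add_mul, Finset.sum_add_distrib]

theorem lform_smul (k : A) (c : Fin n → A) : lform (k • c) = C k * lform c := by
  simp [lform, Finset.mul_sum, mul_assoc]

theorem exists_eq_single_add {m : Fin n →₀ ℕ} {d : ℕ} (hm : m.degree = d + 1) :
    ∃ (i : Fin n) (m' : Fin n →₀ ℕ), m'.degree = d ∧ m = Finsupp.single i 1 + m' := by
  obtain ⟨i, hi⟩ : ∃ i, m i ≠ 0 := by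
    by_contra! h
    have : m = 0 := Finsupp.ext h
    simp [this] at hm
  have hm' : Finsupp.single i 1 + (m - Finsupp.single i 1) = m := by
    refine add_tsub_cancel_of_le ?_
    rw [Finsupp.single_le_iff]
    omega
  refine ⟨i, m - Finsupp.single i 1, ?_, hm'.symm⟩
  have := congrArg Finsupp.degree hm'
  rw [map_add, Finsupp.degree_single] at this
  omega

theorem eq_lform_of_isHomogeneous {f : MvPolynomial (Fin n) A} (hf : f.IsHomogeneous 1) :
    f = lform fun i => coeff (Finsupp.single i 1) f := by
  ext m
  by_cases hm : m.degree = 1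
  · obtain ⟨i, rfl⟩ : ∃ i, m = Finsupp.single i 1 := by
      obtain ⟨i, m', hm', rfl⟩ := exists_eq_single_add hm
      rw [Finsupp.degree_eq_zero_iff] at hm'
      exact ⟨i, by rw [hm', add_zero]⟩
    rw [coeff_single_lform]
  · rw [hf.coeff_eq_zero hm, (lform_isHomogeneous _).coeff_eq_zero hm]

theorem homogeneousComponent_X_mul (i : Fin n) (f : MvPolynomial (Fin n) A) (d : ℕ) :
    homogeneousComponent (d + 1) (X i * f) = X i * homogeneousComponent d f := by
  induction f using MvPolynomial.induction_on' with
  | monomial m c =>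
    have h1 : (monomial m c : MvPolynomial (Fin n) A) ∈ homogeneousSubmodule (Fin n) A m.degree :=
      isHomogeneous_monomial c rfl
    have h2 : X i * (monomial m c : MvPolynomial (Fin n) A)
        ∈ homogeneousSubmodule (Fin n) A (1 + m.degree) :=
      (isHomogeneous_X A i).mul h1
    rw [homogeneousComponent_of_mem h1, homogeneousComponent_of_mem h2, mul_ite, mul_zero]
    exact if_congr (by omega) rfl rfl
  | add p q hp hq => rw [mul_add, map_add, hp, hq, map_add, mul_add]

theorem homogeneousComponent_zero_X_mul (i : Fin n) (f : MvPolynomial (Fin n) A) :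
    homogeneousComponent 0 (X i * f) = 0 := by
  rw [homogeneousComponent_zero, coeff_X_mul']
  simp

/-- To prove a statement about all forms of degree `d + 1`, multiply forms of degree `d` by
variables. -/
theorem isHomogeneous_succ_induction {d : ℕ} {p : MvPolynomial (Fin n) A → Prop} (h0 : p 0)
    (hadd : ∀ f g, p f → p g → p (f + g))
    (hX : ∀ i f, f.IsHomogeneous d → p (X i * f)) {f : MvPolynomial (Fin n) A}
    (hf : f.IsHomogeneous (d + 1)) : p f := by
  rw [← support_sum_monomial_coeff f]
  refine Finset.sum_induction _ p hadd h0 fun m hm => ?_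
  have hd : m.degree = d + 1 := by
    by_contra h
    exact mem_support_iff.1 hm (hf.coeff_eq_zero h)
  obtain ⟨i, m', hm', h⟩ := exists_eq_single_add hd
  have h1 : (monomial m (coeff m f) : MvPolynomial (Fin n) A)
      = X i * monomial m' (coeff m f) := by
    rw [X, monomial_mul, ← h, one_mul]
  rw [h1]
  exact hX _ _ (isHomogeneous_monomial _ hm')

end LinearForms

/-! ### The ideals attached to a pair of vectors and a quadratic algebra -/

/-- Vectors `u, v` forming part of a basis, with dual vectors `a, b`, a quadratic algebra
`A[ω]`, `ω² = r + s ω`, and the linear functional on it with `1 ↦ 1` and `ω ↦ t`. -/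
@[ext] structure Datum (A : Type u) [CommRing A] (n : ℕ) where
  u : Fin n → A
  v : Fin n → A
  a : Fin n → A
  b : Fin n → A
  r : A
  s : A
  t : A
  au : ∑ i, a i * u i = 1
  av : ∑ i, a i * v i = 0
  bu : ∑ i, b i * u i = 0
  bv : ∑ i, b i * v i = 1

namespace Datum

section Ring

variable {A : Type u} [CommRing A] {n : ℕ} (D : Datum A n)

/-- Evaluation at `u + ω v`. -/
def ev : MvPolynomial (Fin n) A →ₐ[A] QuadraticAlgebra A D.r D.s :=
  aeval fun i => ⟨D.u i, D.v i⟩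

/-- The functional `1 ↦ 1`, `ω ↦ t`. -/
def ell : QuadraticAlgebra A D.r D.s →ₗ[A] A where
  toFun z := z.re + D.t * z.im
  map_add' z w := by simp; ring
  map_smul' c z := by simp; ring

theorem ell_apply (z : QuadraticAlgebra A D.r D.s) : D.ell z = z.re + D.t * z.im := rfl

@[simp] theorem ev_X (i : Fin n) : D.ev (X i) = ⟨D.u i, D.v i⟩ := aeval_X _ i

theorem ev_C (c : A) : D.ev (C c) = ⟨c, 0⟩ := by
  rw [ev, aeval_C]; rfl

theorem ev_lform (c : Fin n → A) : D.ev (lform c) = ⟨∑ i, c i * D.u i, ∑ i, c i * D.v i⟩ := by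
  have h : ∀ s : Finset (Fin n), ∑ i ∈ s, D.ev (C (c i) * X i)
      = ⟨∑ i ∈ s, c i * D.u i, ∑ i ∈ s, c i * D.v i⟩ := by
    classical
    intro s
    induction s using Finset.induction_on with
    | empty => rfl
    | insert i s hi ih =>
      rw [Finset.sum_insert hi, ih, Finset.sum_insert hi, Finset.sum_insert hi, map_mul, ev_C,
        ev_X]
      ext <;> simp
  rw [lform, map_sum, h]

@[simp] theorem ev_lform_a : D.ev (lform D.a) = 1 := by
  rw [ev_lform, D.au, D.av]; rfl

@[simp] theorem ev_lform_b : D.ev (lform D.b) = ⟨0, 1⟩ := by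
  rw [ev_lform, D.bu, D.bv]

/-- The conditions on a form of degree `d` to belong to the ideal. -/
def deg : ℕ → Submodule A (MvPolynomial (Fin n) A)
  | 0 => ⊥
  | 1 => ⊥
  | 2 => LinearMap.ker D.ev.toLinearMap
  | 3 => LinearMap.ker D.ev.toLinearMap
  | 4 => LinearMap.ker (D.ell ∘ₗ D.ev.toLinearMap)
  | _ => ⊤

/-- Multiplicativity of `ev` carries the degree 2 condition to degree 3, and the degree 3 condition
into the weaker condition in degree 4; so the graded conditions define an ideal. -/
theorem X_mul_mem_deg {d : ℕ} {f : MvPolynomial (Fin n) A} (hf : f ∈ D.deg d) (i : Fin n) :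
    X i * f ∈ D.deg (d + 1) := by
  match d, hf with
  | 0, hf => obtain rfl : f = 0 := hf; simp
  | 1, hf => obtain rfl : f = 0 := hf; simp
  | 2, hf =>
    replace hf : D.ev f = 0 := hf
    change D.ev (X i * f) = 0
    rw [map_mul, hf, mul_zero]
  | 3, hf =>
    replace hf : D.ev f = 0 := hf
    change D.ell (D.ev (X i * f)) = 0
    rw [map_mul, hf, mul_zero, map_zero]
  | _ + 4, _ => exact Submodule.mem_top

/-- The ideal of a datum. -/
def ideal : Ideal (MvPolynomial (Fin n) A) where
  carrier := {f | ∀ d, homogeneousComponent d f ∈ D.deg d}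
  zero_mem' d := by simp
  add_mem' hf hg d := by rw [map_add]; exact add_mem (hf d) (hg d)
  smul_mem' p f hf := by
    induction p using MvPolynomial.induction_on generalizing f with
    | C c =>
      intro d
      rw [smul_eq_mul, homogeneousComponent_C_mul, ← smul_eq_C_mul]
      exact Submodule.smul_mem _ _ (hf d)
    | add p q hp hq =>
      intro d
      rw [add_smul, map_add]
      exact add_mem (hp _ hf d) (hq _ hf d)
    | mul_X p i hp =>
      rw [mul_smul, smul_eq_mul]
      refine hp _ fun d => ?_
      cases d with
      | zero => rw [smul_eq_mul, homogeneousComponent_zero_X_mul]; exact zero_mem _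
      | succ d => rw [smul_eq_mul, homogeneousComponent_X_mul]; exact D.X_mul_mem_deg (hf d) i

theorem mem_ideal_iff {f : MvPolynomial (Fin n) A} :
    f ∈ D.ideal ↔ ∀ d, homogeneousComponent d f ∈ D.deg d := Iff.rfl

theorem mem_ideal_iff_of_isHomogeneous {f : MvPolynomial (Fin n) A} {d : ℕ}
    (hf : f.IsHomogeneous d) : f ∈ D.ideal ↔ f ∈ D.deg d := by
  rw [mem_ideal_iff]
  constructor
  · intro h
    have := h d
    rwa [homogeneousComponent_eq_self hf] at this
  · intro h e
    rw [homogeneousComponent_of_mem hf]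
    split_ifs with he
    · rwa [he]
    · exact zero_mem _

theorem mem_ideal_two {f : MvPolynomial (Fin n) A} (hf : f.IsHomogeneous 2) :
    f ∈ D.ideal ↔ D.ev f = 0 := D.mem_ideal_iff_of_isHomogeneous hf

theorem mem_ideal_three {f : MvPolynomial (Fin n) A} (hf : f.IsHomogeneous 3) :
    f ∈ D.ideal ↔ D.ev f = 0 := D.mem_ideal_iff_of_isHomogeneous hf

theorem mem_ideal_four {f : MvPolynomial (Fin n) A} (hf : f.IsHomogeneous 4) :
    f ∈ D.ideal ↔ D.ell (D.ev f) = 0 := D.mem_ideal_iff_of_isHomogeneous hf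

/-- A form of degree `d + 1` with prescribed value at `u + ω v`. -/
def lift (d : ℕ) (z : QuadraticAlgebra A D.r D.s) : MvPolynomial (Fin n) A :=
  (C z.re * lform D.a + C z.im * lform D.b) * lform D.a ^ d

theorem lift_isHomogeneous (d : ℕ) (z : QuadraticAlgebra A D.r D.s) :
    (D.lift d z).IsHomogeneous (d + 1) := by
  rw [add_comm d 1]
  exact (((lform_isHomogeneous _).C_mul _).add ((lform_isHomogeneous _).C_mul _)).mul
    (lform_pow_isHomogeneous _ d)

@[simp] theorem ev_lift (d : ℕ) (z : QuadraticAlgebra A D.r D.s) : D.ev (D.lift d z) = z := by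
  simp only [lift, map_mul, map_add, map_pow, ev_C, ev_lform_a, ev_lform_b, one_pow, mul_one]
  ext <;> simp

end Ring

end Datum

theorem mk_piece_eq_zero_iff {A : Type u} [CommRing A] {n : ℕ}
    (J : Ideal (MvPolynomial (Fin n) A)) {d : ℕ} (f : homogeneousSubmodule (Fin n) A d) :
    (Submodule.Quotient.mk f : piece J d) = 0 ↔ f.1 ∈ J :=
  Submodule.Quotient.mk_eq_zero _

/-- Flatness and constant rank are obtained together, with no assumption on the base ring, by
identifying the quotient with a free module. -/
theorem projective_rank_of_surjective {A : Type u} [CommRing A] {M : Type u} [AddCommGroup M]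
    [Module A M] (N : Submodule A M) (k : ℕ) (q : M →ₗ[A] (Fin k → A))
    (hq : Function.Surjective q) (hN : ∀ x, x ∈ N ↔ q x = 0) :
    Module.Projective A (M ⧸ N) ∧ ∀ p : PrimeSpectrum A, Module.rankAtStalk (M ⧸ N) p = k := by
  have h : N = LinearMap.ker q := Submodule.ext fun x => hN x
  let e : (M ⧸ N) ≃ₗ[A] (Fin k → A) :=
    (Submodule.quotEquivOfEq _ _ h).trans (q.quotKerEquivOfSurjective hq)
  refine ⟨Module.Projective.of_equiv e.symm, fun p => ?_⟩
  have : Nontrivial A := ⟨⟨0, 1, fun h => p.isPrime.one_notMem (h ▸ zero_mem _)⟩⟩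
  rw [Module.rankAtStalk_eq_of_equiv e, Module.rankAtStalk_eq_finrank_of_free]
  simp

namespace Datum

/-! ### Flatness and base change of the family of a datum. -/

section Family

variable {A : Type u} [CommRing A] {n : ℕ} (D : Datum A n)

/-- In each degree the ideal is the kernel of an explicit surjection onto a free module. From degree
2 on, surjectivity comes from `lift`, which produces a form of any positive degree with prescribed
value at `u + ω v`. -/
theorem isFamily : IsFamily (hilb1n221 n) D.ideal := by
  have key : ∀ d, Module.Projective A (piece D.ideal d) ∧
      ∀ p : PrimeSpectrum A, Module.rankAtStalk (piece D.ideal d) p = hilb1n221 n d := by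
    intro d
    match d with
    | 0 =>
      refine projective_rank_of_surjective _ 1
        (LinearMap.pi fun _ => lcoeff A (0 : Fin n →₀ ℕ) ∘ₗ Submodule.subtype _) ?_ ?_
      · intro z
        refine ⟨⟨C (z 0), isHomogeneous_C _ _⟩, ?_⟩
        ext i
        obtain rfl : i = 0 := Subsingleton.elim _ _
        simp [lcoeff]
      · rintro ⟨f, hf⟩
        rw [Submodule.mem_comap]
        refine (D.mem_ideal_iff_of_isHomogeneous hf).trans ?_
        have h1 : f = C (coeff 0 f) := by
          rw [← homogeneousComponent_zero, homogeneousComponent_eq_self hf]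
        constructor
        · intro h
          obtain rfl : f = 0 := h
          ext i; simp
        · intro h
          have : coeff 0 f = 0 := congrFun h 0
          change f = 0
          rw [h1, this, C_0]
    | 1 =>
      refine projective_rank_of_surjective _ n
        (LinearMap.pi fun i => lcoeff A (Finsupp.single i 1) ∘ₗ Submodule.subtype _) ?_ ?_
      · intro z
        refine ⟨⟨lform z, lform_isHomogeneous z⟩, ?_⟩
        ext i
        exact coeff_single_lform z i
      · rintro ⟨f, hf⟩
        rw [Submodule.mem_comap]
        refine (D.mem_ideal_iff_of_isHomogeneous hf).trans ?_
        constructor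
        · intro h
          obtain rfl : f = 0 := h
          ext i; simp
        · intro h
          change f = 0
          rw [eq_lform_of_isHomogeneous hf]
          have : (fun i => coeff (Finsupp.single i 1) f) = (0 : Fin n → A) := h
          rw [this]
          simp [lform]
    | 2 =>
      refine projective_rank_of_surjective _ 2
        ((QuadraticAlgebra.linearEquivTuple D.r D.s).toLinearMap ∘ₗ D.ev.toLinearMap ∘ₗ
          Submodule.subtype _) ?_ ?_
      · intro z
        refine ⟨⟨D.lift 1 ((QuadraticAlgebra.linearEquivTuple D.r D.s).symm z),
          D.lift_isHomogeneous 1 _⟩, ?_⟩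
        ext i
        fin_cases i <;> simp
      · rintro ⟨f, hf⟩
        rw [Submodule.mem_comap]
        exact (D.mem_ideal_two hf).trans
          (QuadraticAlgebra.linearEquivTuple D.r D.s).map_eq_zero_iff.symm
    | 3 =>
      refine projective_rank_of_surjective _ 2
        ((QuadraticAlgebra.linearEquivTuple D.r D.s).toLinearMap ∘ₗ D.ev.toLinearMap ∘ₗ
          Submodule.subtype _) ?_ ?_
      · intro z
        refine ⟨⟨D.lift 2 ((QuadraticAlgebra.linearEquivTuple D.r D.s).symm z),
          D.lift_isHomogeneous 2 _⟩, ?_⟩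
        ext i
        fin_cases i <;> simp
      · rintro ⟨f, hf⟩
        rw [Submodule.mem_comap]
        exact (D.mem_ideal_three hf).trans
          (QuadraticAlgebra.linearEquivTuple D.r D.s).map_eq_zero_iff.symm
    | 4 =>
      refine projective_rank_of_surjective _ 1
        (LinearMap.pi fun _ => D.ell ∘ₗ D.ev.toLinearMap ∘ₗ Submodule.subtype _) ?_ ?_
      · intro z
        -- The functional takes `1` to `1`, so a constant value already gives a preimage.
        refine ⟨⟨D.lift 3 ⟨z 0, 0⟩, D.lift_isHomogeneous 3 _⟩, ?_⟩
        ext i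
        obtain rfl : i = 0 := Subsingleton.elim _ _
        simp [ell_apply]
      · rintro ⟨f, hf⟩
        rw [Submodule.mem_comap]
        refine (D.mem_ideal_four hf).trans ?_
        constructor
        · intro h
          ext i
          exact h
        · intro h
          exact congrFun h 0
    | d + 5 =>
      refine projective_rank_of_surjective _ 0 0 (fun z => ⟨0, Subsingleton.elim _ _⟩) ?_
      rintro ⟨f, hf⟩
      rw [Submodule.mem_comap]
      exact (D.mem_ideal_iff_of_isHomogeneous hf).trans (by simp [deg])
  refine ⟨fun f hf d e => ?_, fun d => (key d).1, fun d => (key d).2⟩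
  rw [homogeneousComponent_of_mem (homogeneousComponent_mem d f)]
  split_ifs with h
  · rw [h]; exact hf d
  · exact zero_mem _

/-- The family of ideals of a datum. -/
def fam : Points A n (hilb1n221 n) := ⟨D.ideal, D.isFamily⟩

variable {B : Type u} [CommRing B]

/-- Base change of data. -/
def map (φ : A →+* B) : Datum B n where
  u i := φ (D.u i)
  v i := φ (D.v i)
  a i := φ (D.a i)
  b i := φ (D.b i)
  r := φ D.r
  s := φ D.s
  t := φ D.t
  au := by simpa using congrArg φ D.au
  av := by simpa using congrArg φ D.av
  bu := by simpa using congrArg φ D.bu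
  bv := by simpa using congrArg φ D.bv

theorem ev_map (φ : A →+* B) (f : MvPolynomial (Fin n) A) :
    (D.map φ).ev (MvPolynomial.map φ f) = ⟨φ (D.ev f).re, φ (D.ev f).im⟩ := by
  induction f using MvPolynomial.induction_on with
  | C c => rw [map_C, ev_C, ev_C, map_zero]
  | add p q hp hq =>
    rw [map_add, map_add, hp, hq, map_add]
    ext <;> simp
  | mul_X p i hp =>
    rw [map_mul, map_mul, hp, map_X, ev_X, map_mul, ev_X, QuadraticAlgebra.mk_mul_mk]
    ext <;> simp [map]

theorem homogeneousComponent_map (φ : A →+* B) (f : MvPolynomial (Fin n) A) (d : ℕ) :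
    homogeneousComponent d (MvPolynomial.map φ f)
      = MvPolynomial.map φ (homogeneousComponent d f) := by
  ext m
  simp only [coeff_homogeneousComponent, coeff_map]
  split_ifs <;> simp

/-- One inclusion suffices: over a field both ideals have the same Hilbert function, so equality is
automatic. -/
theorem map_ideal_le (φ : A →+* B) :
    D.ideal.map (MvPolynomial.map φ) ≤ (D.map φ).ideal := by
  rw [Ideal.map_le_iff_le_comap]
  intro f hf d
  rw [homogeneousComponent_map]
  have hd := hf d
  revert hd
  generalize homogeneousComponent d f = g
  intro hg
  match d, hg with
  | 0, hg => obtain rfl : g = 0 := hg; simp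
  | 1, hg => obtain rfl : g = 0 := hg; simp
  | 2, hg =>
    replace hg : D.ev g = 0 := hg
    change (D.map φ).ev _ = 0
    rw [ev_map, hg]; simp; rfl
  | 3, hg =>
    replace hg : D.ev g = 0 := hg
    change (D.map φ).ev _ = 0
    rw [ev_map, hg]; simp; rfl
  | 4, hg =>
    replace hg : D.ell (D.ev g) = 0 := hg
    change (D.map φ).ell ((D.map φ).ev _) = 0
    rw [ell_apply] at hg
    rw [ev_map, ell_apply]
    simpa [map] using congrArg φ hg
  | _ + 5, _ => exact Submodule.mem_top

end Family

end Datum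

/-! ### Ideals over a field -/

section Field

variable {K : Type u} [Field K] {n : ℕ}

theorem mem_of_homogeneousComponent_mem {I : Ideal (MvPolynomial (Fin n) K)}
    {f : MvPolynomial (Fin n) K} (h : ∀ d, homogeneousComponent d f ∈ I) : f ∈ I := by
  rw [← sum_homogeneousComponent f]
  exact Ideal.sum_mem _ fun d _ => h d

theorem finrank_piece {H : ℕ → ℕ} (I : Points K n H) (d : ℕ) :
    Module.finrank K (piece I.ideal d) = H d :=
  ((isFamily_iff_of_field H I.ideal).1 I.isFamily).2 d

/-- Two ideals with the same Hilbert function are equal as soon as one contains the other. -/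
theorem Points.eq_of_le {H : ℕ → ℕ} {I J : Points K n H} (h : I.ideal ≤ J.ideal) : I = J := by
  refine Points.ext (le_antisymm h fun f hf => mem_of_homogeneousComponent_mem fun d => ?_)
  let N := fun I : Points K n H =>
    (I.ideal.restrictScalars K).comap (homogeneousSubmodule (Fin n) K d).subtype
  have h1 : N I ≤ N J := fun x hx => h hx
  have hI := (N I).finrank_quotient_add_finrank
  have hJ := (N J).finrank_quotient_add_finrank
  have hI' : Module.finrank K (homogeneousSubmodule (Fin n) K d ⧸ N I) = H d := finrank_piece I d
  have hJ' : Module.finrank K (homogeneousSubmodule (Fin n) K d ⧸ N J) = H d := finrank_piece J d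
  have h2 : N I = N J := Submodule.eq_of_le_of_finrank_eq h1 (by omega)
  have h3 : (⟨homogeneousComponent d f, homogeneousComponent_mem d f⟩ :
      homogeneousSubmodule (Fin n) K d) ∈ N J := J.isFamily.homogeneous f hf d
  rw [← h2] at h3
  exact h3

/-- It suffices to compare the two ideals in each degree. -/
theorem Points.eq_of_forall_mem {H : ℕ → ℕ} {I J : Points K n H}
    (h : ∀ d, ∀ f ∈ I.ideal, f.IsHomogeneous d → f ∈ J.ideal) : I = J :=
  Points.eq_of_le fun f hf => mem_of_homogeneousComponent_mem fun d =>
    h d _ (I.isFamily.homogeneous f hf d) (homogeneousComponent_isHomogeneous d f)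

namespace Datum

theorem fam_map {A : Type u} [CommRing A] (D : Datum A n) (φ : A →+* K) :
    D.fam.map φ = (D.map φ).fam :=
  Points.eq_of_le (D.map_ideal_le φ)

end Datum

/-- An ideal with Hilbert function `(1, n, 2, 2, 1)` has no forms of degree `0` or `1`. -/
theorem eq_zero_of_mem_of_isHomogeneous (I : GradedHilb K n (hilb1n221 n)) {d : ℕ} (hd : d < 2)
    {f : MvPolynomial (Fin n) K} (hf : f.IsHomogeneous d) (hfI : f ∈ I.ideal) : f = 0 := by
  let N := (I.ideal.restrictScalars K).comap (homogeneousSubmodule (Fin n) K d).subtype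
  have h1 : Module.finrank K (homogeneousSubmodule (Fin n) K d) ≤ hilb1n221 n d := by
    interval_cases d
    · let q : homogeneousSubmodule (Fin n) K 0 →ₗ[K] K :=
        lcoeff K (0 : Fin n →₀ ℕ) ∘ₗ Submodule.subtype _
      have hq : Function.Injective q := by
        rw [injective_iff_map_eq_zero]
        rintro ⟨f, hf⟩ h
        replace h : coeff 0 f = 0 := h
        ext1
        change f = 0
        rw [← homogeneousComponent_eq_self hf, homogeneousComponent_zero, h, C_0]
      exact (LinearMap.finrank_le_finrank_of_injective hq).trans (by simp [hilb1n221])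
    · let q : homogeneousSubmodule (Fin n) K 1 →ₗ[K] (Fin n → K) :=
        LinearMap.pi fun i => lcoeff K (Finsupp.single i 1) ∘ₗ Submodule.subtype _
      have hq : Function.Injective q := by
        rw [injective_iff_map_eq_zero]
        rintro ⟨f, hf⟩ h
        replace h : (fun i => coeff (Finsupp.single i 1) f) = (0 : Fin n → K) := h
        ext1
        change f = 0
        rw [eq_lform_of_isHomogeneous hf, h]
        simp [lform]
      exact (LinearMap.finrank_le_finrank_of_injective hq).trans (by simp [hilb1n221])
  have h2 := N.finrank_quotient_add_finrank
  have h3 : Module.finrank K (homogeneousSubmodule (Fin n) K d ⧸ N) = hilb1n221 n d :=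
    finrank_piece I d
  -- The quotient already has at least the dimension of the space of all forms of this degree.
  have h4 : Module.finrank K N = 0 := by omega
  rw [Submodule.finrank_eq_zero] at h4
  have h5 : (⟨f, hf⟩ : homogeneousSubmodule (Fin n) K d) ∈ N := hfI
  rw [h4, Submodule.mem_bot] at h5
  exact congrArg Subtype.val h5

namespace Datum

/-- An ideal is the ideal of a datum as soon as its forms of degree `3` and `4` are contained in
the latter. -/
theorem eq_fam (D : Datum K n) (I : GradedHilb K n (hilb1n221 n))
    (h3 : ∀ f ∈ I.ideal, f.IsHomogeneous 3 → D.ev f = 0)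
    (h4 : ∀ f ∈ I.ideal, f.IsHomogeneous 4 → D.ell (D.ev f) = 0) : I = D.fam := by
  refine Points.eq_of_forall_mem fun d f hf hd => (D.mem_ideal_iff_of_isHomogeneous hd).2 ?_
  match d with
  | 0 => rw [eq_zero_of_mem_of_isHomogeneous I (by norm_num) hd hf]; exact zero_mem _
  | 1 => rw [eq_zero_of_mem_of_isHomogeneous I (by norm_num) hd hf]; exact zero_mem _
  | 2 =>
    -- The form `a` takes the value `1` at `u + ω v`, so multiplying by it transports the cubic
    -- condition back to quadrics.
    have := h3 (lform D.a * f) (I.ideal.mul_mem_left _ hf) ((lform_isHomogeneous _).mul hd)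
    rwa [map_mul, ev_lform_a, one_mul] at this
  | 3 => exact h3 f hf hd
  | 4 => exact h4 f hf hd
  | _ + 5 => exact Submodule.mem_top

/-- The datum with `ω` replaced by `ω + c`. -/
def shift (D : Datum K n) (c : K) : Datum K n where
  -- The new generator is `ω' = ω - c`, so that `u + ω v = (u + c v) + ω' v`; the other fields are
  -- the relation, dual basis and functional rewritten for `ω'`.
  u i := D.u i + c * D.v i
  v := D.v
  a := D.a
  b i := D.b i - c * D.a i
  r := D.r + D.s * c - c ^ 2
  s := D.s - 2 * c
  t := D.t - c
  au := by
    simp only [mul_add, Finset.sum_add_distrib, mul_left_comm _ c, ← Finset.mul_sum, D.au, D.av]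
    ring
  av := D.av
  bu := by
    simp only [mul_add, sub_mul, Finset.sum_add_distrib, Finset.sum_sub_distrib, mul_assoc,
      mul_left_comm _ c, ← Finset.mul_sum, D.au, D.av, D.bu, D.bv]
    ring
  bv := by
    simp only [sub_mul, Finset.sum_sub_distrib, mul_assoc, ← Finset.mul_sum, D.av, D.bv]
    ring

theorem ev_shift (D : Datum K n) (c : K) (f : MvPolynomial (Fin n) K) :
    (D.shift c).ev f = ⟨(D.ev f).re + c * (D.ev f).im, (D.ev f).im⟩ := by
  induction f using MvPolynomial.induction_on with
  | C c => rw [ev_C, ev_C]; simp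
  | add p q hp hq =>
    rw [map_add, hp, hq, map_add]
    ext
    · simp; ring
    · simp
  | mul_X p i hp =>
    rw [map_mul, hp, ev_X, map_mul, ev_X, QuadraticAlgebra.mk_mul_mk]
    ext <;> simp [shift] <;> ring

/-- Only the basis of the quadratic algebra changes; the point `u + ω v` and the functional stay the
same. -/
theorem fam_shift (D : Datum K n) (c : K) : (D.shift c).fam = D.fam := by
  refine eq_fam D _ (fun f hf hd => ?_) (fun f hf hd => ?_)
  · have h := ((D.shift c).mem_ideal_three hd).1 hf
    rw [ev_shift] at h
    have h1 : (D.ev f).im = 0 := congrArg QuadraticAlgebra.im h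
    have h2 : (D.ev f).re + c * (D.ev f).im = 0 := congrArg QuadraticAlgebra.re h
    ext
    · simpa [h1] using h2
    · exact h1
  · have h := ((D.shift c).mem_ideal_four hd).1 hf
    rw [ev_shift, ell_apply] at h
    rw [ell_apply, ← h]
    simp [shift]; ring

end Datum

end Field

/-! ### Closed conditions on the functionals vanishing on an ideal -/

section Functionals

variable {A B : Type u} [CommRing A] [CommRing B] [Algebra A B] {n : ℕ}
  (J : Ideal (MvPolynomial (Fin n) A)) (d : ℕ)

/-- Projectivity of the graded piece lifts a functional on a fibre along the surjection `A → B`. -/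
theorem exists_functional_lift (hAB : Function.Surjective (algebraMap A B))
    [Module.Projective A (piece J d)]
    (lam : piece (J.map (MvPolynomial.map (algebraMap A B))) d →ₗ[B] B) :
    ∃ L : piece J d →ₗ[A] A, ∀ x, algebraMap A B (L x) = lam (pieceMap J d x) := by
  obtain ⟨L, hL⟩ := Module.projective_lifting_property (Algebra.linearMap A B)
    (lam.restrictScalars A ∘ₗ pieceMap J d) hAB
  exact ⟨L, fun x => LinearMap.congr_fun hL x⟩

theorem exists_functional_baseChange (hJ : ∀ f ∈ J, ∀ d, homogeneousComponent d f ∈ J)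
    (L : piece J d →ₗ[A] A) :
    ∃ lam : piece (J.map (MvPolynomial.map (algebraMap A B))) d →ₗ[B] B,
      ∀ x, algebraMap A B (L x) = lam (pieceMap J d x) :=
  ⟨(pieceMap_isBaseChange J d hJ).lift (Algebra.linearMap A B ∘ₗ L), fun x =>
    ((pieceMap_isBaseChange J d hJ).lift_eq (Algebra.linearMap A B ∘ₗ L) x).symm⟩

end Functionals

section Closed

variable {K : Type u} [Field K] {n : ℕ} {H : ℕ → ℕ}

/-- The value at a form of a functional on the forms modulo an ideal. -/
def value {I : Ideal (MvPolynomial (Fin n) K)} {κ : Type} {d : κ → ℕ}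
    (lam : ∀ k, piece I (d k) →ₗ[K] K) (x : Σ k, homogeneousSubmodule (Fin n) K (d k)) : K :=
  lam x.1 (Submodule.Quotient.mk x.2)

/-- The source of all closed sets on the charts. In a family over `A`, functionals on the pieces of
the family restrict to the fibre at a `K`-point, and every functional on the fibre is such a
restriction because the pieces are projective. Hence the condition on the fibre is the vanishing
there of the elements of `A` got by evaluating `P` on functionals of the family. -/
theorem isClosed_forall_functionals {κ : Type} (d : κ → ℕ)
    (P : MvPolynomial (Σ k, homogeneousSubmodule (Fin n) K (d k)) K) :
    IsClosed {I : GradedHilb K n H | ∀ lam : ∀ k, piece I.ideal (d k) →ₗ[K] K,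
      aeval (value lam) P = 0} := by
  rw [isClosed_iff]
  intro A _ _ J
  let g (w : Σ k, homogeneousSubmodule (Fin n) K (d k)) : piece J.ideal (d w.1) :=
    Submodule.Quotient.mk ⟨MvPolynomial.map (algebraMap K A) w.2.1, w.2.2.map _⟩
  refine ⟨Set.range fun L : ∀ k, piece J.ideal (d k) →ₗ[A] A =>
    aeval (fun w => L w.1 (g w)) P, fun φ => ?_⟩
  let _ : Algebra A K := φ.toRingHom.toAlgebra
  have hφ : ∀ x, algebraMap A K x = φ x := fun x => rfl
  have hsurj : Function.Surjective (algebraMap A K) := fun x => ⟨algebraMap K A x, φ.commutes x⟩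
  have hcomp : φ.toRingHom.comp (algebraMap K A) = RingHom.id K := RingHom.ext φ.commutes
  have hg : ∀ w, pieceMap (B := K) J.ideal (d w.1) (g w) = Submodule.Quotient.mk w.2 := by
    intro w
    rw [pieceMap_mk]
    congr 1
    ext1
    change MvPolynomial.map φ.toRingHom (MvPolynomial.map (algebraMap K A) w.2.1) = w.2.1
    rw [MvPolynomial.map_map, hcomp, MvPolynomial.map_id]
  have key : ∀ (L : ∀ k, piece J.ideal (d k) →ₗ[A] A)
      (lam : ∀ k, piece (J.ideal.map (MvPolynomial.map (algebraMap A K))) (d k) →ₗ[K] K),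
      (∀ k x, algebraMap A K (L k x) = lam k (pieceMap J.ideal (d k) x)) →
      φ (aeval (fun w => L w.1 (g w)) P) = aeval (value lam) P := by
    intro L lam h
    rw [comp_aeval_apply]
    congr 2
    ext w
    rw [← hφ, h, hg]
    rfl
  constructor
  · rintro h _ ⟨L, rfl⟩
    choose lam hlam using fun k =>
      exists_functional_baseChange (B := K) J.ideal (d k) J.isFamily.homogeneous (L k)
    exact (key L lam hlam).trans (h lam)
  · intro h lam
    have := J.isFamily.projective
    choose L hL using fun k => exists_functional_lift (B := K) J.ideal (d k) hsurj (lam k)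
    exact (key L lam hL).symm.trans (h _ ⟨L, rfl⟩)

end Closed

section Charts

variable {K : Type u} [Field K] {n : ℕ}

/-! ### Ideals with a prescribed basis in degrees three and four -/

/-- `l³` and `l²m` are independent modulo `I`, and `l⁴ ∉ I`. -/
structure IsAdapted (I : Ideal (MvPolynomial (Fin n) K)) (l m : Fin n → K) : Prop where
  indep : ∀ p q : K, C p * lform l ^ 3 + C q * (lform l ^ 2 * lform m) ∈ I → p = 0 ∧ q = 0
  four : lform l ^ 4 ∉ I

theorem exists_sub_mem_of_finrank_eq_two {H : ℕ → ℕ} (I : Points K n H) {d : ℕ} (hd : H d = 2)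
    {x y : MvPolynomial (Fin n) K} (hx : x.IsHomogeneous d) (hy : y.IsHomogeneous d)
    (h : ∀ p q : K, C p * x + C q * y ∈ I.ideal → p = 0 ∧ q = 0)
    {f : MvPolynomial (Fin n) K} (hf : f.IsHomogeneous d) :
    ∃ p q : K, f - (C p * x + C q * y) ∈ I.ideal := by
  let mk : homogeneousSubmodule (Fin n) K d →ₗ[K] piece I.ideal d := Submodule.mkQ _
  have hmk : ∀ z, mk z = 0 ↔ z.1 ∈ I.ideal := mk_piece_eq_zero_iff I.ideal
  have hli : LinearIndependent K ![mk ⟨x, hx⟩, mk ⟨y, hy⟩] := by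
    rw [LinearIndependent.pair_iff]
    intro p q hpq
    refine h p q ?_
    rw [← map_smul, ← map_smul, ← map_add, hmk] at hpq
    change p • x + q • y ∈ I.ideal at hpq
    rwa [smul_eq_C_mul, smul_eq_C_mul] at hpq
  have hspan := hli.span_eq_top_of_card_eq_finrank'
    (by rw [Fintype.card_fin]; exact (finrank_piece I d).trans hd |>.symm)
  have hm : mk ⟨f, hf⟩ ∈ Submodule.span K (Set.range ![mk ⟨x, hx⟩, mk ⟨y, hy⟩]) := by
    rw [hspan]; trivial
  rw [Matrix.range_cons, Matrix.range_cons, Matrix.range_empty, Set.union_empty,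
    Set.singleton_union, Submodule.mem_span_pair] at hm
  obtain ⟨p, q, hpq⟩ := hm
  refine ⟨p, q, ?_⟩
  rw [← map_smul, ← map_smul, ← map_add, eq_comm, ← sub_eq_zero, ← map_sub, hmk] at hpq
  change f - (p • x + q • y) ∈ I.ideal at hpq
  rwa [smul_eq_C_mul, smul_eq_C_mul] at hpq

theorem exists_sub_mem_of_finrank_eq_one {H : ℕ → ℕ} (I : Points K n H) {d : ℕ} (hd : H d = 1)
    {x : MvPolynomial (Fin n) K} (hx : x.IsHomogeneous d) (h : x ∉ I.ideal)
    {f : MvPolynomial (Fin n) K} (hf : f.IsHomogeneous d) :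
    ∃ p : K, f - C p * x ∈ I.ideal := by
  let mk : homogeneousSubmodule (Fin n) K d →ₗ[K] piece I.ideal d := Submodule.mkQ _
  have hmk : ∀ z, mk z = 0 ↔ z.1 ∈ I.ideal := mk_piece_eq_zero_iff I.ideal
  have h1 : mk ⟨x, hx⟩ ≠ 0 := fun h0 => h ((hmk _).1 h0)
  obtain ⟨p, hp⟩ := (finrank_eq_one_iff_of_nonzero' _ h1).1 ((finrank_piece I d).trans hd)
    (mk ⟨f, hf⟩)
  refine ⟨p, ?_⟩
  rw [← map_smul, eq_comm, ← sub_eq_zero, ← map_sub, hmk] at hp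
  change f - p • x ∈ I.ideal at hp
  rwa [smul_eq_C_mul] at hp

namespace IsAdapted

variable {I : GradedHilb K n (hilb1n221 n)} {l m : Fin n → K}

theorem indep_two (h : IsAdapted I.ideal l m) (p q : K)
    (hpq : C p * lform l ^ 2 + C q * (lform l * lform m) ∈ I.ideal) : p = 0 ∧ q = 0 := by
  refine h.indep p q ?_
  have := I.ideal.mul_mem_left (lform l) hpq
  convert this using 1
  ring

/-- Modulo the ideal, `l², lm` is a basis in degree 2, `l³, l²m` in degree 3 and `l⁴` in degree 4.
Multiplication by linear forms in these bases is that of a quadratic algebra in which `l` acts as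
`1` and `m` as `ω`. -/
theorem exists_datum (h : IsAdapted I.ideal l m) :
    ∃ D : Datum K n, D.a = l ∧ D.b = m ∧ D.fam = I := by
  have hL := lform_isHomogeneous l
  have hM := lform_isHomogeneous m
  have hL2 := lform_pow_isHomogeneous l 2
  have hsp2 : ∀ f : MvPolynomial (Fin n) K, f.IsHomogeneous 2 →
      ∃ p q : K, f - (C p * lform l ^ 2 + C q * (lform l * lform m)) ∈ I.ideal := fun f hf =>
    exists_sub_mem_of_finrank_eq_two I rfl hL2 (hL.mul hM) h.indep_two hf
  -- The structure constants: `Xᵢ l ≡ uᵢ l² + vᵢ l m`, then `m² ≡ r l² + s l m` and `l³ m ≡ t l⁴`.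
  choose u v huv using fun i : Fin n => hsp2 (X i * lform l) ((isHomogeneous_X K i).mul hL)
  obtain ⟨r, s, hrs⟩ := hsp2 (lform m * lform m) (hM.mul hM)
  obtain ⟨t, ht⟩ := exists_sub_mem_of_finrank_eq_one I rfl (lform_pow_isHomogeneous l 4) h.four
    ((lform_pow_isHomogeneous l 3).mul hM)
  simp only [← Ideal.Quotient.eq_zero_iff_mem, map_sub, map_add, map_mul, map_pow] at huv hrs ht
  set π := Ideal.Quotient.mk I.ideal with hπ
  have hmul : ∀ c : Fin n → K, π (lform c) * π (lform l)
      = π (C (∑ i, c i * u i)) * π (lform l) ^ 2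
        + π (C (∑ i, c i * v i)) * (π (lform l) * π (lform m)) := by
    intro c
    have h1 : π (lform c) = ∑ i, π (C (c i)) * π (X i) := by simp [lform]
    have h2 : ∀ w : Fin n → K, π (C (∑ i, c i * w i)) = ∑ i, π (C (c i)) * π (C (w i)) := by
      intro w; simp
    rw [h1, h2, h2, Finset.sum_mul, Finset.sum_mul, Finset.sum_mul, ← Finset.sum_add_distrib]
    refine Finset.sum_congr rfl fun i _ => ?_
    linear_combination π (C (c i)) * huv i
  -- Expanding `l · l` and `m · l` through `hmul` and comparing coefficients gives the four duality
  -- relations.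
  have hl := h.indep_two (1 - ∑ i, l i * u i) (-∑ i, l i * v i) (by
    rw [← Ideal.Quotient.eq_zero_iff_mem]
    simp only [map_sub, map_add, map_mul, map_pow, map_neg, map_one]
    have := hmul l
    linear_combination this)
  have hm := h.indep_two (-∑ i, m i * u i) (1 - ∑ i, m i * v i) (by
    rw [← Ideal.Quotient.eq_zero_iff_mem]
    simp only [map_sub, map_add, map_mul, map_pow, map_neg, map_one]
    have := hmul m
    linear_combination this)
  let D : Datum K n :=
    { u := u, v := v, a := l, b := m, r := r, s := s, t := t
      au := (sub_eq_zero.1 hl.1).symm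
      av := neg_eq_zero.1 hl.2
      bu := neg_eq_zero.1 hm.1
      bv := (sub_eq_zero.1 hm.2).symm }
  have hone : ∀ f : MvPolynomial (Fin n) K, f.IsHomogeneous 1 → π f * π (lform l)
      = π (C (D.ev f).re) * π (lform l) ^ 2
        + π (C (D.ev f).im) * (π (lform l) * π (lform m)) := by
    intro f hf
    rw [eq_lform_of_isHomogeneous hf, D.ev_lform]
    exact hmul _
  -- Multiplication by `l` sends the basis `l², lm` to the independent pair `l³, l²m`.
  have hcancel : ∀ f : MvPolynomial (Fin n) K, f.IsHomogeneous 2 →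
      π f * π (lform l) = 0 → π f = 0 := by
    intro f hf h0
    obtain ⟨p, q, hpq⟩ := hsp2 f hf
    simp only [← Ideal.Quotient.eq_zero_iff_mem, map_sub, map_add, map_mul, map_pow] at hpq
    have h1 := h.indep p q (by
      rw [← Ideal.Quotient.eq_zero_iff_mem]
      simp only [map_add, map_mul, map_pow]
      linear_combination h0 - π (lform l) * hpq)
    rw [h1.1, h1.2] at hpq
    simpa using hpq
  -- Every form of degree at least 2 is congruent to the combination of `l^(d+2)` and `l^(d+1) m`
  -- given by its value at `u + ω v`.
  have key : ∀ d, ∀ f : MvPolynomial (Fin n) K, f.IsHomogeneous (d + 2) → π f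
      = π (C (D.ev f).re) * π (lform l) ^ (d + 2)
        + π (C (D.ev f).im) * (π (lform l) ^ (d + 1) * π (lform m)) := by
    intro d
    induction d with
    | zero =>
      intro f hf
      -- The relations reduce products `Xᵢ l`, not `Xᵢ Xⱼ`; hence in degree 2 the congruence is
      -- proved after multiplication by `l`, which is then cancelled.
      have h1 : π f * π (lform l) = π (lform l) * (π (C (D.ev f).re) * π (lform l) ^ 2
          + π (C (D.ev f).im) * (π (lform l) * π (lform m))) := by
        refine isHomogeneous_succ_induction (p := fun f => π f * π (lform l)
          = π (lform l) * (π (C (D.ev f).re) * π (lform l) ^ 2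
          + π (C (D.ev f).im) * (π (lform l) * π (lform m)))) (by simp) ?_ ?_ hf
        · intro f g hf hg
          simp only [map_add, QuadraticAlgebra.re_add, QuadraticAlgebra.im_add]
          linear_combination hf + hg
        · intro i f hf
          have e1 := hone f hf
          have e2 := huv i
          rw [map_mul, map_mul, D.ev_X]
          simp only [QuadraticAlgebra.re_mul, QuadraticAlgebra.im_mul, map_add, map_mul]
          change π (X i) * π f * π (lform l) = π (lform l) *
            ((π (C (u i)) * π (C (D.ev f).re) + π (C r) * π (C (v i)) * π (C (D.ev f).im))
              * π (lform l) ^ 2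
            + (π (C (u i)) * π (C (D.ev f).im) + π (C (v i)) * π (C (D.ev f).re)
              + π (C s) * π (C (v i)) * π (C (D.ev f).im)) * (π (lform l) * π (lform m)))
          linear_combination π f * e2 + (π (C (u i)) * π (lform l) + π (C (v i)) * π (lform m)) * e1
            + π (C (v i)) * π (C (D.ev f).im) * π (lform l) * hrs
      have h2 := hcancel (f - (C (D.ev f).re * lform l ^ 2
          + C (D.ev f).im * (lform l * lform m)))
        (hf.sub ((hL2.C_mul _).add ((hL.mul hM).C_mul _))) (by
          simp only [map_sub, map_add, map_mul, map_pow]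
          linear_combination h1)
      simp only [map_sub, map_add, map_mul, map_pow] at h2
      linear_combination h2
    | succ d ih =>
      intro f hf
      refine isHomogeneous_succ_induction (p := fun f => π f
        = π (C (D.ev f).re) * π (lform l) ^ (d + 1 + 2)
          + π (C (D.ev f).im) * (π (lform l) ^ (d + 1 + 1) * π (lform m))) (by simp) ?_ ?_ hf
      · intro f g hf hg
        simp only [map_add, QuadraticAlgebra.re_add, QuadraticAlgebra.im_add]
        linear_combination hf + hg
      · intro i f hf
        have e1 := ih f hf
        have e2 := huv i
        rw [map_mul, map_mul, D.ev_X]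
        simp only [QuadraticAlgebra.re_mul, QuadraticAlgebra.im_mul, map_add, map_mul]
        change π (X i) * π f =
          (π (C (u i)) * π (C (D.ev f).re) + π (C r) * π (C (v i)) * π (C (D.ev f).im))
              * π (lform l) ^ (d + 1 + 2)
            + (π (C (u i)) * π (C (D.ev f).im) + π (C (v i)) * π (C (D.ev f).re)
              + π (C s) * π (C (v i)) * π (C (D.ev f).im)) *
                (π (lform l) ^ (d + 1 + 1) * π (lform m))
        linear_combination π (X i) * e1 + (π (C (D.ev f).re) * π (lform l) ^ (d + 1)
          + π (C (D.ev f).im) * (π (lform l) ^ d * π (lform m))) * e2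
          + π (C (v i)) * π (C (D.ev f).im) * π (lform l) ^ (d + 1) * hrs
  refine ⟨D, rfl, rfl, (D.eq_fam I (fun f hf hd => ?_) (fun f hf hd => ?_)).symm⟩
  · have h0 := key 1 f hd
    rw [Ideal.Quotient.eq_zero_iff_mem.2 hf] at h0
    have h1 := h.indep (D.ev f).re (D.ev f).im (by
      rw [← Ideal.Quotient.eq_zero_iff_mem]
      simp only [map_add, map_mul, map_pow]
      exact h0.symm)
    exact QuadraticAlgebra.ext h1.1 h1.2
  · have h0 := key 2 f hd
    rw [Ideal.Quotient.eq_zero_iff_mem.2 hf] at h0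
    by_contra hne
    refine h.four ?_
    -- With `l³ m ≡ t l⁴` the quartic becomes `ell (ev f)` times `l⁴`; were that scalar nonzero,
    -- `l⁴` would lie in the ideal.
    have h1 : π (C (D.ell (D.ev f))) * π (lform l) ^ 4 = 0 := by
      rw [D.ell_apply]
      change π (C ((D.ev f).re + t * (D.ev f).im)) * _ = 0
      simp only [map_add, map_mul]
      linear_combination -h0 - π (C (D.ev f).im) * ht
    rw [← Ideal.Quotient.eq_zero_iff_mem, map_pow]
    have h2 : π (C (D.ell (D.ev f))⁻¹) * π (C (D.ell (D.ev f))) = 1 := by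
      rw [← map_mul, ← C_mul, inv_mul_cancel₀ hne, C_1, map_one]
    linear_combination π (C (D.ell (D.ev f))⁻¹) * h1 - π (lform l) ^ 4 * h2

end IsAdapted

/-! ### Adapted linear forms exist in characteristic zero -/

/-- A functional on `V / N` turns the sum into a polynomial in `z` vanishing on an infinite field,
so each of its coefficients is zero. -/
theorem mem_of_forall_sum_pow_smul_mem [Infinite K] {V : Type*} [AddCommGroup V] [Module K V]
    (N : Submodule K V) (w : ℕ → V) (k : ℕ)
    (h : ∀ z : K, ∑ j ∈ Finset.range k, z ^ j • w j ∈ N) {j : ℕ} (hj : j < k) : w j ∈ N := by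
  rw [← Submodule.Quotient.mk_eq_zero, ← Module.forall_dual_apply_eq_zero_iff K]
  intro f
  let p : Polynomial K := ∑ j ∈ Finset.range k, Polynomial.monomial j (f (N.mkQ (w j)))
  have hp : p = 0 := by
    refine Polynomial.funext fun z => ?_
    have := congrArg f ((Submodule.Quotient.mk_eq_zero N).2 (h z))
    rw [map_zero, ← Submodule.mkQ_apply, map_sum, map_sum] at this
    rw [Polynomial.eval_zero, ← this, Polynomial.eval_finsetSum]
    refine Finset.sum_congr rfl fun j _ => ?_
    simp [mul_comm]
  have := congrArg (Polynomial.coeff · j) hp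
  simpa [p, Polynomial.finsetSum_coeff, Polynomial.coeff_monomial, hj] using this

/-- In characteristic zero, powers of linear forms span all forms. -/
theorem mem_of_forall_lform_pow_mem [CharZero K] (N : Submodule K (MvPolynomial (Fin n) K))
    (d : ℕ) (h : ∀ c, lform c ^ d ∈ N) {f : MvPolynomial (Fin n) K} (hf : f.IsHomogeneous d) :
    f ∈ N := by
  -- Polarization: `j` factors equal one linear form, the remaining factor of degree `k` is
  -- arbitrary.
  have key : ∀ k j, j + k = d → ∀ g : MvPolynomial (Fin n) K, g.IsHomogeneous k →
      ∀ c, lform c ^ j * g ∈ N := by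
    intro k
    induction k with
    | zero =>
      intro j hj g hg c
      rw [← homogeneousComponent_eq_self hg, homogeneousComponent_zero, mul_comm,
        ← smul_eq_C_mul]
      obtain rfl : j = d := by omega
      exact N.smul_mem _ (h c)
    | succ k ih =>
      intro j hj g hg
      refine isHomogeneous_succ_induction (p := fun g => ∀ c, lform c ^ j * g ∈ N) ?_ ?_ ?_ hg
      · intro c; simp
      · intro f g hf hg c
        rw [mul_add]; exact N.add_mem (hf c) (hg c)
      · intro i g hg c
        have hX : (X i : MvPolynomial (Fin n) K) = lform (Pi.single i 1) := by
          rw [eq_lform_of_isHomogeneous (isHomogeneous_X K i)]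
          congr 1
          ext k
          simp [coeff_X, Pi.single_apply, Finsupp.single_left_inj, eq_comm]
        -- The coefficient of `z` in `(z Xᵢ + lform c)^(j+1) g` is `(j+1) Xᵢ (lform c)^j g`;
        -- dividing by `j + 1` uses characteristic zero.
        have h1 := mem_of_forall_sum_pow_smul_mem N
          (fun m => (X i ^ m * lform c ^ (j + 1 - m) * ((j + 1).choose m : MvPolynomial (Fin n) K))
            * g) (j + 1 + 1) (fun z => by
            have h2 := ih (j + 1) (by omega) g hg (z • Pi.single i 1 + c)
            rw [lform_add, lform_smul, ← hX, add_pow, Finset.sum_mul] at h2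
            convert h2 using 2 with m
            rw [smul_eq_C_mul, C_pow, mul_pow]
            ring) (j := 1) (by omega)
        have h3 := N.smul_mem ((j + 1 : ℕ) : K)⁻¹ h1
        convert h3 using 1
        rw [smul_eq_C_mul, Nat.choose_one_right, Nat.add_sub_cancel, pow_one]
        have h4 : (C ((j + 1 : ℕ) : K)⁻¹ : MvPolynomial (Fin n) K) * ((j + 1 : ℕ)) = 1 := by
          rw [← map_natCast C, ← C_mul, inv_mul_cancel₀ (Nat.cast_ne_zero.2 j.succ_ne_zero), C_1]
        linear_combination -(lform c ^ j * X i * g) * h4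
  simpa using key d 0 (by omega) f hf 0

theorem toPiece_eq_zero {H : ℕ → ℕ} (I : Points K n H) (d : ℕ) {f : MvPolynomial (Fin n) K}
    (hf : f ∈ I.ideal) : toPiece I.ideal d f = 0 :=
  (Submodule.Quotient.mk_eq_zero _).2 (I.isFamily.homogeneous f hf d)

/-- Suppose that `l² m` is proportional to `l³` modulo the ideal for all `m` whenever `l⁴` is
outside it. Deforming `l` to `l + z m` and comparing coefficients of `z` shows that a functional on
cubics killing the ideal and `l³` kills every cube of a linear form, hence every cubic. The cubics
modulo the ideal would then have dimension at most one, not two. -/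
theorem exists_isAdapted [CharZero K] (I : GradedHilb K n (hilb1n221 n)) :
    ∃ l m, IsAdapted I.ideal l m := by
  obtain ⟨l, hl⟩ : ∃ l, lform l ^ 4 ∉ I.ideal := by
    by_contra! h
    have h1 : ∀ x : piece I.ideal 4, x = 0 := fun x => by
      obtain ⟨f, rfl⟩ := Submodule.Quotient.mk_surjective _ x
      rw [mk_piece_eq_zero_iff]
      exact mem_of_forall_lform_pow_mem (I.ideal.restrictScalars K) 4 h f.2
    have h2 := finrank_piece I 4
    have : Subsingleton (piece I.ideal 4) := ⟨fun x y => by rw [h1 x, h1 y]⟩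
    rw [Module.finrank_zero_of_subsingleton] at h2
    exact absurd h2 (by simp [hilb1n221])
  by_contra! hno
  have hprop : ∀ l m, lform l ^ 4 ∉ I.ideal →
      ∃ c : K, lform l ^ 2 * lform m - C c * lform l ^ 3 ∈ I.ideal := by
    intro l m hl
    by_contra! hc
    refine hno l m ⟨fun p q hpq => ?_, hl⟩
    have hq : q = 0 := by
      by_contra hq
      refine hc (-(q⁻¹ * p)) ?_
      have h1 := I.ideal.mul_mem_left (C q⁻¹) hpq
      have h2 : (C q⁻¹ * C q : MvPolynomial (Fin n) K) = 1 := by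
        rw [← C_mul, inv_mul_cancel₀ hq, C_1]
      convert h1 using 1
      rw [C_neg, C_mul]
      linear_combination -(lform l ^ 2 * lform m) * h2
    refine ⟨?_, hq⟩
    by_contra hp
    rw [hq, C_0, zero_mul, add_zero] at hpq
    refine hl ?_
    have h1 := I.ideal.mul_mem_left (C p⁻¹ * lform l) hpq
    have h2 : (C p⁻¹ * C p : MvPolynomial (Fin n) K) = 1 := by
      rw [← C_mul, inv_mul_cancel₀ hp, C_1]
    convert h1 using 1
    linear_combination -(lform l ^ 4) * h2
  have hl3 : toPiece I.ideal 3 (lform l ^ 3) ≠ 0 := by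
    intro h
    have h1 : (Submodule.Quotient.mk ⟨lform l ^ 3, lform_pow_isHomogeneous l 3⟩ :
      piece I.ideal 3) = 0 := by rw [← toPiece_of_mem]; exact h
    refine hl ?_
    rw [pow_succ']
    exact I.ideal.mul_mem_left _ ((mk_piece_eq_zero_iff I.ideal _).1 h1)
  have hl4 : toPiece I.ideal 4 (lform l ^ 4) ≠ 0 := by
    intro h
    have h1 : (Submodule.Quotient.mk ⟨lform l ^ 4, lform_pow_isHomogeneous l 4⟩ :
      piece I.ideal 4) = 0 := by rw [← toPiece_of_mem]; exact h
    exact hl ((mk_piece_eq_zero_iff I.ideal _).1 h1)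
  obtain ⟨e', he'⟩ := Module.Projective.exists_dual_ne_zero K hl3
  obtain ⟨μ', hμ'⟩ := Module.Projective.exists_dual_ne_zero K hl4
  have hlt : Submodule.span K {toPiece I.ideal 3 (lform l ^ 3)} < ⊤ := by
    rw [lt_top_iff_ne_top]
    intro h
    have h1 := finrank_span_singleton (K := K) hl3
    rw [h, finrank_top, finrank_piece] at h1
    exact absurd h1 (by simp [hilb1n221])
  obtain ⟨lam', hlam1, hlam0⟩ := Submodule.exists_le_ker_of_lt_top _ hlt
  let e := e' ∘ₗ toPiece I.ideal 3
  let lam := lam' ∘ₗ toPiece I.ideal 3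
  let μ := μ' ∘ₗ toPiece I.ideal 4
  have he : e (lform l ^ 3) ≠ 0 := he'
  have hμ : μ (lform l ^ 4) ≠ 0 := hμ'
  have hlam : lam (lform l ^ 3) = 0 :=
    hlam0 (Submodule.mem_span_singleton_self _)
  have heI : ∀ f ∈ I.ideal, e f = 0 := fun f hf => by
    simp only [e, LinearMap.comp_apply, toPiece_eq_zero I 3 hf, map_zero]
  have hlI : ∀ f ∈ I.ideal, lam f = 0 := fun f hf => by
    simp only [lam, LinearMap.comp_apply, toPiece_eq_zero I 3 hf, map_zero]
  have hμI : ∀ f ∈ I.ideal, μ f = 0 := fun f hf => by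
    simp only [μ, LinearMap.comp_apply, toPiece_eq_zero I 4 hf, map_zero]
  have main : ∀ m, lform l ^ 2 * lform m ∈ I.ideal →
      lam (lform l * lform m ^ 2) = 0 ∧ lam (lform m ^ 3) = 0 := by
    intro m hm
    set L := lform l
    set M := lform m
    -- The polynomial `κ` is the value of `μ` at `(L + z M)⁴`: where it does not vanish, that fourth
    -- power lies outside the ideal and `hprop` applies.
    let κ : Polynomial K := Polynomial.C (μ (L ^ 4)) + Polynomial.C (4 * μ (L ^ 3 * M)) * .X
      + Polynomial.C (6 * μ (L ^ 2 * M ^ 2)) * .X ^ 2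
      + Polynomial.C (4 * μ (L * M ^ 3)) * .X ^ 3 + Polynomial.C (μ (M ^ 4)) * .X ^ 4
    -- Applying `e` and `lam` to `(L + z M)² M ≡ c (L + z M)³` and eliminating `c` leaves `θ(z) =
    -- 0`; the terms in `z³` and `z⁵` cancel.
    let θ : Polynomial K := Polynomial.C (2 * e (L ^ 3) * lam (L * M ^ 2)) * .X
      + Polynomial.C (e (L ^ 3) * lam (M ^ 3)) * .X ^ 2
      + Polynomial.C (e (L * M ^ 2) * lam (M ^ 3) - e (M ^ 3) * lam (L * M ^ 2)) * .X ^ 4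
    have hz : κ * θ = 0 := by
      refine Polynomial.funext fun z => ?_
      rw [Polynomial.eval_mul, Polynomial.eval_zero, mul_eq_zero, or_iff_not_imp_left]
      intro hκ
      have hLz : lform (l + z • m) = L + C z * M := by rw [lform_add, lform_smul]
      have h4 : μ ((L + C z * M) ^ 4) = κ.eval z := by
        have : (L + C z * M) ^ 4 = L ^ 4 + (4 * z) • (L ^ 3 * M) + (6 * z ^ 2) • (L ^ 2 * M ^ 2)
            + (4 * z ^ 3) • (L * M ^ 3) + z ^ 4 • M ^ 4 := by
          simp only [smul_eq_C_mul, C_mul, C_pow, map_ofNat]; ring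
        rw [this]
        simp only [map_add, map_smul, smul_eq_mul, κ, Polynomial.eval_add, Polynomial.eval_mul,
          Polynomial.eval_C, Polynomial.eval_X, Polynomial.eval_pow]
        ring
      have hnot : lform (l + z • m) ^ 4 ∉ I.ideal := fun h => hκ (by
        rw [← h4, ← hLz]; exact hμI _ h)
      obtain ⟨c, hc⟩ := hprop (l + z • m) m hnot
      rw [hLz] at hc
      have e1 : ∀ ρ : MvPolynomial (Fin n) K →ₗ[K] K, (∀ f ∈ I.ideal, ρ f = 0) →
          2 * z * ρ (L * M ^ 2) + z ^ 2 * ρ (M ^ 3)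
            = c * (ρ (L ^ 3) + 3 * z ^ 2 * ρ (L * M ^ 2) + z ^ 3 * ρ (M ^ 3)) := by
        intro ρ hρ
        have h5 : (L + C z * M) ^ 2 * M - C c * (L + C z * M) ^ 3
            = (1 - 3 * z * c) • (L ^ 2 * M) + (2 * z) • (L * M ^ 2) + z ^ 2 • M ^ 3
              - c • (L ^ 3 + (3 * z ^ 2) • (L * M ^ 2) + z ^ 3 • M ^ 3) := by
          simp only [smul_eq_C_mul, C_mul, C_pow, map_ofNat, map_sub, C_1]; ring
        have h6 := hρ _ hc
        rw [h5] at h6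
        simp only [map_add, map_sub, map_smul, smul_eq_mul, hρ _ hm] at h6
        linear_combination h6
      have h7 := e1 e heI
      have h8 := e1 lam hlI
      rw [hlam] at h8
      simp only [θ, Polynomial.eval_add, Polynomial.eval_mul, Polynomial.eval_C,
        Polynomial.eval_X, Polynomial.eval_pow]
      linear_combination
        (e (L ^ 3) + 3 * z ^ 2 * e (L * M ^ 2) + z ^ 3 * e (M ^ 3)) * h8
        - (0 + 3 * z ^ 2 * lam (L * M ^ 2) + z ^ 3 * lam (M ^ 3)) * h7
    have hκ : κ ≠ 0 := fun h => hμ (by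
      have := congrArg (Polynomial.coeff · 0) h
      simpa [κ] using this)
    have hθ : θ = 0 := (mul_eq_zero.1 hz).resolve_left hκ
    -- The coefficients of `z` and `z²` contain the nonzero factor `e (L³)`, so they force both
    -- values of `lam` to vanish.
    have h1 := congrArg (Polynomial.coeff · 1) hθ
    have h2 := congrArg (Polynomial.coeff · 2) hθ
    simp only [θ, Polynomial.coeff_add, Polynomial.coeff_C_mul, Polynomial.coeff_X,
      Polynomial.coeff_X_pow, Polynomial.coeff_zero] at h1 h2
    norm_num [he] at h1 h2
    exact ⟨h1, h2⟩
  refine hlam1 (LinearMap.ext fun x => ?_)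
  obtain ⟨f, rfl⟩ := Submodule.Quotient.mk_surjective _ x
  have hker : f.1 ∈ LinearMap.ker lam := by
    refine mem_of_forall_lform_pow_mem _ 3 (fun m => ?_) f.2
    obtain ⟨c, hc⟩ := hprop l m hl
    -- Replacing `m` by `m - c l` puts `l² (m - c l)` into the ideal, as `main` requires.
    obtain ⟨h1, h2⟩ := main (m - c • l) (by
      rw [sub_eq_add_neg, ← neg_smul, lform_add, lform_smul, C_neg]
      convert hc using 1
      ring)
    have h3 : lform m = lform (m - c • l) + C c * lform l := by
      rw [← lform_smul, ← lform_add, sub_add_cancel]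
    have h4 : lform m ^ 3 = lform (m - c • l) ^ 3
        + (3 * c) • (lform l * lform (m - c • l) ^ 2)
        + (3 * c ^ 2) • (lform l ^ 2 * lform m - C c * lform l ^ 3)
        + c ^ 3 • lform l ^ 3 := by
      rw [h3]
      simp only [smul_eq_C_mul, C_mul, C_pow, map_ofNat]; ring
    rw [LinearMap.mem_ker, h4]
    simp only [map_add, map_smul, h1, h2, hlam, hlI _ hc, smul_zero, add_zero]
  have h5 : lam f.1 = lam' (toPiece I.ideal 3 f.1) := rfl
  rw [LinearMap.mem_ker, h5, toPiece_of_mem] at hker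
  exact hker

/-- In characteristic zero, every ideal with Hilbert function `(1, n, 2, 2, 1)` comes from a
datum. -/
theorem exists_fam_eq [CharZero K] (I : GradedHilb K n (hilb1n221 n)) :
    ∃ D : Datum K n, D.fam = I := by
  obtain ⟨l, m, h⟩ := exists_isAdapted I
  obtain ⟨D, -, -, hD⟩ := h.exists_datum
  exact ⟨D, hD⟩

end Charts

section Contraction

variable {K : Type u} [Field K] {n : ℕ}

/-! ### The action by differentiation on powers of linear forms -/

/-- The action by differentiation, as a bilinear map. -/
def contractBilin :
    MvPolynomial (Fin n) K →ₗ[K] MvPolynomial (Fin n) K →ₗ[K] MvPolynomial (Fin n) K :=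
  (basisMonomials (Fin n) K).constr K fun a => (basisMonomials (Fin n) K).constr K fun b =>
    monomial (b - a) ((∏ i, (b i).descFactorial (a i) : ℕ) : K)

theorem contractBilin_monomial (a b : Fin n →₀ ℕ) (c e : K) :
    contractBilin (monomial a c) (monomial b e)
      = monomial (b - a) (c * e * ((∏ i, (b i).descFactorial (a i) : ℕ) : K)) := by
  have h : ∀ (m : Fin n →₀ ℕ) (x : K), (monomial m x : MvPolynomial (Fin n) K)
      = x • basisMonomials (Fin n) K m := by
    intro m x
    rw [coe_basisMonomials, smul_monomial, smul_eq_mul, mul_one]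
  rw [h a c, h b e, contractBilin]
  simp only [map_smul, LinearMap.smul_apply, Module.Basis.constr_basis, smul_monomial,
    smul_eq_mul]
  congr 1
  ring

theorem contract_eq_contractBilin (f g : MvPolynomial (Fin n) K) :
    contract f g = contractBilin f g := by
  conv_rhs => rw [← support_sum_monomial_coeff f, ← support_sum_monomial_coeff g]
  simp only [map_sum, LinearMap.sum_apply, contractBilin_monomial]
  rw [contract, Finset.sum_comm]

theorem contract_add_left (f f' g : MvPolynomial (Fin n) K) :
    contract (f + f') g = contract f g + contract f' g := by
  simp only [contract_eq_contractBilin, map_add, LinearMap.add_apply]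

theorem contract_zero_left (g : MvPolynomial (Fin n) K) : contract 0 g = 0 := by
  simp only [contract_eq_contractBilin, map_zero, LinearMap.zero_apply]

theorem contract_add_right (f g g' : MvPolynomial (Fin n) K) :
    contract f (g + g') = contract f g + contract f g' := by
  simp only [contract_eq_contractBilin, map_add]

theorem contract_C_mul_right (f g : MvPolynomial (Fin n) K) (c : K) :
    contract f (C c * g) = C c * contract f g := by
  simp only [contract_eq_contractBilin, ← smul_eq_C_mul, map_smul]

theorem contract_C_left (g : MvPolynomial (Fin n) K) (c : K) : contract (C c) g = C c * g := by
  induction g using MvPolynomial.induction_on' with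
  | monomial m e =>
    rw [contract_eq_contractBilin, ← monomial_zero', contractBilin_monomial, monomial_zero',
      C_mul_monomial]
    simp
  | add p q hp hq => rw [contract_add_right, hp, hq, mul_add]

/-- The recursion that characterizes the action; it lets contractions be computed by induction on
the degree of `f`. -/
theorem contract_X_mul (i : Fin n) (f g : MvPolynomial (Fin n) K) :
    contract (X i * f) g = contract f (pderiv i g) := by
  induction f using MvPolynomial.induction_on' with
  | add p q hp hq => rw [mul_add, contract_add_left, hp, hq, contract_add_left]
  | monomial a c =>
    induction g using MvPolynomial.induction_on' with
    | add p q hp hq => rw [map_add, contract_add_right, hp, hq, contract_add_right]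
    | monomial b e =>
      classical
      rw [pderiv_monomial, X, monomial_mul, one_mul, contract_eq_contractBilin,
        contractBilin_monomial, contract_eq_contractBilin, contractBilin_monomial,
        tsub_add_eq_tsub_tsub]
      congr 1
      have h : ∏ j, (b j).descFactorial ((Finsupp.single i 1 + a : Fin n →₀ ℕ) j)
          = b i * ∏ j, ((b - Finsupp.single i 1 : Fin n →₀ ℕ) j).descFactorial (a j) := by
        rw [← Finset.mul_prod_erase _ _ (Finset.mem_univ i),
          ← Finset.mul_prod_erase (Finset.univ) (fun j =>
            ((b - Finsupp.single i 1 : Fin n →₀ ℕ) j).descFactorial (a j)) (Finset.mem_univ i), ← mul_assoc]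
        congr 1
        · simp only [Finsupp.add_apply, Finsupp.single_eq_same, Finsupp.tsub_apply]
          rw [add_comm]
          cases b i with
          | zero => simp
          | succ k => rw [Nat.succ_descFactorial_succ]; rfl
        · refine Finset.prod_congr rfl fun j hj => ?_
          have hji : i ≠ j := (Finset.ne_of_mem_erase hj).symm
          simp [Finsupp.single_eq_of_ne' hji]
      rw [h]
      push_cast
      ring

theorem pderiv_lform (i : Fin n) (c : Fin n → K) : pderiv i (lform c) = C (c i) := by
  classical
  simp [lform, pderiv_X, Pi.single_apply]

theorem pderiv_lform_pow (i : Fin n) (c : Fin n → K) (d : ℕ) :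
    pderiv i (lform c ^ d) = C (d * c i) * lform c ^ (d - 1) := by
  rw [Derivation.leibniz_pow, pderiv_lform, C_mul, map_natCast, nsmul_eq_mul, smul_eq_mul]
  ring

/-- Contracting a power of a linear form amounts to evaluating at its coefficient vector. This links
inverse systems with `ev`. -/
theorem contract_lform_pow (c : Fin n → K) {f : MvPolynomial (Fin n) K} {k : ℕ}
    (hf : f.IsHomogeneous k) (d : ℕ) :
    contract f (lform c ^ d) = C (d.descFactorial k * eval c f) * lform c ^ (d - k) := by
  induction k generalizing f d with
  | zero =>
    rw [← homogeneousComponent_eq_self hf, homogeneousComponent_zero, contract_C_left]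
    simp
  | succ k ih =>
    refine isHomogeneous_succ_induction (p := fun f => contract f (lform c ^ d)
      = C (d.descFactorial (k + 1) * eval c f) * lform c ^ (d - (k + 1))) ?_ ?_ ?_ hf
    · simp [contract_zero_left]
    · intro f g hf hg
      rw [contract_add_left, hf, hg, map_add, mul_add, C_add, add_mul]
    · intro i f hf
      rw [contract_X_mul, pderiv_lform_pow, contract_C_mul_right, ih hf, map_mul (eval c), eval_X,
        ← mul_assoc, ← C_mul]
      cases d with
      | zero => simp
      | succ d =>
        rw [Nat.succ_descFactorial_succ, Nat.add_sub_cancel, Nat.add_sub_add_right]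
        congr 2
        push_cast
        ring

/-- The derivative of `f` at `c` in the direction `e`. -/
def dirDeriv (c e : Fin n → K) : MvPolynomial (Fin n) K →ₗ[K] K where
  toFun f := ∑ i, e i * eval c (pderiv i f)
  map_add' f g := by simp [mul_add, Finset.sum_add_distrib]
  map_smul' k f := by simp [smul_eq_C_mul, Finset.mul_sum, mul_left_comm]

theorem dirDeriv_C (c e : Fin n → K) (k : K) : dirDeriv c e (C k) = 0 := by
  simp [dirDeriv]

theorem dirDeriv_X (c e : Fin n → K) (i : Fin n) : dirDeriv c e (X i) = e i := by
  classical
  simp [dirDeriv, pderiv_X, Pi.single_apply, apply_ite]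

theorem dirDeriv_mul (c e : Fin n → K) (f g : MvPolynomial (Fin n) K) :
    dirDeriv c e (f * g) = dirDeriv c e f * eval c g + eval c f * dirDeriv c e g := by
  simp only [dirDeriv, LinearMap.coe_mk, AddHom.coe_mk, Derivation.leibniz, smul_eq_mul, map_add,
    map_mul, mul_add, Finset.sum_add_distrib, Finset.sum_mul, Finset.mul_sum]
  rw [add_comm]
  congr 1 <;> refine Finset.sum_congr rfl fun i _ => by ring

/-- The first-order version, needed for `x³y` and `x²y`. The truncated `k - 1` is harmless for `k =
0`, because a constant has zero derivative. -/
theorem contract_lform_pow_mul (c e : Fin n → K) {f : MvPolynomial (Fin n) K} {k : ℕ}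
    (hf : f.IsHomogeneous k) (d : ℕ) :
    contract f (lform c ^ d * lform e)
      = C (d.descFactorial k * eval c f) * (lform c ^ (d - k) * lform e)
        + C (d.descFactorial (k - 1) * dirDeriv c e f) * lform c ^ (d - (k - 1)) := by
  induction k generalizing f d with
  | zero =>
    rw [← homogeneousComponent_eq_self hf, homogeneousComponent_zero, contract_C_left, dirDeriv_C]
    simp
  | succ k ih =>
    refine isHomogeneous_succ_induction (p := fun f => contract f (lform c ^ d * lform e)
      = C (d.descFactorial (k + 1) * eval c f) * (lform c ^ (d - (k + 1)) * lform e)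
        + C (d.descFactorial (k + 1 - 1) * dirDeriv c e f) * lform c ^ (d - (k + 1 - 1)))
      ?_ ?_ ?_ hf
    · simp [contract_zero_left]
    · intro f g hf hg
      rw [contract_add_left, hf, hg]
      simp only [map_add, mul_add, add_mul]
      ring
    · intro i f hf
      have h1 : pderiv i (lform c ^ d * lform e)
          = C (d * c i) * (lform c ^ (d - 1) * lform e) + C (e i) * lform c ^ d := by
        rw [Derivation.leibniz, pderiv_lform, pderiv_lform_pow, smul_eq_mul, smul_eq_mul]
        ring
      rw [contract_X_mul, h1, contract_add_right, contract_C_mul_right, contract_C_mul_right,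
        contract_lform_pow c hf, ih hf, map_mul (eval c), eval_X, dirDeriv_mul, dirDeriv_X, eval_X,
        Nat.add_sub_cancel]
      cases k with
      | zero =>
        have h2 : dirDeriv c e f = 0 := by
          rw [← homogeneousComponent_eq_self hf, homogeneousComponent_zero, dirDeriv_C]
        rw [h2]
        simp only [Nat.descFactorial_zero, Nat.descFactorial_one, C_mul, Nat.cast_one, C_0,
          zero_add, Nat.sub_zero, mul_zero, zero_mul, add_zero, one_mul]
        ring
      | succ k =>
        cases d with
        | zero => simp
        | succ d =>
          simp only [Nat.succ_descFactorial_succ, Nat.add_sub_cancel, Nat.add_sub_add_right,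
            Nat.cast_mul, C_mul, C_add]
          ring

theorem mem_inverseSystem_of_forall_isHomogeneous (I : GradedHilb K n (hilb1n221 n))
    (g : MvPolynomial (Fin n) K)
    (h : ∀ k, ∀ f ∈ I.ideal, f.IsHomogeneous (k + 2) → contract f g = 0) :
    g ∈ inverseSystem I.ideal := by
  intro f hf
  have hc : ∀ d, contract (homogeneousComponent d f) g = 0 := by
    intro d
    have h1 := I.isFamily.homogeneous f hf d
    have h2 := homogeneousComponent_isHomogeneous d f
    match d with
    | 0 => rw [eq_zero_of_mem_of_isHomogeneous I (by norm_num) h2 h1, contract_zero_left]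
    | 1 => rw [eq_zero_of_mem_of_isHomogeneous I (by norm_num) h2 h1, contract_zero_left]
    | k + 2 => exact h k _ h1 h2
  conv_lhs => rw [← sum_homogeneousComponent f]
  rw [contract_eq_contractBilin, map_sum, LinearMap.sum_apply]
  refine Finset.sum_eq_zero fun d _ => ?_
  rw [← contract_eq_contractBilin, hc]

end Contraction

/-! ### The loci in terms of data -/

section Types

variable {K : Type u} [Field K] {n : ℕ}

theorem exists_dual_vectors {c e : Fin n → K} (h : LinearIndependent K ![c, e]) :
    ∃ a b : Fin n → K, ∑ i, a i * c i = 1 ∧ ∑ i, a i * e i = 0 ∧ ∑ i, b i * c i = 0 ∧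
      ∑ i, b i * e i = 1 := by
  obtain ⟨g, hg⟩ := LinearMap.exists_leftInverse_of_injective _
    (LinearMap.ker_eq_bot.2 (linearIndependent_iff_injective_fintypeLinearCombination.1 h))
  have h1 : ∀ (w : Fin n → K) (k : Fin 2), ∑ i, g (Pi.single i 1) k * w i = g w k := by
    intro w k
    have hs : ∀ x, (Pi.single x 1 : Fin n → K) = fun j => if x = j then 1 else 0 := by
      intro x; ext j; simp [Pi.single_apply, eq_comm]
    rw [LinearMap.pi_apply_eq_sum_univ g w]
    simp [mul_comm, hs]
  have hc : g c = Pi.single 0 1 := by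
    have := LinearMap.congr_fun hg (Pi.single 0 1)
    simpa [Fintype.linearCombination_apply] using this
  have he : g e = Pi.single 1 1 := by
    have := LinearMap.congr_fun hg (Pi.single 1 1)
    simpa [Fintype.linearCombination_apply] using this
  refine ⟨fun i => g (Pi.single i 1) 0, fun i => g (Pi.single i 1) 1, ?_, ?_, ?_, ?_⟩ <;>
    rw [h1] <;> simp [hc, he]

theorem lform_injective : Function.Injective (lform : (Fin n → K) → MvPolynomial (Fin n) K) := by
  intro c e h
  ext i
  rw [← coeff_single_lform c, h, coeff_single_lform]

theorem exists_lform_of_indepForms {x y : MvPolynomial (Fin n) K} (h : IndepForms x y) :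
    ∃ c e : Fin n → K, x = lform c ∧ y = lform e ∧ LinearIndependent K ![c, e] := by
  obtain ⟨hx, hy, hxy⟩ := h
  refine ⟨_, _, eq_lform_of_isHomogeneous hx, eq_lform_of_isHomogeneous hy, ?_⟩
  rw [LinearIndependent.pair_iff] at hxy ⊢
  intro p q hpq
  refine hxy p q ?_
  have h0 : (lform (0 : Fin n → K)) = 0 := by simp [lform]
  rw [eq_lform_of_isHomogeneous hx, eq_lform_of_isHomogeneous hy, smul_eq_C_mul, smul_eq_C_mul,
    ← lform_smul, ← lform_smul, ← lform_add, hpq, h0]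

theorem indepForms_lform {c e : Fin n → K} (h : LinearIndependent K ![c, e]) :
    IndepForms (lform c) (lform e) := by
  refine ⟨lform_isHomogeneous c, lform_isHomogeneous e, ?_⟩
  rw [LinearIndependent.pair_iff] at h ⊢
  intro p q hpq
  refine h p q (lform_injective ?_)
  rw [lform_add, lform_smul, lform_smul, ← smul_eq_C_mul, ← smul_eq_C_mul, hpq]
  simp [lform]

theorem eq_zero_of_C_mul_add {c e : Fin n → K} (h : LinearIndependent K ![c, e]) {p q : K}
    (hpq : C p * lform c + C q * lform e = 0) : p = 0 ∧ q = 0 := by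
  have h1 := (indepForms_lform h).2.2
  rw [LinearIndependent.pair_iff] at h1
  exact h1 p q (by rw [smul_eq_C_mul, smul_eq_C_mul, hpq])

namespace Datum

theorem linearIndependent (D : Datum K n) {p q p' q' : K} (h : p * q' - q * p' ≠ 0) :
    LinearIndependent K ![p • D.u + q • D.v, p' • D.u + q' • D.v] := by
  rw [LinearIndependent.pair_iff]
  intro x y hxy
  have hc : ∀ w : Fin n → K, ∑ i, w i * (x • (p • D.u + q • D.v) + y • (p' • D.u + q' • D.v)) i
      = (x * p + y * p') * ∑ i, w i * D.u i + (x * q + y * q') * ∑ i, w i * D.v i := by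
    intro w
    rw [Finset.mul_sum, Finset.mul_sum, ← Finset.sum_add_distrib]
    refine Finset.sum_congr rfl fun i _ => ?_
    simp
    ring
  have ha := hc D.a
  have hb := hc D.b
  rw [hxy] at ha hb
  rw [D.au, D.av] at ha
  rw [D.bu, D.bv] at hb
  simp only [Pi.zero_apply, mul_zero, Finset.sum_const_zero] at ha hb
  constructor
  · have : x * (p * q' - q * p') = 0 := by linear_combination -q' * ha + p' * hb
    exact (mul_eq_zero.1 this).resolve_right h
  · have : y * (p * q' - q * p') = 0 := by linear_combination q * ha - p * hb
    exact (mul_eq_zero.1 this).resolve_right h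

theorem exists_of_linearIndependent {c e : Fin n → K} (h : LinearIndependent K ![c, e])
    (r s t : K) : ∃ D : Datum K n, D.u = c ∧ D.v = e ∧ D.r = r ∧ D.s = s ∧ D.t = t := by
  obtain ⟨a, b, h1, h2, h3, h4⟩ := exists_dual_vectors h
  exact ⟨⟨c, e, a, b, r, s, t, h1, h2, h3, h4⟩, rfl, rfl, rfl, rfl, rfl⟩

/-- When `r = 0` the quadratic algebra maps to the field by `ω ↦ 0` and `ω ↦ s`, so `Z` contains the
points `u` and `u + s v`. This lemma and the next evaluate at them; the third treats the double
point `s = 0`, where the `ω`-part is a derivative along `v`. -/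
theorem ev_re (D : Datum K n) (hr : D.r = 0) (f : MvPolynomial (Fin n) K) :
    (D.ev f).re = eval D.u f := by
  induction f using MvPolynomial.induction_on with
  | C c => rw [ev_C, eval_C]
  | add p q hp hq => rw [map_add, map_add, QuadraticAlgebra.re_add, hp, hq]
  | mul_X p i hp => rw [map_mul, ev_X, map_mul, eval_X, QuadraticAlgebra.re_mul, hp]; linear_combination (D.ev p).im * D.v i * hr

theorem ev_re_add_im (D : Datum K n) (hr : D.r = 0) (f : MvPolynomial (Fin n) K) :
    (D.ev f).re + D.s * (D.ev f).im = eval (D.u + D.s • D.v) f := by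
  induction f using MvPolynomial.induction_on with
  | C c => rw [ev_C, eval_C]; ring
  | add p q hp hq =>
    rw [map_add, map_add, QuadraticAlgebra.re_add, QuadraticAlgebra.im_add, ← hp, ← hq]; ring
  | mul_X p i hp =>
    rw [map_mul, ev_X, map_mul, eval_X, QuadraticAlgebra.re_mul, QuadraticAlgebra.im_mul, ← hp]
    simp only [Pi.add_apply, Pi.smul_apply, smul_eq_mul]
    linear_combination (D.ev p).im * D.v i * hr

theorem ev_im (D : Datum K n) (hr : D.r = 0) (hs : D.s = 0) (f : MvPolynomial (Fin n) K) :
    (D.ev f).im = dirDeriv D.u D.v f := by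
  induction f using MvPolynomial.induction_on with
  | C c => rw [ev_C, dirDeriv_C]
  | add p q hp hq => rw [map_add, map_add, QuadraticAlgebra.im_add, hp, hq]
  | mul_X p i hp =>
    rw [map_mul, ev_X, dirDeriv_mul, eval_X, dirDeriv_X, QuadraticAlgebra.im_mul, hp,
      D.ev_re hr]
    linear_combination dirDeriv D.u D.v p * D.v i * hs

theorem ev_eq_zero_of_mem (D : Datum K n) {k : ℕ} (hk : k < 2) {f : MvPolynomial (Fin n) K}
    (hf : f ∈ D.fam.ideal) (hd : f.IsHomogeneous (k + 2)) : D.ev f = 0 := by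
  interval_cases k
  · exact (D.mem_ideal_two hd).1 hf
  · exact (D.mem_ideal_three hd).1 hf

/-! Membership in the loci, for `ω² = s ω`. -/

variable [CharZero K]

/-- The conditions on `p, q` say that the functional `1 ↦ 1`, `ω ↦ t` is `p` times evaluation at `u`
plus `q` times evaluation at `u + s v`; its dual quartic is the same combination of fourth powers.
-/
theorem contract_pow_four_add (D : Datum K n) (hr : D.r = 0) {p q : K} (hp : p + q = 1)
    (hq : q * D.s = D.t) {k : ℕ} {f : MvPolynomial (Fin n) K} (hf : f ∈ D.fam.ideal)
    (hd : f.IsHomogeneous (k + 2)) :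
    C p * contract f (lform D.u ^ 4) + C q * contract f (lform (D.u + D.s • D.v) ^ 4) = 0 := by
  rw [contract_lform_pow _ hd, contract_lform_pow _ hd, ← D.ev_re hr, ← D.ev_re_add_im hr]
  match k, hd with
  | 0, hd => rw [D.ev_eq_zero_of_mem (by norm_num) hf hd]; simp
  | 1, hd => rw [D.ev_eq_zero_of_mem (by norm_num) hf hd]; simp
  | 2, hd =>
    have h := (D.mem_ideal_four hd).1 hf
    rw [ell_apply] at h
    simp only [Nat.sub_self, pow_zero, mul_one]
    rw [← C_mul, ← C_mul, ← C_add, ← C_0]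
    congr 1
    linear_combination ((4 : ℕ).descFactorial (2 + 2) : K) * h +
      ((4 : ℕ).descFactorial (2 + 2) : K) * (D.ev f).re * hp +
      ((4 : ℕ).descFactorial (2 + 2) : K) * (D.ev f).im * hq
  | k + 3, hd => rw [Nat.descFactorial_eq_zero_iff_lt.2 (by omega)]; simp

theorem pow_three_mem (D : Datum K n) (w : Fin n → K)
    (hw : ∀ f, D.ev f = 0 → eval w f = 0) : lform w ^ 3 ∈ inverseSystem D.fam.ideal := by
  refine mem_inverseSystem_of_forall_isHomogeneous D.fam _ fun k f hf hd => ?_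
  rw [contract_lform_pow _ hd]
  match k, hd with
  | 0, hd => rw [hw f (D.ev_eq_zero_of_mem (by norm_num) hf hd)]; simp
  | 1, hd => rw [hw f (D.ev_eq_zero_of_mem (by norm_num) hf hd)]; simp
  | k + 2, hd => rw [Nat.descFactorial_eq_zero_iff_lt.2 (by omega)]; simp

theorem fam_mem_locusIV [IsAlgClosed K] (D : Datum K n) (hr : D.r = 0) (hs : D.s ≠ 0)
    (ht : D.t ≠ 0) (hts : D.t ≠ D.s) : D.fam ∈ locusIV K n (hilb1n221 n) := by
  -- The weights of the two points are `1 - t/s` and `t/s`, nonzero by hypothesis; fourth roots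
  -- absorb them into the linear forms.
  obtain ⟨p, hp⟩ := IsAlgClosed.exists_pow_nat_eq (1 - D.t / D.s) (n := 4) (by norm_num)
  obtain ⟨q, hq⟩ := IsAlgClosed.exists_pow_nat_eq (D.t / D.s) (n := 4) (by norm_num)
  have hp0 : p ≠ 0 := by
    rintro rfl
    refine hts ?_
    field_simp at hp
    linear_combination hp
  have hq0 : q ≠ 0 := by
    rintro rfl
    refine ht ?_
    field_simp at hq
    linear_combination -hq
  have hi := D.linearIndependent (p := p) (q := 0) (p' := q) (q' := q * D.s) (by
    rw [zero_mul, sub_zero]; exact mul_ne_zero hp0 (mul_ne_zero hq0 hs))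
  have hx : lform (p • D.u + (0 : K) • D.v) = C p * lform D.u := by
    rw [zero_smul, add_zero, lform_smul]
  have hy : lform (q • D.u + (q * D.s) • D.v) = C q * lform (D.u + D.s • D.v) := by
    rw [mul_smul, ← smul_add, lform_smul]
  refine ⟨_, _, indepForms_lform hi, ?_⟩
  refine mem_inverseSystem_of_forall_isHomogeneous D.fam _ fun k f hf hd => ?_
  rw [hx, hy, mul_pow, mul_pow, contract_add_right, ← C_pow, ← C_pow, contract_C_mul_right,
    contract_C_mul_right]
  refine D.contract_pow_four_add hr ?_ ?_ hf hd
  · rw [hp, hq]; ring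
  · rw [hq]; field_simp

theorem fam_mem_locusIII (D : Datum K n) (hr : D.r = 0) (hs : D.s ≠ 0)
    (ht : D.t = 0 ∨ D.t = D.s) : D.fam ∈ locusIII K n (hilb1n221 n) := by
  have hu : lform D.u ^ 3 ∈ inverseSystem D.fam.ideal := D.pow_three_mem _ fun f hf => by
    rw [← D.ev_re hr, hf]; rfl
  have hv : lform (D.u + D.s • D.v) ^ 3 ∈ inverseSystem D.fam.ideal :=
    D.pow_three_mem _ fun f hf => by rw [← D.ev_re_add_im hr, hf]; simp
  -- For `t = 0` the functional is evaluation at `u`, for `t = s` at `u + s v`; that point gives the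
  -- quartic, the other one the cubic.
  rcases ht with ht | ht
  · have hi := D.linearIndependent (p := 1) (q := 0) (p' := 1) (q' := D.s) (by simpa using hs)
    rw [one_smul, zero_smul, add_zero] at hi
    refine ⟨_, _, indepForms_lform hi, ?_, hv⟩
    refine mem_inverseSystem_of_forall_isHomogeneous D.fam _ fun k f hf hd => ?_
    have := D.contract_pow_four_add hr (p := 1) (q := 0) (by ring) (by rw [ht, zero_mul]) hf hd
    simpa using this
  · have hi := D.linearIndependent (p := 1) (q := D.s) (p' := 1) (q' := 0) (by simpa using hs)
    rw [one_smul, zero_smul, add_zero] at hi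
    refine ⟨_, _, indepForms_lform hi, ?_, hu⟩
    refine mem_inverseSystem_of_forall_isHomogeneous D.fam _ fun k f hf hd => ?_
    have := D.contract_pow_four_add hr (p := 0) (q := 1) (by ring) (by rw [ht, one_mul]) hf hd
    simpa using this

theorem fam_mem_locusII (D : Datum K n) (hr : D.r = 0) (hs : D.s = 0) (ht : D.t ≠ 0) :
    D.fam ∈ locusII K n (hilb1n221 n) := by
  -- The functional `f ↦ f(u) + t ∂ᵥf(u)` has dual quartic `u⁴ + 4t u³v = u³(u + 4t v)`, since
  -- contraction yields the factors 24 and 6.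
  have hi := D.linearIndependent (p := 1) (q := 0) (p' := 1) (q' := 4 * D.t) (by simpa using ht)
  rw [one_smul, zero_smul, add_zero] at hi
  refine ⟨_, _, indepForms_lform hi, ?_⟩
  refine mem_inverseSystem_of_forall_isHomogeneous D.fam _ fun k f hf hd => ?_
  have h1 : lform D.u ^ 3 * lform (D.u + (4 * D.t) • D.v)
      = lform D.u ^ 4 + C (4 * D.t) * (lform D.u ^ 3 * lform D.v) := by
    rw [lform_add, lform_smul]; ring
  rw [h1, contract_add_right, contract_C_mul_right, contract_lform_pow _ hd,
    contract_lform_pow_mul _ _ hd, ← D.ev_re hr, ← D.ev_im hr hs]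
  match k, hd with
  | 0, hd => rw [D.ev_eq_zero_of_mem (by norm_num) hf hd]; simp
  | 1, hd => rw [D.ev_eq_zero_of_mem (by norm_num) hf hd]; simp
  | 2, hd =>
    have h := (D.mem_ideal_four hd).1 hf
    rw [ell_apply] at h
    have h4 : ((4 : ℕ).descFactorial (2 + 2) : K) = 24 := by norm_num [Nat.descFactorial]
    have h3 : ((3 : ℕ).descFactorial (2 + 2) : K) = 0 := by norm_num [Nat.descFactorial]
    have h3' : ((3 : ℕ).descFactorial (2 + 2 - 1) : K) = 6 := by norm_num [Nat.descFactorial]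
    rw [h4, h3, h3']
    simp only [Nat.sub_self, pow_zero, mul_one, zero_mul, C_0, zero_add, Nat.reduceAdd,
      Nat.reduceSub]
    rw [← C_mul, ← C_add, ← C_0]
    congr 1
    linear_combination 24 * h
  | k + 3, hd =>
    rw [Nat.descFactorial_eq_zero_iff_lt.2 (by omega), Nat.descFactorial_eq_zero_iff_lt.2 (by omega),
      Nat.descFactorial_eq_zero_iff_lt.2 (by omega)]
    simp

theorem fam_mem_locusI (D : Datum K n) (hr : D.r = 0) (hs : D.s = 0) (ht : D.t = 0) :
    D.fam ∈ locusI K n (hilb1n221 n) := by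
  have hi := D.linearIndependent (p := 1) (q := 0) (p' := 0) (q' := 1) (by simp)
  rw [one_smul, zero_smul, add_zero, one_smul, zero_smul, zero_add] at hi
  refine ⟨_, _, indepForms_lform hi, ?_, ?_⟩
  · refine mem_inverseSystem_of_forall_isHomogeneous D.fam _ fun k f hf hd => ?_
    have := D.contract_pow_four_add hr (p := 1) (q := 0) (by ring) (by rw [ht, zero_mul]) hf hd
    simpa using this
  · refine mem_inverseSystem_of_forall_isHomogeneous D.fam _ fun k f hf hd => ?_
    rw [contract_lform_pow_mul _ _ hd, ← D.ev_re hr, ← D.ev_im hr hs]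
    match k, hd with
    | 0, hd => rw [D.ev_eq_zero_of_mem (by norm_num) hf hd]; simp
    | 1, hd => rw [D.ev_eq_zero_of_mem (by norm_num) hf hd]; simp
    | k + 2, hd =>
      rw [Nat.descFactorial_eq_zero_iff_lt.2 (by omega),
        Nat.descFactorial_eq_zero_iff_lt.2 (by omega)]
      simp

end Datum

/-! Every point of a locus comes from a datum in normal form. -/

variable [CharZero K] {I : GradedHilb K n (hilb1n221 n)}

/-- The two points are read off from the linear forms, and the functional is the mean of the two
evaluations. Here, as for the other loci, `eq_fam` reduces the equality of ideals to an inclusion in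
degrees 3 and 4. -/
theorem exists_datum_of_mem_locusIV (hI : I ∈ locusIV K n (hilb1n221 n)) :
    ∃ D : Datum K n, D.fam = I ∧ D.r = 0 ∧ D.s = 1 ∧ D.t = 1 / 2 := by
  obtain ⟨x, y, hxy, hF⟩ := hI
  obtain ⟨c, e, rfl, rfl, hce⟩ := exists_lform_of_indepForms hxy
  have hce' : LinearIndependent K ![c, e - c] := by
    rw [LinearIndependent.pair_iff] at hce ⊢
    intro p q hpq
    have := hce (p - q) q (by rw [← hpq]; module)
    exact ⟨by linear_combination this.1 + this.2, this.2⟩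
  -- With `u = c`, `v = e - c` and `s = 1`, the points `u` and `u + s v` are `c` and `e`.
  obtain ⟨D, hu, hv, hr, hs, ht⟩ := Datum.exists_of_linearIndependent hce' 0 1 (1 / 2)
  have hw : D.u + D.s • D.v = e := by rw [hu, hv, hs, one_smul]; abel
  refine ⟨D, (D.eq_fam I (fun f hf hd => ?_) (fun f hf hd => ?_)).symm, hr, hs, ht⟩
  · have h := hF f hf
    rw [contract_add_right, contract_lform_pow _ hd, contract_lform_pow _ hd] at h
    simp only [Nat.reduceSub, pow_one] at h
    have h2 := eq_zero_of_C_mul_add hce h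
    have h3 : ((4 : ℕ).descFactorial 3 : K) ≠ 0 := by norm_num [Nat.descFactorial]
    have h4 := (mul_eq_zero.1 h2.1).resolve_left h3
    have h5 := (mul_eq_zero.1 h2.2).resolve_left h3
    rw [← hw, ← D.ev_re_add_im hr] at h5
    rw [← hu, ← D.ev_re hr] at h4
    ext
    · exact h4
    · simp only [QuadraticAlgebra.im_zero]
      linear_combination h5 - h4 - (D.ev f).im * hs
  · have h := hF f hf
    rw [contract_add_right, contract_lform_pow _ hd, contract_lform_pow _ hd, ← hw,
      ← D.ev_re_add_im hr, ← hu, ← D.ev_re hr, Nat.sub_self, pow_zero, mul_one, pow_zero,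
      mul_one, ← C_add, C_eq_zero] at h
    have h3 : ((4 : ℕ).descFactorial 4 : K) = 24 := by norm_num [Nat.descFactorial]
    rw [h3] at h
    rw [D.ell_apply, ht]
    linear_combination h / 48 - (D.ev f).im / 2 * hs

theorem exists_datum_of_mem_locusIII (hI : I ∈ locusIII K n (hilb1n221 n)) :
    ∃ D : Datum K n, D.fam = I ∧ D.r = 0 ∧ D.s = 1 ∧ D.t = 0 := by
  obtain ⟨x, y, hxy, hF, hG⟩ := hI
  obtain ⟨c, e, rfl, rfl, hce⟩ := exists_lform_of_indepForms hxy
  have hce' : LinearIndependent K ![c, e - c] := by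
    rw [LinearIndependent.pair_iff] at hce ⊢
    intro p q hpq
    have := hce (p - q) q (by rw [← hpq]; module)
    exact ⟨by linear_combination this.1 + this.2, this.2⟩
  obtain ⟨D, hu, hv, hr, hs, ht⟩ := Datum.exists_of_linearIndependent hce' 0 1 0
  have hw : D.u + D.s • D.v = e := by rw [hu, hv, hs, one_smul]; abel
  refine ⟨D, (D.eq_fam I (fun f hf hd => ?_) (fun f hf hd => ?_)).symm, hr, hs, ht⟩
  · have h := hF f hf
    have h' := hG f hf
    rw [contract_lform_pow _ hd] at h h'
    have hc : lform c ≠ 0 := (indepForms_lform hce).2.2.ne_zero 0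
    rw [mul_eq_zero, or_iff_left (pow_ne_zero _ hc), C_eq_zero] at h
    rw [Nat.sub_self, pow_zero, mul_one, C_eq_zero] at h'
    have h4 := (mul_eq_zero.1 h).resolve_left (by norm_num [Nat.descFactorial])
    have h5 := (mul_eq_zero.1 h').resolve_left (by norm_num [Nat.descFactorial])
    rw [← hw, ← D.ev_re_add_im hr] at h5
    rw [← hu, ← D.ev_re hr] at h4
    ext
    · exact h4
    · simp only [QuadraticAlgebra.im_zero]
      linear_combination h5 - h4 - (D.ev f).im * hs
  · have h := hF f hf
    rw [contract_lform_pow _ hd, Nat.sub_self, pow_zero, mul_one, C_eq_zero] at h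
    have h4 := (mul_eq_zero.1 h).resolve_left (by norm_num [Nat.descFactorial])
    rw [← hu, ← D.ev_re hr] at h4
    rw [D.ell_apply, ht, h4]
    ring

theorem exists_datum_of_mem_locusII (hI : I ∈ locusII K n (hilb1n221 n)) :
    ∃ D : Datum K n, D.fam = I ∧ D.r = 0 ∧ D.s = 0 ∧ D.t = 1 / 4 := by
  obtain ⟨x, y, hxy, hF⟩ := hI
  obtain ⟨c, e, rfl, rfl, hce⟩ := exists_lform_of_indepForms hxy
  have hce' : LinearIndependent K ![c, e - c] := by
    rw [LinearIndependent.pair_iff] at hce ⊢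
    intro p q hpq
    have := hce (p - q) q (by rw [← hpq]; module)
    exact ⟨by linear_combination this.1 + this.2, this.2⟩
  -- Since `c³e = u⁴ + u³v`, comparison with `u⁴ + 4t u³v` gives `t = 1/4`.
  obtain ⟨D, hu, hv, hr, hs, ht⟩ := Datum.exists_of_linearIndependent hce' 0 0 (1 / 4)
  have hF' : lform c ^ 3 * lform e = lform D.u ^ 4 + lform D.u ^ 3 * lform D.v := by
    have : e = D.u + D.v := by rw [hu, hv]; abel
    rw [this, lform_add, hu]; ring
  have hi : LinearIndependent K ![D.u, D.v] := by rwa [hu, hv]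
  refine ⟨D, (D.eq_fam I (fun f hf hd => ?_) (fun f hf hd => ?_)).symm, hr, hs, ht⟩
  · have h := hF f hf
    rw [hF', contract_add_right, contract_lform_pow _ hd, contract_lform_pow_mul _ _ hd,
      ← D.ev_re hr, ← D.ev_im hr hs] at h
    have h4 : ((4 : ℕ).descFactorial 3 : K) = 24 := by norm_num [Nat.descFactorial]
    have h3 : ((3 : ℕ).descFactorial 3 : K) = 6 := by norm_num [Nat.descFactorial]
    have h3' : ((3 : ℕ).descFactorial (3 - 1) : K) = 6 := by norm_num [Nat.descFactorial]
    rw [h4, h3, h3'] at h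
    have h5 := eq_zero_of_C_mul_add hi (p := 24 * (D.ev f).re + 6 * (D.ev f).im)
      (q := 6 * (D.ev f).re) (by
        rw [← h]
        simp only [C_add, Nat.reduceSub, pow_one, pow_zero]
        ring)
    have h6 : (D.ev f).re = 0 := by linear_combination h5.2 / 6
    ext
    · exact h6
    · simp only [QuadraticAlgebra.im_zero]
      linear_combination h5.1 / 6 - 4 * h6
  · have h := hF f hf
    rw [hF', contract_add_right, contract_lform_pow _ hd, contract_lform_pow_mul _ _ hd,
      ← D.ev_re hr, ← D.ev_im hr hs] at h
    have h4 : ((4 : ℕ).descFactorial 4 : K) = 24 := by norm_num [Nat.descFactorial]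
    have h3 : ((3 : ℕ).descFactorial 4 : K) = 0 := by norm_num [Nat.descFactorial]
    have h3' : ((3 : ℕ).descFactorial (4 - 1) : K) = 6 := by norm_num [Nat.descFactorial]
    rw [h4, h3, h3'] at h
    simp only [Nat.sub_self, pow_zero, mul_one, zero_mul, C_0, zero_add, Nat.reduceSub] at h
    rw [← C_add, C_eq_zero] at h
    rw [D.ell_apply, ht]
    linear_combination h / 24

theorem exists_datum_of_mem_locusI (hI : I ∈ locusI K n (hilb1n221 n)) :
    ∃ D : Datum K n, D.fam = I ∧ D.r = 0 ∧ D.s = 0 ∧ D.t = 0 := by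
  obtain ⟨x, y, hxy, hF, hG⟩ := hI
  obtain ⟨c, e, rfl, rfl, hce⟩ := exists_lform_of_indepForms hxy
  obtain ⟨D, hu, hv, hr, hs, ht⟩ := Datum.exists_of_linearIndependent hce 0 0 0
  have hc : lform c ≠ 0 := (indepForms_lform hce).2.2.ne_zero 0
  have hre : ∀ f ∈ I.ideal, ∀ k, k ≤ 4 → f.IsHomogeneous k → (D.ev f).re = 0 := by
    intro f hf k hk hd
    have h := hF f hf
    rw [contract_lform_pow _ hd, mul_eq_zero, or_iff_left (pow_ne_zero _ hc), C_eq_zero] at h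
    rw [D.ev_re hr, hu]
    exact (mul_eq_zero.1 h).resolve_left
      (Nat.cast_ne_zero.2 (mt Nat.descFactorial_eq_zero_iff_lt.1 (by omega)))
  refine ⟨D, (D.eq_fam I (fun f hf hd => ?_) (fun f hf hd => ?_)).symm, hr, hs, ht⟩
  · have h := hG f hf
    rw [contract_lform_pow_mul _ _ hd, Nat.descFactorial_eq_zero_iff_lt.2 (by norm_num)] at h
    simp only [Nat.cast_zero, zero_mul, C_0, zero_add, Nat.reduceSub, pow_zero, mul_one,
      C_eq_zero, Nat.sub_self] at h
    have h5 := (mul_eq_zero.1 h).resolve_left (by norm_num [Nat.descFactorial])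
    ext
    · exact hre f hf 3 (by norm_num) hd
    · rw [D.ev_im hr hs, hu, hv, h5]; rfl
  · rw [D.ell_apply, ht, hre f hf 4 le_rfl hd]
    ring

/-! ### The locus of a datum -/

namespace Datum

/-- The discriminant of `ω² - s ω - r`. -/
def disc {A : Type u} [CommRing A] (D : Datum A n) : A := D.s ^ 2 + 4 * D.r

/-- The value at `t` of `ω² - s ω - r`. -/
def nrm {A : Type u} [CommRing A] (D : Datum A n) : A := D.t ^ 2 - D.s * D.t - D.r

/-- The right-hand side says that the quadratic algebra has a nonzero element of square zero,
expressed through the ideal alone. Thus vanishing of the discriminant does not depend on the datum.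
-/
theorem disc_eq_zero_iff (D : Datum K n) : D.disc = 0 ↔
    ∃ f : MvPolynomial (Fin n) K, f.IsHomogeneous 1 ∧ f * f ∈ D.fam.ideal ∧
      ∃ g : MvPolynomial (Fin n) K, g.IsHomogeneous 1 ∧ f * g ∉ D.fam.ideal := by
  constructor
  · intro h
    -- The element `ω - s/2` has square `disc / 4`.
    have h1 := D.lift_isHomogeneous 0 ⟨-D.s / 2, 1⟩
    refine ⟨_, h1, (D.mem_ideal_two (h1.mul h1)).2 ?_, lform D.a, lform_isHomogeneous _,
      fun hm => ?_⟩
    · rw [map_mul, ev_lift, QuadraticAlgebra.mk_mul_mk]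
      rw [disc] at h
      ext
      · simp only [QuadraticAlgebra.re_zero]
        linear_combination h / 4
      · simp only [QuadraticAlgebra.im_zero]
        ring
    · have := (D.mem_ideal_two (h1.mul (lform_isHomogeneous _))).1 hm
      rw [map_mul, ev_lift, ev_lform_a, mul_one] at this
      exact one_ne_zero (congrArg QuadraticAlgebra.im this)
  · rintro ⟨f, hf, hff, g, hg, hfg⟩
    have h1 := (D.mem_ideal_two (hf.mul hf)).1 hff
    have hne : D.ev f ≠ 0 := fun h => hfg ((D.mem_ideal_two (hf.mul hg)).2 (by
      rw [map_mul, h, zero_mul]))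
    rw [map_mul] at h1
    have hre := congrArg QuadraticAlgebra.re h1
    have him := congrArg QuadraticAlgebra.im h1
    simp only [QuadraticAlgebra.re_mul, QuadraticAlgebra.im_mul, QuadraticAlgebra.re_zero,
      QuadraticAlgebra.im_zero] at hre him
    have hq : (D.ev f).im ≠ 0 := fun h => hne (by
      rw [h] at hre
      ext
      · simpa using hre
      · exact h)
    have h2 : 2 * (D.ev f).re + D.s * (D.ev f).im = 0 := by
      refine (mul_eq_zero.1 ?_).resolve_left hq
      linear_combination him
    have h3 : (D.ev f).im ^ 2 * D.disc = 0 := by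
      rw [disc]
      linear_combination 4 * hre + (D.s * (D.ev f).im - 2 * (D.ev f).re) * h2
    exact (mul_eq_zero.1 h3).resolve_left (pow_ne_zero 2 hq)

/-- The right-hand side is a nonzero socle element of the quotient in degree 3, that is, an element
of `Q` generating an ideal killed by the functional. -/
theorem nrm_eq_zero_iff (D : Datum K n) : D.nrm = 0 ↔
    ∃ f : MvPolynomial (Fin n) K, f.IsHomogeneous 3 ∧ f ∉ D.fam.ideal ∧
      ∀ g : MvPolynomial (Fin n) K, g.IsHomogeneous 1 → g * f ∈ D.fam.ideal := by
  constructor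
  · intro h
    -- Up to scale, `ω - t` spans the kernel of the functional, and `ω (ω - t)` is sent to `-nrm`.
    have h1 := D.lift_isHomogeneous 2 ⟨-D.t, 1⟩
    refine ⟨_, h1, fun hm => ?_, fun g hg => (D.mem_ideal_four (hg.mul h1)).2 ?_⟩
    · have := (D.mem_ideal_three h1).1 hm
      rw [ev_lift] at this
      exact one_ne_zero (congrArg QuadraticAlgebra.im this)
    · rw [map_mul, ev_lift, ell_apply, QuadraticAlgebra.re_mul, QuadraticAlgebra.im_mul]
      rw [nrm] at h
      linear_combination -(D.ev g).im * h
  · rintro ⟨f, hf, hfn, h⟩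
    have ha := (D.mem_ideal_four ((lform_isHomogeneous _).mul hf)).1 (h _ (lform_isHomogeneous D.a))
    have hb := (D.mem_ideal_four ((lform_isHomogeneous _).mul hf)).1 (h _ (lform_isHomogeneous D.b))
    rw [map_mul, ev_lform_a, one_mul, ell_apply] at ha
    rw [map_mul, ev_lform_b, ell_apply, QuadraticAlgebra.re_mul, QuadraticAlgebra.im_mul] at hb
    have hq : (D.ev f).im ≠ 0 := fun h => hfn ((D.mem_ideal_three hf).2 (by
      rw [h] at ha
      ext
      · simpa using ha
      · exact h))
    refine (mul_eq_zero.1 (?_ : (D.ev f).im * D.nrm = 0)).resolve_left hq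
    rw [nrm]
    linear_combination D.t * ha - hb

theorem disc_eq_zero_congr {D D' : Datum K n} (h : D.fam = D'.fam) :
    D.disc = 0 ↔ D'.disc = 0 := by
  rw [disc_eq_zero_iff, disc_eq_zero_iff, h]

theorem nrm_eq_zero_congr {D D' : Datum K n} (h : D.fam = D'.fam) :
    D.nrm = 0 ↔ D'.nrm = 0 := by
  rw [nrm_eq_zero_iff, nrm_eq_zero_iff, h]

variable [IsAlgClosed K]

theorem exists_fam_eq_r_eq_zero (D : Datum K n) :
    ∃ D' : Datum K n, D'.fam = D.fam ∧ D'.r = 0 ∧ (D'.s = 0 ↔ D.disc = 0) ∧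
      (D'.t * (D'.t - D'.s) = 0 ↔ D.nrm = 0) := by
  obtain ⟨z, hz⟩ := IsAlgClosed.exists_pow_nat_eq D.disc (n := 2) (by norm_num)
  rw [disc] at hz
  -- The shift is by a root of `ω² - s ω - r`, which moves this root to zero.
  refine ⟨D.shift ((D.s + z) / 2), D.fam_shift _, ?_, ?_, ?_⟩
  · simp only [shift]
    linear_combination -hz / 4
  · have h1 : (D.shift ((D.s + z) / 2)).s = -z := by simp only [shift]; ring
    rw [h1, disc, ← hz]
    simp
  · have h1 : (D.shift ((D.s + z) / 2)).t * ((D.shift ((D.s + z) / 2)).t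
        - (D.shift ((D.s + z) / 2)).s) = D.nrm := by
      simp only [shift, nrm]
      linear_combination -hz / 4
    rw [h1]

/-- Membership supplies a datum in normal form, for which both invariants are computed directly, and
their vanishing depends only on the ideal. Conversely, a shift to `r = 0` reduces to the explicit
dual forms. The other three loci are handled alike. -/
theorem fam_mem_locusIV_iff (D : Datum K n) :
    D.fam ∈ locusIV K n (hilb1n221 n) ↔ D.disc ≠ 0 ∧ D.nrm ≠ 0 := by
  constructor
  · intro h
    obtain ⟨D', hD', hr, hs, ht⟩ := exists_datum_of_mem_locusIV h
    rw [Ne, Ne, ← disc_eq_zero_congr hD', ← nrm_eq_zero_congr hD', disc, nrm, hr, hs, ht]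
    norm_num
  · rintro ⟨h1, h2⟩
    obtain ⟨D', hD', hr, hs, ht⟩ := D.exists_fam_eq_r_eq_zero
    rw [← hD']
    rw [Ne, ← hs] at h1
    rw [Ne, ← ht, mul_eq_zero, not_or, sub_eq_zero] at h2
    exact D'.fam_mem_locusIV hr h1 h2.1 h2.2

theorem fam_mem_locusIII_iff (D : Datum K n) :
    D.fam ∈ locusIII K n (hilb1n221 n) ↔ D.disc ≠ 0 ∧ D.nrm = 0 := by
  constructor
  · intro h
    obtain ⟨D', hD', hr, hs, ht⟩ := exists_datum_of_mem_locusIII h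
    rw [Ne, ← disc_eq_zero_congr hD', ← nrm_eq_zero_congr hD', disc, nrm, hr, hs, ht]
    norm_num
  · rintro ⟨h1, h2⟩
    obtain ⟨D', hD', hr, hs, ht⟩ := D.exists_fam_eq_r_eq_zero
    rw [← hD']
    rw [Ne, ← hs] at h1
    rw [← ht, mul_eq_zero, sub_eq_zero] at h2
    exact D'.fam_mem_locusIII hr h1 h2

theorem fam_mem_locusII_iff (D : Datum K n) :
    D.fam ∈ locusII K n (hilb1n221 n) ↔ D.disc = 0 ∧ D.nrm ≠ 0 := by
  constructor
  · intro h
    obtain ⟨D', hD', hr, hs, ht⟩ := exists_datum_of_mem_locusII h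
    rw [Ne, ← disc_eq_zero_congr hD', ← nrm_eq_zero_congr hD', disc, nrm, hr, hs, ht]
    norm_num
  · rintro ⟨h1, h2⟩
    obtain ⟨D', hD', hr, hs, ht⟩ := D.exists_fam_eq_r_eq_zero
    rw [← hD']
    rw [← hs] at h1
    rw [Ne, ← ht, mul_eq_zero, not_or] at h2
    exact D'.fam_mem_locusII hr h1 h2.1

theorem fam_mem_locusI_iff (D : Datum K n) :
    D.fam ∈ locusI K n (hilb1n221 n) ↔ D.disc = 0 ∧ D.nrm = 0 := by
  constructor
  · intro h
    obtain ⟨D', hD', hr, hs, ht⟩ := exists_datum_of_mem_locusI h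
    rw [← disc_eq_zero_congr hD', ← nrm_eq_zero_congr hD', disc, nrm, hr, hs, ht]
    norm_num
  · rintro ⟨h1, h2⟩
    obtain ⟨D', hD', hr, hs, ht⟩ := D.exists_fam_eq_r_eq_zero
    rw [← hD']
    rw [← hs] at h1
    rw [← ht, h1, sub_zero, mul_self_eq_zero] at h2
    exact D'.fam_mem_locusI hr h1 h2

end Datum

theorem union_loci_eq_univ [IsAlgClosed K] :
    locusI K n (hilb1n221 n) ∪ locusII K n (hilb1n221 n) ∪ locusIII K n (hilb1n221 n) ∪
      locusIV K n (hilb1n221 n) = Set.univ := by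
  refine Set.eq_univ_of_forall fun I => ?_
  obtain ⟨D, rfl⟩ := exists_fam_eq I
  simp only [Set.mem_union, D.fam_mem_locusI_iff, D.fam_mem_locusII_iff, D.fam_mem_locusIII_iff,
    D.fam_mem_locusIV_iff]
  tauto

end Types

/-! ### Affine space with the Zariski topology -/

section Zariski

/-- Affine space, with the Zariski topology on its rational points. -/
def Zar (σ : Type) (K : Type u) : Type u := σ → K

variable {σ τ : Type} {K : Type u} [Field K]

/-- The value of a polynomial at a point. -/
def evalAt (x : Zar σ K) : MvPolynomial σ K →ₐ[K] K := aeval fun i => x i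

@[simp] theorem evalAt_X (x : Zar σ K) (i : σ) : evalAt x (X i) = x i := aeval_X _ i

theorem evalAt_C (x : Zar σ K) (c : K) : evalAt x (C c) = c := by
  rw [evalAt, aeval_C]; rfl

/-- The prime ideal of a point. -/
def primeAt (x : Zar σ K) : PrimeSpectrum (MvPolynomial σ K) :=
  ⟨RingHom.ker (evalAt x), RingHom.ker_isPrime _⟩

instance : TopologicalSpace (Zar σ K) := TopologicalSpace.induced primeAt inferInstance

theorem isInducing_primeAt : Topology.IsInducing (primeAt : Zar σ K → _) := ⟨rfl⟩

theorem isClosed_zar_iff {Z : Set (Zar σ K)} :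
    IsClosed Z ↔ ∃ S : Set (MvPolynomial σ K), Z = {x | ∀ p ∈ S, evalAt x p = 0} := by
  rw [isInducing_primeAt.isClosed_iff]
  constructor
  · rintro ⟨W, hW, rfl⟩
    obtain ⟨S, rfl⟩ := (PrimeSpectrum.isClosed_iff_zeroLocus W).1 hW
    exact ⟨S, rfl⟩
  · rintro ⟨S, rfl⟩
    exact ⟨_, PrimeSpectrum.isClosed_zeroLocus S, rfl⟩

theorem isOpen_ne_zero (p : MvPolynomial σ K) : IsOpen {x : Zar σ K | evalAt x p ≠ 0} := by
  rw [← isClosed_compl_iff, isClosed_zar_iff]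
  exact ⟨{p}, by ext; simp⟩

theorem continuous_zar_of_forall {Y : Type*} [TopologicalSpace Y] {f : Y → Zar σ K}
    (h : ∀ p : MvPolynomial σ K, IsClosed {y | evalAt (f y) p = 0}) : Continuous f := by
  refine continuous_iff_isClosed.2 fun Z hZ => ?_
  obtain ⟨S, rfl⟩ := isClosed_zar_iff.1 hZ
  have : f ⁻¹' {x | ∀ p ∈ S, evalAt x p = 0} = ⋂ p ∈ S, {y | evalAt (f y) p = 0} := by
    ext; simp
  rw [this]
  exact isClosed_biInter fun p _ => h p

theorem isClosed_eq_zero (p : MvPolynomial σ K) : IsClosed {x : Zar σ K | evalAt x p = 0} :=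
  isClosed_zar_iff.2 ⟨{p}, by simp⟩

/-- A polynomial map between affine spaces. -/
def polyMap (γ : τ → MvPolynomial σ K) (x : Zar σ K) : Zar τ K := fun j => evalAt x (γ j)

theorem evalAt_polyMap (γ : τ → MvPolynomial σ K) (x : Zar σ K) (p : MvPolynomial τ K) :
    evalAt (polyMap γ x) p = evalAt x (aeval γ p) := by
  rw [evalAt, evalAt, comp_aeval_apply]
  rfl

theorem continuous_polyMap (γ : τ → MvPolynomial σ K) : Continuous (polyMap γ) :=
  continuous_zar_of_forall fun p => by
    simp only [evalAt_polyMap]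
    exact isClosed_eq_zero _

theorem eq_of_forall_evalAt [Infinite K] {p q : MvPolynomial σ K}
    (h : ∀ x : Zar σ K, evalAt x p = evalAt x q) : p = q :=
  MvPolynomial.funext fun x => by
    have h1 : ∀ r, evalAt (x : Zar σ K) r = eval x r := fun r => by
      rw [← coe_aeval_eq_eval]; rfl
    exact (h1 p).symm.trans ((h x).trans (h1 q))

theorem exists_evalAt_ne_zero [Infinite K] {p : MvPolynomial σ K} (hp : p ≠ 0) :
    ∃ x : Zar σ K, evalAt x p ≠ 0 := by
  by_contra! h
  exact hp (eq_of_forall_evalAt fun x => by rw [h, map_zero])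

theorem exists_ne_zero_subset {U : Set (Zar σ K)} (hU : IsOpen U) {x : Zar σ K} (hx : x ∈ U) :
    ∃ p : MvPolynomial σ K, evalAt x p ≠ 0 ∧ ∀ y : Zar σ K, evalAt y p ≠ 0 → y ∈ U := by
  obtain ⟨S, hS⟩ := isClosed_zar_iff.1 (isClosed_compl_iff.2 hU)
  have h1 : x ∉ Uᶜ := fun h => h hx
  rw [hS] at h1
  simp only [Set.mem_ofPred_eq, not_forall] at h1
  obtain ⟨p, hp, hpx⟩ := h1
  refine ⟨p, hpx, fun y hy => ?_⟩
  by_contra h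
  have h2 : y ∈ Uᶜ := h
  rw [hS] at h2
  exact hy (h2 p hp)

instance [Infinite K] : IrreducibleSpace (Zar σ K) where
  toNonempty := ⟨fun _ => 0⟩
  isPreirreducible_univ := by
    rintro U V hU hV ⟨x, -, hx⟩ ⟨y, -, hy⟩
    obtain ⟨p, hp, hpU⟩ := exists_ne_zero_subset hU hx
    obtain ⟨q, hq, hqV⟩ := exists_ne_zero_subset hV hy
    have hpq : p * q ≠ 0 := mul_ne_zero (fun h => hp (by rw [h, map_zero]))
      (fun h => hq (by rw [h, map_zero]))
    obtain ⟨z, hz⟩ := exists_evalAt_ne_zero hpq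
    rw [map_mul] at hz
    exact ⟨z, trivial, hpU z (left_ne_zero_of_mul hz), hqV z (right_ne_zero_of_mul hz)⟩

instance : T1Space (Zar σ K) where
  t1 x := by
    rw [isClosed_zar_iff]
    refine ⟨Set.range fun i => X i - C (x i), ?_⟩
    ext y
    simp only [Set.mem_singleton_iff, Set.mem_ofPred_eq, Set.forall_mem_range, map_sub, evalAt_X,
      evalAt_C, sub_eq_zero]
    exact funext_iff

/-- The rational points carry the topology induced from the prime spectrum, whose dimension bounds
theirs. -/
theorem topologicalKrullDim_zar_le [Finite σ] :
    topologicalKrullDim (Zar σ K) ≤ (Nat.card σ : WithBot ℕ∞) := by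
  refine (isInducing_primeAt.topologicalKrullDim_le).trans ?_
  rw [PrimeSpectrum.topologicalKrullDim_eq_ringKrullDim,
    MvPolynomial.ringKrullDim_of_isNoetherianRing, ringKrullDim_eq_zero_of_field, zero_add]

/-- The coordinate subspaces through a point. -/
def flag {e : ℕ} (ε : σ ≃ Fin e) (x : Zar σ K) (k : ℕ) : Set (Zar σ K) :=
  {y | ∀ i, k ≤ ε i → y i = x i}

theorem isClosed_flag {e : ℕ} (ε : σ ≃ Fin e) (x : Zar σ K) (k : ℕ) :
    IsClosed (flag ε x k) := by
  rw [isClosed_zar_iff]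
  refine ⟨{p | ∃ i, k ≤ ε i ∧ p = X i - C (x i)}, ?_⟩
  ext y
  constructor
  · rintro hy _ ⟨i, hi, rfl⟩
    rw [map_sub, evalAt_X, evalAt_C, hy i hi, sub_self]
  · intro hy i hi
    have := hy _ ⟨i, hi, rfl⟩
    rwa [map_sub, evalAt_X, evalAt_C, sub_eq_zero] at this

theorem isIrreducible_flag [Infinite K] {e : ℕ} (ε : σ ≃ Fin e) (x : Zar σ K) (k : ℕ) :
    IsIrreducible (flag ε x k) := by
  classical
  have h : flag ε x k = polyMap (fun i => if k ≤ ε i then C (x i) else X i) '' Set.univ := by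
    ext y
    rw [Set.image_univ]
    constructor
    · intro hy
      refine ⟨y, ?_⟩
      funext i
      rw [polyMap]
      split_ifs with hi
      · rw [evalAt_C, hy i hi]
      · rw [evalAt_X]
    · rintro ⟨z, rfl⟩ i hi
      rw [polyMap, if_pos hi, evalAt_C]
  rw [h]
  exact (IrreducibleSpace.isIrreducible_univ _).image _ (continuous_polyMap _).continuousOn

/-- The coordinate flag through a point of `T` restricts to a strict chain of irreducible closed
subsets of `T`. -/
theorem le_topologicalKrullDim_of_isOpen [Infinite K] [Finite σ] {T : Set (Zar σ K)}
    (hT : IsOpen T) (hne : T.Nonempty) :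
    (Nat.card σ : WithBot ℕ∞) ≤ topologicalKrullDim T := by
  classical
  obtain ⟨x, hx⟩ := hne
  let ε := Finite.equivFin σ
  have hemb := hT.isOpenEmbedding_subtypeVal
  have hmem : ∀ k, x ∈ flag ε x k := fun k i _ => rfl
  let Z (k : ℕ) : TopologicalSpace.IrreducibleCloseds T :=
    { carrier := Subtype.val ⁻¹' flag ε x k
      isIrreducible' := (isIrreducible_flag ε x k).preimage hemb ⟨x, hmem k, ⟨x, hx⟩, rfl⟩
      isClosed' := (isClosed_flag ε x k).preimage continuous_subtype_val }
  have hstep : ∀ k < Nat.card σ, Z k < Z (k + 1) := by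
    intro k hk
    refine lt_of_le_of_ne (fun y hy i hi => hy i (by omega)) fun heq => ?_
    let j : σ := ε.symm ⟨k, hk⟩
    have hj : (ε j : ℕ) = k := by simp [j]
    -- Moving the `j`-th coordinate shows that the next flag member meets `X j ≠ x j`; being
    -- irreducible, it does so inside `T`.
    let x' : Zar σ K := fun i => if i = j then x j + 1 else x i
    obtain ⟨w, hw1, hw2, hw3⟩ := (isIrreducible_flag ε x (k + 1)).2 T
      {y | evalAt y (X j - C (x j)) ≠ 0} hT (isOpen_ne_zero _) ⟨x, hmem _, hx⟩
      ⟨x', fun i hi => if_neg (by rintro rfl; omega), by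
        change evalAt x' _ ≠ 0
        rw [map_sub, evalAt_X, evalAt_C, show x' j = x j + 1 from if_pos rfl]
        simp⟩
    have h1 : (⟨w, hw2⟩ : T) ∈ Z (k + 1) := hw1
    rw [← heq] at h1
    have h2 : w j = x j := h1 j hj.ge
    change evalAt w _ ≠ 0 at hw3
    rw [map_sub, evalAt_X, evalAt_C, h2, sub_self] at hw3
    exact hw3 rfl
  let p : LTSeries (TopologicalSpace.IrreducibleCloseds T) :=
    { length := Nat.card σ
      toFun := fun k => Z k
      step := fun k => hstep k k.2 }
  exact Order.LTSeries.length_le_krullDim p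

/-- A space with an open covering by open subsets of affine space has the expected dimension. -/
theorem topologicalKrullDim_eq_of_charts [Infinite K] [Finite σ] {Y : Type*}
    [TopologicalSpace Y] [Nonempty Y]
    (h : ∀ y : Y, ∃ (T : Set (Zar σ K)) (f : T → Y), IsOpen T ∧ Topology.IsOpenEmbedding f ∧
      y ∈ Set.range f) :
    topologicalKrullDim Y = (Nat.card σ : WithBot ℕ∞) := by
  apply le_antisymm
  -- Coheights are local: the irreducible closed sets containing `Z` all meet any chart that `Z`
  -- meets.
  · rw [topologicalKrullDim, Order.krullDim_eq_iSup_coheight]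
    refine iSup_le fun Z => ?_
    obtain ⟨y, hy⟩ := Z.isIrreducible.nonempty
    obtain ⟨T, f, hT, hf, x, rfl⟩ := h y
    let e := TopologicalSpace.IrreducibleCloseds.orderIsoOfIsOpenEmbedding f hf
    obtain ⟨Z', hZ'⟩ := e.surjective ⟨Z, ⟨x, hy⟩⟩
    have hZ : TopologicalSpace.IrreducibleCloseds.map f hf.continuous Z' = Z :=
      congrArg Subtype.val hZ'
    rw [← hZ, hf.coheight_map]
    exact (Order.coheight_le_krullDim _).trans
      ((topologicalKrullDim_subspace_le _ T).trans topologicalKrullDim_zar_le)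
  · obtain ⟨T, f, hT, hf, x, -⟩ := h (Classical.arbitrary Y)
    exact (le_topologicalKrullDim_of_isOpen hT ⟨x, x.2⟩).trans
      hf.isInducing.topologicalKrullDim_le

end Zariski

section Coordinates

variable {K : Type u} [Field K] {n : ℕ}

/-! ### Families over affine space -/

/-- Closedness of a set of ideals is tested on families, and `D.fam` is one such family over affine
space. -/
theorem continuous_fam {σ : Type} (D : Datum (MvPolynomial σ K) n) :
    Continuous fun x : Zar σ K => (D.map (evalAt x).toRingHom).fam := by
  refine continuous_iff_isClosed.2 fun Z hZ => ?_
  obtain ⟨s, hs⟩ := isClosed_iff.1 hZ _ D.fam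
  rw [isClosed_zar_iff]
  refine ⟨s, ?_⟩
  ext x
  rw [Set.mem_preimage, ← D.fam_map]
  exact hs (evalAt x)

/-! ### Functionals on the forms modulo the ideal of a datum -/

/-- Two functionals on cubic forms and one on quartic forms. -/
def funDeg : Option Bool → ℕ
  | some _ => 3
  | none => 4

namespace Datum

theorem functional_three (D : Datum K n) (lam : piece D.fam.ideal 3 →ₗ[K] K)
    (f g h : homogeneousSubmodule (Fin n) K 3) (hg : D.ev g.1 = 1) (hh : D.ev h.1 = ⟨0, 1⟩) :
    lam (Submodule.Quotient.mk f) = (D.ev f.1).re * lam (Submodule.Quotient.mk g)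
      + (D.ev f.1).im * lam (Submodule.Quotient.mk h) := by
  have h0 : (Submodule.Quotient.mk (f - ((D.ev f.1).re • g + (D.ev f.1).im • h)) :
      piece D.fam.ideal 3) = 0 := by
    rw [mk_piece_eq_zero_iff]
    refine (D.mem_ideal_three (f - ((D.ev f.1).re • g + (D.ev f.1).im • h)).2).2 ?_
    change D.ev (f.1 - ((D.ev f.1).re • g.1 + (D.ev f.1).im • h.1)) = 0
    rw [map_sub, map_add, map_smul, map_smul, hg, hh]
    ext <;> simp [QuadraticAlgebra.re_one, QuadraticAlgebra.im_one]
  have h1 := congrArg lam h0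
  rw [Submodule.Quotient.mk_sub, Submodule.Quotient.mk_add, Submodule.Quotient.mk_smul,
    Submodule.Quotient.mk_smul, map_sub, map_add, map_smul, map_smul, map_zero] at h1
  exact sub_eq_zero.1 h1

theorem functional_four (D : Datum K n) (lam : piece D.fam.ideal 4 →ₗ[K] K)
    (f g : homogeneousSubmodule (Fin n) K 4) (hg : D.ev g.1 = 1) :
    lam (Submodule.Quotient.mk f) = D.ell (D.ev f.1) * lam (Submodule.Quotient.mk g) := by
  have h0 : (Submodule.Quotient.mk (f - D.ell (D.ev f.1) • g) : piece D.fam.ideal 4) = 0 := by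
    rw [mk_piece_eq_zero_iff]
    refine (D.mem_ideal_four (f - D.ell (D.ev f.1) • g).2).2 ?_
    change D.ell (D.ev (f.1 - D.ell (D.ev f.1) • g.1)) = 0
    rw [map_sub, map_smul, hg, map_sub, map_smul]
    have : D.ell 1 = 1 := by
      simp [ell_apply, QuadraticAlgebra.re_one, QuadraticAlgebra.im_one]
    rw [this, smul_eq_mul, mul_one, sub_self]
  have h1 := congrArg lam h0
  rw [Submodule.Quotient.mk_sub, Submodule.Quotient.mk_smul, map_sub, map_smul, map_zero] at h1
  exact sub_eq_zero.1 h1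

/-- The functionals on cubics and quartics attached to a datum. -/
def functionals (D : Datum K n) : ∀ k, piece D.fam.ideal (funDeg k) →ₗ[K] K
  | some true => Submodule.liftQ _
      (QuadraticAlgebra.reₗ D.r D.s ∘ₗ D.ev.toLinearMap ∘ₗ Submodule.subtype _)
      (fun f hf => congrArg QuadraticAlgebra.re ((D.mem_ideal_three f.2).1 hf))
  | some false => Submodule.liftQ _
      (QuadraticAlgebra.imₗ D.r D.s ∘ₗ D.ev.toLinearMap ∘ₗ Submodule.subtype _)
      (fun f hf => congrArg QuadraticAlgebra.im ((D.mem_ideal_three f.2).1 hf))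
  | none => Submodule.liftQ _ (D.ell ∘ₗ D.ev.toLinearMap ∘ₗ Submodule.subtype _)
      (fun f hf => (D.mem_ideal_four f.2).1 hf)

end Datum

/-! ### Coordinates -/

/-- Values of functionals on forms, as variables. -/
abbrev Values (K : Type u) [Field K] (n : ℕ) :=
  MvPolynomial (Σ k, homogeneousSubmodule (Fin n) K (funDeg k)) K

/-- The value of a functional at the cubic `l² m`. -/
def cubeVar (i : Bool) (l m : Fin n → K) : Values K n :=
  X ⟨some i, ⟨lform l ^ 2 * lform m,
    (lform_pow_isHomogeneous l 2).mul (lform_isHomogeneous m)⟩⟩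

/-- The value of the functional on quartics at `l³ m`. -/
def quartVar (l m : Fin n → K) : Values K n :=
  X ⟨none, ⟨lform l ^ 3 * lform m,
    (lform_pow_isHomogeneous l 3).mul (lform_isHomogeneous m)⟩⟩

/-- The value of a functional at the cubic `l m²`. -/
def cubeVar' (i : Bool) (l m : Fin n → K) : Values K n :=
  X ⟨some i, ⟨lform m ^ 2 * lform l,
    (lform_pow_isHomogeneous m 2).mul (lform_isHomogeneous l)⟩⟩

/-- The common denominator of the coordinates. -/
def denom (a b : Fin n → K) : Values K n :=
  (cubeVar true a a * cubeVar false a b - cubeVar true a b * cubeVar false a a) * quartVar a a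

/-- The parameters of a chart. -/
abbrev Params (n k : ℕ) : Type := (Fin (n - 2) ⊕ Fin (n - 2)) ⊕ Fin k

/-- The numerators of the coordinates. -/
def numer (a b : Fin n → K) (h : Fin (n - 2) → Fin n → K) : Params n 3 → Values K n
  | .inl (.inl k) => (cubeVar true a (h k) * cubeVar false a b
      - cubeVar false a (h k) * cubeVar true a b) * quartVar a a
  | .inl (.inr k) => (cubeVar true a a * cubeVar false a (h k)
      - cubeVar false a a * cubeVar true a (h k)) * quartVar a a
  | .inr 0 => (cubeVar' true a b * cubeVar false a b
      - cubeVar' false a b * cubeVar true a b) * quartVar a a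
  | .inr 1 => (cubeVar true a a * cubeVar' false a b
      - cubeVar false a a * cubeVar' true a b) * quartVar a a
  | .inr 2 => (cubeVar true a a * cubeVar false a b - cubeVar true a b * cubeVar false a a)
      * quartVar a b

namespace Datum

/-- The coordinates of a datum. -/
def coords (D : Datum K n) (h : Fin (n - 2) → Fin n → K) : Zar (Params n 3) K
  | .inl (.inl k) => ∑ i, h k i * D.u i
  | .inl (.inr k) => ∑ i, h k i * D.v i
  | .inr 0 => D.r
  | .inr 1 => D.s
  | .inr 2 => D.t

/-- Cramer's rule. The ideal forces `lam(a²c) = (c·u) lam(a³) + (c·v) lam(a²b)` for a functional on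
cubics; two such functionals give a linear system with the determinant in `denom`. The value `ω²` of
`a b²` yields `r` and `s`, and the quartic functional yields `t`. -/
theorem value_numer (D : Datum K n) (h : Fin (n - 2) → Fin n → K)
    (lam : ∀ k, piece D.fam.ideal (funDeg k) →ₗ[K] K) (j : Params n 3) :
    aeval (value lam) (numer D.a D.b h j)
      = D.coords h j * aeval (value lam) (denom D.a D.b) := by
  have h3 : ∀ i c, aeval (value lam) (cubeVar i D.a c)
      = (∑ j, c j * D.u j) * aeval (value lam) (cubeVar i D.a D.a)
        + (∑ j, c j * D.v j) * aeval (value lam) (cubeVar i D.a D.b) := by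
    intro i c
    simp only [cubeVar, aeval_X]
    refine (D.functional_three (lam (some i)) _ ⟨lform D.a ^ 2 * lform D.a,
      (lform_pow_isHomogeneous D.a 2).mul (lform_isHomogeneous D.a)⟩ ⟨lform D.a ^ 2 * lform D.b,
      (lform_pow_isHomogeneous D.a 2).mul (lform_isHomogeneous D.b)⟩ (by simp) (by simp)).trans ?_
    have h1 : D.ev (lform D.a ^ 2 * lform c) = ⟨∑ j, c j * D.u j, ∑ j, c j * D.v j⟩ := by
      rw [map_mul, map_pow, ev_lform_a, one_pow, one_mul, ev_lform]
    simp only [h1]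
    rfl
  have h3' : ∀ i, aeval (value lam) (cubeVar' i D.a D.b)
      = D.r * aeval (value lam) (cubeVar i D.a D.a)
        + D.s * aeval (value lam) (cubeVar i D.a D.b) := by
    intro i
    simp only [cubeVar, cubeVar', aeval_X]
    refine (D.functional_three (lam (some i)) _ ⟨lform D.a ^ 2 * lform D.a,
      (lform_pow_isHomogeneous D.a 2).mul (lform_isHomogeneous D.a)⟩ ⟨lform D.a ^ 2 * lform D.b,
      (lform_pow_isHomogeneous D.a 2).mul (lform_isHomogeneous D.b)⟩ (by simp) (by simp)).trans ?_
    have h1 : D.ev (lform D.b ^ 2 * lform D.a) = ⟨D.r, D.s⟩ := by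
      rw [map_mul, map_pow, ev_lform_a, mul_one, ev_lform_b, sq, QuadraticAlgebra.mk_mul_mk]
      ext <;> simp
    simp only [h1]
    rfl
  have h4 : aeval (value lam) (quartVar D.a D.b) = D.t * aeval (value lam) (quartVar D.a D.a) := by
    simp only [quartVar, aeval_X]
    refine (D.functional_four (lam none) _ ⟨lform D.a ^ 3 * lform D.a,
      (lform_pow_isHomogeneous D.a 3).mul (lform_isHomogeneous D.a)⟩ (by simp)).trans ?_
    have h1 : D.ell (D.ev (lform D.a ^ 3 * lform D.b)) = D.t := by
      simp [ell_apply]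
    simp only [h1]
    rfl
  match j with
  | .inl (.inl k) =>
    simp only [numer, denom, coords, map_mul, map_sub, h3 _ (h k)]
    ring
  | .inl (.inr k) =>
    simp only [numer, denom, coords, map_mul, map_sub, h3 _ (h k)]
    ring
  | .inr 0 =>
    simp only [numer, denom, coords, map_mul, map_sub, h3']
    ring
  | .inr 1 =>
    simp only [numer, denom, coords, map_mul, map_sub, h3']
    ring
  | .inr 2 =>
    simp only [numer, denom, coords, map_mul, map_sub, h4]
    ring

theorem value_functionals_denom (D : Datum K n) :
    aeval (value D.functionals) (denom D.a D.b) = 1 := by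
  have h1 : ∀ c, aeval (value D.functionals) (cubeVar true D.a c)
      = (D.ev (lform D.a ^ 2 * lform c)).re := fun c => by rw [cubeVar, aeval_X]; rfl
  have h2 : ∀ c, aeval (value D.functionals) (cubeVar false D.a c)
      = (D.ev (lform D.a ^ 2 * lform c)).im := fun c => by rw [cubeVar, aeval_X]; rfl
  have h3 : aeval (value D.functionals) (quartVar D.a D.a)
      = D.ell (D.ev (lform D.a ^ 3 * lform D.a)) := by rw [quartVar, aeval_X]; rfl
  simp only [denom, map_mul, map_sub, h1, h2, h3]
  simp [ell_apply, QuadraticAlgebra.re_one, QuadraticAlgebra.im_one]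

end Datum

/-- Clears denominators, so that a polynomial in the ratios `numer / denom` becomes one in the
values of functionals. -/
theorem exists_homogenization {σ : Type} (p : MvPolynomial σ K) :
    ∃ (N : ℕ) (P : MvPolynomial (Option σ) K), ∀ (x : Zar σ K) (w : K),
      aeval (fun o : Option σ => o.elim w fun j => x j * w) P = w ^ N * evalAt x p := by
  induction p using MvPolynomial.induction_on with
  | C c => exact ⟨0, C c, fun x w => by rw [evalAt_C, aeval_C]; simp⟩
  | add p q hp hq =>
    obtain ⟨N, P, hP⟩ := hp
    obtain ⟨M, Q, hQ⟩ := hq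
    refine ⟨N + M, X none ^ M * P + X none ^ N * Q, fun x w => ?_⟩
    simp only [map_add, map_mul, map_pow, aeval_X, hP, hQ, Option.elim_none]
    ring
  | mul_X p i hp =>
    obtain ⟨N, P, hP⟩ := hp
    refine ⟨N + 1, P * X (some i), fun x w => ?_⟩
    simp only [map_mul, aeval_X, hP, Option.elim_some, evalAt_X]
    ring

/-- The vanishing of a polynomial in the coordinates is a closed condition. -/
theorem exists_isClosed_coords (a b : Fin n → K) (h : Fin (n - 2) → Fin n → K)
    (p : MvPolynomial (Params n 3) K) :
    ∃ Z : Set (GradedHilb K n (hilb1n221 n)), IsClosed Z ∧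
      ∀ D : Datum K n, D.a = a → D.b = b → (D.fam ∈ Z ↔ evalAt (D.coords h) p = 0) := by
  obtain ⟨N, P, hP⟩ := exists_homogenization p
  refine ⟨_, isClosed_forall_functionals funDeg
    (denom a b * aeval (fun o : Option (Params n 3) => o.elim (denom a b) (numer a b h)) P), ?_⟩
  rintro D rfl rfl
  have key : ∀ lam : ∀ k, piece D.fam.ideal (funDeg k) →ₗ[K] K,
      aeval (value lam) (denom D.a D.b *
        aeval (fun o : Option (Params n 3) => o.elim (denom D.a D.b) (numer D.a D.b h)) P)
      = aeval (value lam) (denom D.a D.b) ^ (N + 1) * evalAt (D.coords h) p := by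
    intro lam
    rw [map_mul, comp_aeval_apply, pow_succ', mul_assoc, ← hP]
    congr 3
    ext o
    cases o with
    | none => rfl
    | some j => exact D.value_numer h lam j
  constructor
  · intro hD
    -- For these functionals the denominator is `1`, so the condition gives back the vanishing of
    -- `p`.
    have := hD D.functionals
    rwa [key, D.value_functionals_denom, one_pow, one_mul] at this
  · intro hp lam
    rw [key, hp, mul_zero]

/-- The domain of a chart. -/
def chartDomain (a b : Fin n → K) : Set (GradedHilb K n (hilb1n221 n)) :=
  {I | ∃ lam : ∀ k, piece I.ideal (funDeg k) →ₗ[K] K, aeval (value lam) (denom a b) ≠ 0}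

theorem isOpen_chartDomain (a b : Fin n → K) : IsOpen (chartDomain a b) := by
  rw [← isClosed_compl_iff]
  convert isClosed_forall_functionals (H := hilb1n221 n) funDeg (denom a b) using 1
  ext I
  simp [chartDomain]

theorem Datum.fam_mem_chartDomain (D : Datum K n) : D.fam ∈ chartDomain D.a D.b :=
  ⟨D.functionals, by rw [D.value_functionals_denom]; exact one_ne_zero⟩

/-- A nonzero determinant makes `a³, a²b` independent modulo the ideal, and a nonzero value at `a⁴`
keeps `a⁴` outside it; thus `a, b` are adapted. -/
theorem exists_datum_of_mem_chartDomain {a b : Fin n → K} {I : GradedHilb K n (hilb1n221 n)}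
    (hI : I ∈ chartDomain a b) : ∃ D : Datum K n, D.a = a ∧ D.b = b ∧ D.fam = I := by
  obtain ⟨lam, hlam⟩ := hI
  refine IsAdapted.exists_datum ⟨fun p q hpq => ?_, fun h4 => hlam ?_⟩
  · have h1 : ∀ i, p * aeval (value lam) (cubeVar i a a) + q * aeval (value lam) (cubeVar i a b)
        = 0 := by
      intro i
      simp only [cubeVar, aeval_X, value]
      refine (fun L : piece I.ideal 3 →ₗ[K] K => ?_ : ∀ L : piece I.ideal 3 →ₗ[K] K,
        p * L (Submodule.Quotient.mk ⟨lform a ^ 2 * lform a,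
          (lform_pow_isHomogeneous a 2).mul (lform_isHomogeneous a)⟩)
        + q * L (Submodule.Quotient.mk ⟨lform a ^ 2 * lform b,
          (lform_pow_isHomogeneous a 2).mul (lform_isHomogeneous b)⟩) = 0) (lam (some i))
      have h2 : (Submodule.Quotient.mk (p • (⟨lform a ^ 2 * lform a,
          (lform_pow_isHomogeneous a 2).mul (lform_isHomogeneous a)⟩ :
            homogeneousSubmodule (Fin n) K 3) + q • ⟨lform a ^ 2 * lform b,
          (lform_pow_isHomogeneous a 2).mul (lform_isHomogeneous b)⟩) : piece I.ideal 3) = 0 := by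
        rw [mk_piece_eq_zero_iff]
        change p • (lform a ^ 2 * lform a) + q • (lform a ^ 2 * lform b) ∈ I.ideal
        rw [smul_eq_C_mul, smul_eq_C_mul, ← pow_succ]
        exact hpq
      have h3 := congrArg L h2
      rw [Submodule.Quotient.mk_add, Submodule.Quotient.mk_smul, Submodule.Quotient.mk_smul,
        map_add, map_smul, map_smul, map_zero] at h3
      exact h3
    have ht := h1 true
    have hf := h1 false
    simp only [denom, map_mul, map_sub] at hlam
    have hd := left_ne_zero_of_mul hlam
    constructor
    · refine (mul_eq_zero.1 ?_).resolve_right hd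
      linear_combination aeval (value lam) (cubeVar false a b) * ht
        - aeval (value lam) (cubeVar true a b) * hf
    · refine (mul_eq_zero.1 ?_).resolve_right hd
      linear_combination aeval (value lam) (cubeVar true a a) * hf
        - aeval (value lam) (cubeVar false a a) * ht
  · have h1 : aeval (value lam) (quartVar a a) = 0 := by
      simp only [quartVar, aeval_X, value]
      have h2 : (Submodule.Quotient.mk (⟨lform a ^ 3 * lform a,
          (lform_pow_isHomogeneous a 3).mul (lform_isHomogeneous a)⟩ :
            homogeneousSubmodule (Fin n) K 4) : piece I.ideal 4) = 0 := by
        rw [mk_piece_eq_zero_iff]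
        change lform a ^ 3 * lform a ∈ I.ideal
        rw [← pow_succ]
        exact h4
      exact (congrArg (lam none) h2).trans (map_zero _)
    rw [denom, map_mul, h1, mul_zero]

end Coordinates

section Charts

variable {K : Type u} [Field K] {n : ℕ}

/-! ### Charts -/

/-- A completion of the vectors `u, v` of a datum to a basis, and of `a, b` to the dual basis. -/
structure Frame (D : Datum K n) where
  w : Fin (n - 2) → Fin n → K
  h : Fin (n - 2) → Fin n → K
  aw : ∀ k, ∑ i, D.a i * w k i = 0
  bw : ∀ k, ∑ i, D.b i * w k i = 0
  hu : ∀ k, ∑ i, h k i * D.u i = 0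
  hv : ∀ k, ∑ i, h k i * D.v i = 0
  hw : ∀ j k, ∑ i, h j i * w k i = if j = k then 1 else 0
  expand : ∀ (x : Fin n → K) (i : Fin n), x i = (∑ j, D.a j * x j) * D.u i
    + (∑ j, D.b j * x j) * D.v i + ∑ k, (∑ j, h k j * x j) * w k i

theorem Datum.nonempty_frame (D : Datum K n) : Nonempty (Frame D) := by
  classical
  let q : (Fin n → K) →ₗ[K] (Fin 2 → K) :=
    LinearMap.pi ![Fintype.linearCombination K D.a, Fintype.linearCombination K D.b]
  have q0 : ∀ x, q x 0 = ∑ j, D.a j * x j := fun x => by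
    simp [q, Fintype.linearCombination_apply, mul_comm]
  have q1 : ∀ x, q x 1 = ∑ j, D.b j * x j := fun x => by
    simp [q, Fintype.linearCombination_apply, mul_comm]
  have qu : q D.u = ![1, 0] := by
    ext i; fin_cases i
    · exact (q0 _).trans D.au
    · exact (q1 _).trans D.bu
  have qv : q D.v = ![0, 1] := by
    ext i; fin_cases i
    · exact (q0 _).trans D.av
    · exact (q1 _).trans D.bv
  have hq : LinearMap.range q = ⊤ := by
    rw [LinearMap.range_eq_top]
    intro z
    refine ⟨z 0 • D.u + z 1 • D.v, ?_⟩
    rw [map_add, map_smul, map_smul, qu, qv]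
    ext i; fin_cases i <;> simp
  have hrank : Module.finrank K (LinearMap.ker q) = n - 2 := by
    have := LinearMap.finrank_range_add_finrank_ker q
    rw [hq, finrank_top, Module.finrank_fin_fun, Module.finrank_fin_fun] at this
    omega
  let B := Module.finBasisOfFinrankEq K (LinearMap.ker q) hrank
  -- Projection along `u, v` onto the common kernel of `a, b`; a basis of this kernel provides the
  -- `w`, its coordinates after projection the `h`.
  let pr : (Fin n → K) →ₗ[K] LinearMap.ker q :=
    (LinearMap.id - (LinearMap.proj 0 ∘ₗ q).smulRight D.u
      - (LinearMap.proj 1 ∘ₗ q).smulRight D.v).codRestrict _ (by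
        intro x
        simp only [LinearMap.mem_ker, LinearMap.sub_apply, LinearMap.smulRight_apply,
          LinearMap.comp_apply, LinearMap.proj_apply, LinearMap.id_apply, map_sub, map_smul, qu, qv]
        ext i; fin_cases i <;> simp <;> exact sub_self _)
  have hpr : ∀ x, (pr x : Fin n → K) = x - q x 0 • D.u - q x 1 • D.v := fun x => rfl
  have hprw : ∀ x : LinearMap.ker q, pr x = x := by
    intro x
    ext1
    rw [hpr, x.2]
    simp
  let h : Fin (n - 2) → Fin n → K := fun k i => B.coord k (pr (Pi.single i 1))
  have hh : ∀ k x, ∑ i, h k i * x i = B.coord k (pr x) := by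
    intro k x
    have hs : ∀ i, (Pi.single i 1 : Fin n → K) = fun j => if i = j then 1 else 0 := by
      intro i; ext j; simp [Pi.single_apply, eq_comm]
    rw [← LinearMap.comp_apply, LinearMap.pi_apply_eq_sum_univ (B.coord k ∘ₗ pr) x]
    simp [h, mul_comm, hs]
  refine ⟨⟨fun k => B k, h, fun k => ?_, fun k => ?_, fun k => ?_, fun k => ?_, fun j k => ?_,
    fun x i => ?_⟩⟩
  · rw [← q0, (B k).2]; rfl
  · rw [← q1, (B k).2]; rfl
  · have : pr D.u = 0 := by ext1; rw [hpr, qu]; simp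
    rw [hh, this, map_zero]
  · have : pr D.v = 0 := by ext1; rw [hpr, qv]; simp
    rw [hh, this, map_zero]
  · rw [hh, hprw, Module.Basis.coord_apply, Module.Basis.repr_self, Finsupp.single_apply]
    exact if_congr eq_comm rfl rfl
  · have h1 := congrArg (fun y : LinearMap.ker q => (y : Fin n → K) i) (B.sum_repr (pr x))
    simp only [hpr, Submodule.coe_sum, Submodule.coe_smul, Finset.sum_apply, Pi.smul_apply,
      Pi.sub_apply, smul_eq_mul] at h1
    simp only [hh, Module.Basis.coord_apply, ← q0, ← q1]
    rw [h1]
    ring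

namespace Frame

variable {D : Datum K n} (F : Frame D)

theorem sum_mul_param {σ : Type} (c x : Fin n → K) (y : Fin (n - 2) → MvPolynomial σ K) :
    ∑ i, C (c i) * (C (x i) + ∑ k, y k * C (F.w k i))
      = C (∑ i, c i * x i) + ∑ k, y k * C (∑ i, c i * F.w k i) := by
  simp only [mul_add, Finset.sum_add_distrib, map_sum, map_mul, Finset.mul_sum]
  rw [Finset.sum_comm]
  congr 1
  exact Finset.sum_congr rfl fun k _ => Finset.sum_congr rfl fun i _ => by ring

/-- The family of the chart of a frame. -/
def chart : Datum (MvPolynomial (Params n 3) K) n where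
  u i := C (D.u i) + ∑ k, X (.inl (.inl k)) * C (F.w k i)
  v i := C (D.v i) + ∑ k, X (.inl (.inr k)) * C (F.w k i)
  a i := C (D.a i)
  b i := C (D.b i)
  r := X (.inr 0)
  s := X (.inr 1)
  t := X (.inr 2)
  au := by simp [sum_mul_param, D.au, F.aw]
  av := by simp [sum_mul_param, D.av, F.aw]
  bu := by simp [sum_mul_param, D.bu, F.bw]
  bv := by simp [sum_mul_param, D.bv, F.bw]

/-- The datum with given coordinates. -/
def chartAt (x : Zar (Params n 3) K) : Datum K n := F.chart.map (evalAt x).toRingHom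

theorem chartAt_u (x : Zar (Params n 3) K) (i : Fin n) :
    (F.chartAt x).u i = D.u i + ∑ k, x (.inl (.inl k)) * F.w k i := by
  have h : (F.chartAt x).u i = evalAt x (F.chart.u i) := rfl
  rw [h, chart]
  simp only [map_add, map_sum, map_mul, evalAt_X, evalAt_C]

theorem chartAt_v (x : Zar (Params n 3) K) (i : Fin n) :
    (F.chartAt x).v i = D.v i + ∑ k, x (.inl (.inr k)) * F.w k i := by
  have h : (F.chartAt x).v i = evalAt x (F.chart.v i) := rfl
  rw [h, chart]
  simp only [map_add, map_sum, map_mul, evalAt_X, evalAt_C]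

theorem chartAt_a (x : Zar (Params n 3) K) : (F.chartAt x).a = D.a :=
  funext fun _ => evalAt_C x _

theorem chartAt_b (x : Zar (Params n 3) K) : (F.chartAt x).b = D.b :=
  funext fun _ => evalAt_C x _

theorem chartAt_r (x : Zar (Params n 3) K) : (F.chartAt x).r = x (.inr 0) := evalAt_X x _
theorem chartAt_s (x : Zar (Params n 3) K) : (F.chartAt x).s = x (.inr 1) := evalAt_X x _
theorem chartAt_t (x : Zar (Params n 3) K) : (F.chartAt x).t = x (.inr 2) := evalAt_X x _

theorem sum_h_mul (k : Fin (n - 2)) (x : Fin n → K) (y : Fin (n - 2) → K) :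
    ∑ i, F.h k i * (x i + ∑ j, y j * F.w j i) = ∑ i, F.h k i * x i + y k := by
  have h1 : ∑ i, F.h k i * ∑ j, y j * F.w j i = ∑ j, y j * ∑ i, F.h k i * F.w j i := by
    simp only [Finset.mul_sum]
    rw [Finset.sum_comm]
    exact Finset.sum_congr rfl fun k _ => Finset.sum_congr rfl fun i _ => by ring
  simp only [mul_add, Finset.sum_add_distrib, h1, F.hw]
  simp

theorem coords_chartAt (x : Zar (Params n 3) K) : (F.chartAt x).coords F.h = x := by
  funext j
  match j with
  | .inl (.inl k) =>
    simp only [Datum.coords, chartAt_u, sum_h_mul, F.hu, zero_add]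
  | .inl (.inr k) =>
    simp only [Datum.coords, chartAt_v, sum_h_mul, F.hv, zero_add]
  | .inr 0 => exact F.chartAt_r x
  | .inr 1 => exact F.chartAt_s x
  | .inr 2 => exact F.chartAt_t x

/-- Vectors with prescribed pairings against `a, b` are determined by their pairings with the `h`;
so the chart reaches every datum with the same `a, b`. -/
theorem chartAt_coords {D' : Datum K n} (ha : D'.a = D.a) (hb : D'.b = D.b) :
    F.chartAt (D'.coords F.h) = D' := by
  refine Datum.ext (funext fun i => ?_) (funext fun i => ?_) ((F.chartAt_a _).trans ha.symm)
    ((F.chartAt_b _).trans hb.symm) (F.chartAt_r _) (F.chartAt_s _) (F.chartAt_t _)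
  · rw [chartAt_u, F.expand D'.u i, ← ha, ← hb, D'.au, D'.bu]
    simp [Datum.coords]
  · rw [chartAt_v, F.expand D'.v i, ← ha, ← hb, D'.av, D'.bv]
    simp [Datum.coords]

/-- Continuity gives one direction. For the other, each polynomial condition on the coordinates is
cut out by a closed set of ideals. -/
theorem isInducing_fam_chartAt : Topology.IsInducing fun x => (F.chartAt x).fam := by
  rw [Topology.isInducing_iff]
  refine TopologicalSpace.ext_isClosed fun Z => ?_
  refine Iff.trans ?_ isClosed_induced_iff.symm
  constructor
  · intro hZ
    obtain ⟨S, rfl⟩ := isClosed_zar_iff.1 hZ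
    choose W hW hWS using fun p => exists_isClosed_coords D.a D.b F.h p
    refine ⟨⋂ p ∈ S, W p, isClosed_biInter fun p _ => hW p, ?_⟩
    ext x
    simp only [Set.mem_preimage, Set.mem_iInter, Set.mem_ofPred_eq]
    refine forall₂_congr fun p _ => ?_
    rw [hWS p _ (F.chartAt_a x) (F.chartAt_b x), coords_chartAt]
  · rintro ⟨W, hW, rfl⟩
    exact hW.preimage (continuous_fam F.chart)

end Frame

/-! ### Strata -/

/-- A parametrization of `(r, s, t)` by polynomials in some of these variables, outside of a
hypersurface. -/
structure Stratum (K : Type u) [Field K] (k : ℕ) where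
  rst : Fin 3 → MvPolynomial (Fin k) K
  ι : Fin k → Fin 3
  rst_ι : ∀ j, rst (ι j) = X j
  g : MvPolynomial (Fin k) K
  g_ne : g ≠ 0

namespace Stratum

variable {k : ℕ} (S : Stratum K k)

/-- The condition for a set of ideals to be described by a stratum. -/
def Describes (Y : Set (GradedHilb K n (hilb1n221 n))) : Prop :=
  ∀ D : Datum K n, D.fam ∈ Y ↔ ∃ z : Zar (Fin k) K, evalAt z S.g ≠ 0 ∧
    ∀ i, evalAt z (S.rst i) = ![D.r, D.s, D.t] i

/-- The coordinates of the points of a stratum. -/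
def param (n : ℕ) : Params n 3 → MvPolynomial (Params n k) K :=
  Sum.elim (fun j => X (.inl j)) fun i => rename Sum.inr (S.rst i)

theorem evalAt_rename_inr {σ : Type} (x : Zar (σ ⊕ Fin k) K) (p : MvPolynomial (Fin k) K) :
    evalAt x (rename Sum.inr p) = evalAt (fun j => x (.inr j) : Zar (Fin k) K) p := by
  rw [evalAt, aeval_rename]; rfl

theorem polyMap_param_inr (x : Zar (Params n k) K) (i : Fin 3) :
    polyMap (S.param n) x (.inr i) = evalAt (fun j => x (.inr j) : Zar (Fin k) K) (S.rst i) :=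
  evalAt_rename_inr x _

theorem polyMap_param_inl (x : Zar (Params n k) K) (j : Fin (n - 2) ⊕ Fin (n - 2)) :
    polyMap (S.param n) x (.inl j) = x (.inl j) :=
  evalAt_X x _

/-- Some of the coordinates are the parameters themselves, so a coordinate projection is a
continuous left inverse. -/
theorem isEmbedding_param : Topology.IsEmbedding (polyMap (S.param n)) := by
  refine Function.LeftInverse.isEmbedding
    (f := polyMap fun j : Params n k => X (Sum.map id S.ι j)) (fun x => ?_)
    (continuous_polyMap _) (continuous_polyMap _)
  funext j
  rw [polyMap, evalAt_X]
  cases j with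
  | inl j => exact S.polyMap_param_inl x j
  | inr j => rw [Sum.map_inr, polyMap_param_inr, S.rst_ι]; exact evalAt_X _ _

theorem isEmbedding_chart {D : Datum K n} (F : Frame D) :
    Topology.IsEmbedding fun x => (F.chartAt (polyMap (S.param n) x)).fam :=
  (F.isInducing_fam_chartAt.comp S.isEmbedding_param.isInducing).isEmbedding

theorem exists_param {D : Datum K n} {z : Zar (Fin k) K}
    (hz : ∀ i, evalAt z (S.rst i) = ![D.r, D.s, D.t] i) (h : Fin (n - 2) → Fin n → K) :
    ∃ x : Zar (Params n k) K, (fun j => x (.inr j)) = z ∧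
      polyMap (S.param n) x = D.coords h := by
  refine ⟨Sum.elim (fun j => D.coords h (.inl j)) z, rfl, ?_⟩
  funext j
  match j with
  | .inl j => exact S.polyMap_param_inl _ j
  | .inr 0 => exact (S.polyMap_param_inr _ 0).trans (hz 0)
  | .inr 1 => exact (S.polyMap_param_inr _ 1).trans (hz 1)
  | .inr 2 => exact (S.polyMap_param_inr _ 2).trans (hz 2)

variable {S} {Y : Set (GradedHilb K n (hilb1n221 n))}

theorem Describes.fam_chartAt_mem (hY : S.Describes Y) {D : Datum K n} (F : Frame D)
    {x : Zar (Params n k) K} (hx : evalAt x (rename Sum.inr S.g) ≠ 0) :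
    (F.chartAt (polyMap (S.param n) x)).fam ∈ Y := by
  rw [evalAt_rename_inr] at hx
  refine (hY _).2 ⟨_, hx, fun i => ?_⟩
  rw [F.chartAt_r, F.chartAt_s, F.chartAt_t]
  fin_cases i <;> exact (S.polyMap_param_inr x _).symm

variable [CharZero K]

/-- On each chart domain the locus is the image of a principal open subset of an affine space of
dimension `2(n - 2) + k`. -/
theorem Describes.topologicalKrullDim_eq (hY : S.Describes Y) (hne : Y.Nonempty) :
    topologicalKrullDim Y = ((2 * (n - 2) + k : ℕ) : WithBot ℕ∞) := by
  have := hne.to_subtype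
  have hcard : Nat.card (Params n k) = 2 * (n - 2) + k := by
    simp [Params, Nat.card_eq_fintype_card]; ring
  rw [← hcard]
  refine topologicalKrullDim_eq_of_charts (σ := Params n k) (K := K) fun ⟨I, hI⟩ => ?_
  obtain ⟨D, rfl⟩ := exists_fam_eq I
  obtain ⟨F⟩ := D.nonempty_frame
  have hmem : ∀ I ∈ Y, I ∈ chartDomain D.a D.b → ∃ x, evalAt x (rename Sum.inr S.g) ≠ 0 ∧
      (F.chartAt (polyMap (S.param n) x)).fam = I := by
    intro I hIY hI
    obtain ⟨D', ha, hb, rfl⟩ := exists_datum_of_mem_chartDomain hI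
    obtain ⟨z, hz, hz'⟩ := (hY D').1 hIY
    obtain ⟨x, rfl, hx⟩ := S.exists_param hz' F.h
    refine ⟨x, ?_, ?_⟩
    · rw [evalAt_rename_inr]; exact hz
    · rw [hx, F.chartAt_coords ha hb]
  refine ⟨{x : Zar (Params n k) K | evalAt x (rename Sum.inr S.g) ≠ 0},
    Set.codRestrict (fun x : {x : Zar (Params n k) K | evalAt x (rename Sum.inr S.g) ≠ 0} =>
      (F.chartAt (polyMap (S.param n) x.1)).fam) Y
      (fun x => hY.fam_chartAt_mem F x.2), isOpen_ne_zero _, ⟨?_, ?_⟩, ?_⟩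
  · exact ((S.isEmbedding_chart F).comp Topology.IsEmbedding.subtypeVal).codRestrict _ _
  · convert (isOpen_chartDomain D.a D.b).preimage (continuous_subtype_val (p := (· ∈ Y))) using 1
    ext ⟨I, hI⟩
    constructor
    · rintro ⟨x, hx⟩
      have h1 : (F.chartAt (polyMap (S.param n) x)).fam = I := congrArg Subtype.val hx
      change I ∈ chartDomain D.a D.b
      rw [← h1]
      have := (F.chartAt (polyMap (S.param n) x)).fam_mem_chartDomain
      rwa [F.chartAt_a, F.chartAt_b] at this
    · intro h
      obtain ⟨x, hx, hx'⟩ := hmem I hI h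
      exact ⟨⟨x, hx⟩, Subtype.ext hx'⟩
  · obtain ⟨x, hx, hx'⟩ := hmem _ hI D.fam_mem_chartDomain
    exact ⟨⟨x, hx⟩, Subtype.ext hx'⟩

/-- The parameters with `g ≠ 0` are dense and map into `Y`, so continuity sends all parameters,
including those with `g = 0`, into the closure. -/
theorem Describes.fam_mem_closure (hY : S.Describes Y) {D : Datum K n} {z : Zar (Fin k) K}
    (hz : ∀ i, evalAt z (S.rst i) = ![D.r, D.s, D.t] i) : D.fam ∈ closure Y := by
  obtain ⟨F⟩ := D.nonempty_frame
  obtain ⟨x, -, hx⟩ := S.exists_param hz F.h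
  have h1 : (F.chartAt (polyMap (S.param n) x)).fam = D.fam := by
    rw [hx, F.chartAt_coords rfl rfl]
  rw [← h1]
  have hg : rename (Sum.inr : Fin k → Params n k) S.g ≠ 0 := fun h =>
    S.g_ne (rename_injective _ Sum.inr_injective (h.trans (map_zero _).symm))
  have hd : Dense {x : Zar (Params n k) K | evalAt x (rename Sum.inr S.g) ≠ 0} :=
    (isOpen_ne_zero _).dense (exists_evalAt_ne_zero hg)
  exact map_mem_closure (f := fun x => (F.chartAt (polyMap (S.param n) x)).fam)
    (S.isEmbedding_chart F).continuous (hd x)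
    fun x hx => hY.fam_chartAt_mem F hx

end Stratum

end Charts

/-! ### The strata of the four loci -/

section Loci

variable (K : Type u) [Field K]

theorem exists_zar_eq {K : Type u} {σ : Type} (f : σ → K) :
    ∃ z : Zar σ K, ∀ i, z i = f i := ⟨f, fun _ => rfl⟩

/-- All `(r, s, t)`. -/
def stratumUniv : Stratum K 3 where
  rst := X
  ι := id
  rst_ι _ := rfl
  g := 1
  g_ne := one_ne_zero

/-- The `(r, s, t)` for which `ω² - s ω - r` has distinct roots, different from `t`. -/
def stratumIV [CharZero K] : Stratum K 3 where
  rst := X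
  ι := id
  rst_ι _ := rfl
  g := (X 1 ^ 2 + C 4 * X 0) * (X 2 ^ 2 - X 1 * X 2 - X 0)
  g_ne h := by
    -- At `(r, s, t) = (0, 1, -1)` the two factors are `1` and `2`.
    obtain ⟨z, hz⟩ := exists_zar_eq (σ := Fin 3) (K := K) ![0, 1, -1]
    have h1 := congrArg (evalAt z) h
    simp only [map_mul, map_add, map_sub, map_pow, evalAt_X, evalAt_C, map_zero, hz] at h1
    simp at h1

/-- The `(r, s, t)` for which `ω² - s ω - r` has distinct roots, one of which is `t`. -/
def stratumIII [CharZero K] : Stratum K 2 where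
  rst := ![X 1 ^ 2 - X 0 * X 1, X 0, X 1]
  ι := ![1, 2]
  rst_ι j := by fin_cases j <;> rfl
  g := X 0 - C 2 * X 1
  g_ne h := by
    obtain ⟨z, hz⟩ := exists_zar_eq (K := K) ![1, 0]
    have h1 := congrArg (evalAt z) h
    simp only [map_mul, map_sub, evalAt_X, evalAt_C, map_zero, hz] at h1
    norm_num at h1

/-- The `(r, s, t)` for which `ω² - s ω - r` has a double root, different from `t`. -/
def stratumII [CharZero K] : Stratum K 2 where
  rst := ![C (-1 / 4) * X 0 ^ 2, X 0, X 1]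
  ι := ![1, 2]
  rst_ι j := by fin_cases j <;> rfl
  g := X 0 - C 2 * X 1
  g_ne := (stratumIII K).g_ne

/-- The `(r, s, t)` for which `ω² - s ω - r` has the double root `t`. -/
def stratumI [CharZero K] : Stratum K 1 where
  rst := ![C (-1 / 4) * X 0 ^ 2, X 0, C (1 / 2) * X 0]
  ι := ![1]
  rst_ι j := by fin_cases j; rfl
  g := 1
  g_ne := one_ne_zero

variable {K} {n : ℕ}

theorem stratumUniv_describes : (stratumUniv K).Describes (n := n) Set.univ := by
  intro D
  obtain ⟨z, hz⟩ := exists_zar_eq (K := K) ![D.r, D.s, D.t]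
  exact iff_of_true trivial ⟨z, by simp [stratumUniv], fun i => (evalAt_X z i).trans (hz i)⟩

variable [IsAlgClosed K] [CharZero K]

theorem stratumIV_describes : (stratumIV K).Describes (locusIV K n (hilb1n221 n)) := by
  intro D
  rw [D.fam_mem_locusIV_iff, Datum.disc, Datum.nrm, ← mul_ne_zero_iff]
  constructor
  · intro h
    obtain ⟨z, hz⟩ := exists_zar_eq (K := K) ![D.r, D.s, D.t]
    refine ⟨z, ?_, fun i => (evalAt_X z i).trans (hz i)⟩
    simp only [stratumIV, map_mul, map_add, map_sub, map_pow, evalAt_X, evalAt_C, hz]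
    convert h using 1
    simp
  · rintro ⟨z, h, hz⟩
    simp only [stratumIV, map_mul, map_add, map_sub, map_pow, evalAt_X, evalAt_C] at h hz
    rw [hz 0, hz 1, hz 2] at h
    convert h using 1
    simp

theorem stratumIII_describes : (stratumIII K).Describes (locusIII K n (hilb1n221 n)) := by
  intro D
  rw [D.fam_mem_locusIII_iff, Datum.disc, Datum.nrm]
  simp only [stratumIII, Fin.forall_fin_succ, map_mul, map_sub, map_pow, evalAt_X, evalAt_C,
    Matrix.cons_val_zero, Matrix.cons_val_succ, IsEmpty.forall_iff, and_true]
  constructor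
  · rintro ⟨h1, h2⟩
    obtain ⟨z, hz⟩ := exists_zar_eq (K := K) ![D.s, D.t]
    refine ⟨z, fun h => h1 ?_, ?_, hz 0, hz 1⟩ <;> simp only [hz] at *
    · simp at h
      -- When `r = t² - s t`, the discriminant equals `(s - 2t)²`.
      linear_combination (D.s - 2 * D.t) * h - 4 * h2
    · simp
      linear_combination h2
  · rintro ⟨z, h, h0, h1, h2⟩
    rw [h1, h2] at h0 h
    refine ⟨fun h3 => h ?_, by linear_combination h0⟩
    refine pow_eq_zero_iff two_ne_zero |>.1 ?_
    linear_combination h3 + 4 * h0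

theorem stratumII_describes : (stratumII K).Describes (locusII K n (hilb1n221 n)) := by
  intro D
  rw [D.fam_mem_locusII_iff, Datum.disc, Datum.nrm]
  simp only [stratumII, Fin.forall_fin_succ, map_mul, map_sub, map_pow, evalAt_X, evalAt_C,
    Matrix.cons_val_zero, Matrix.cons_val_succ, IsEmpty.forall_iff, and_true]
  constructor
  · rintro ⟨h1, h2⟩
    obtain ⟨z, hz⟩ := exists_zar_eq (K := K) ![D.s, D.t]
    refine ⟨z, fun h => h2 ?_, ?_, hz 0, hz 1⟩ <;> simp only [hz] at *
    · simp at h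
      -- When `r = -s²/4`, the value `t² - s t - r` equals `(s - 2t)²/4`.
      linear_combination (D.s - 2 * D.t) / 4 * h - h1 / 4
    · simp
      linear_combination -h1 / 4
  · rintro ⟨z, h, h0, h1, h2⟩
    rw [h1] at h0
    rw [h1, h2] at h
    refine ⟨by linear_combination -4 * h0, fun h3 => h ?_⟩
    refine pow_eq_zero_iff two_ne_zero |>.1 ?_
    linear_combination 4 * h3 - 4 * h0

theorem stratumI_describes : (stratumI K).Describes (locusI K n (hilb1n221 n)) := by
  intro D
  rw [D.fam_mem_locusI_iff, Datum.disc, Datum.nrm]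
  simp only [stratumI, Fin.forall_fin_succ, map_mul, map_pow, map_one, evalAt_X, evalAt_C,
    Matrix.cons_val_zero, Matrix.cons_val_succ, IsEmpty.forall_iff, and_true, ne_eq, one_ne_zero,
    not_false_eq_true, true_and]
  constructor
  · rintro ⟨h1, h2⟩
    obtain ⟨z, hz⟩ := exists_zar_eq (K := K) ![D.s]
    have hz0 : z 0 = D.s := hz 0
    have h3 : D.t - D.s / 2 = 0 := by
      refine pow_eq_zero_iff two_ne_zero |>.1 ?_
      linear_combination h1 / 4 + h2
    refine ⟨z, ?_, hz0, ?_⟩ <;> rw [hz0]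
    · linear_combination -h1 / 4
    · linear_combination -h3
  · rintro ⟨z, h0, h1, h2⟩
    rw [h1] at h0 h2
    constructor
    · linear_combination -4 * h0
    · rw [← h2, ← h0]
      ring

theorem locusII_subset_closure_locusIV : locusII K n (hilb1n221 n) ⊆
    closure (locusIV K n (hilb1n221 n)) := by
  intro I _
  obtain ⟨D, rfl⟩ := exists_fam_eq I
  obtain ⟨z, hz⟩ := exists_zar_eq (K := K) ![D.r, D.s, D.t]
  exact stratumIV_describes.fam_mem_closure fun i => (evalAt_X z i).trans (hz i)

theorem locusIII_subset_closure_locusIV : locusIII K n (hilb1n221 n) ⊆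
    closure (locusIV K n (hilb1n221 n)) := by
  intro I _
  obtain ⟨D, rfl⟩ := exists_fam_eq I
  obtain ⟨z, hz⟩ := exists_zar_eq (K := K) ![D.r, D.s, D.t]
  exact stratumIV_describes.fam_mem_closure fun i => (evalAt_X z i).trans (hz i)

theorem locusI_subset_closure_locusII : locusI K n (hilb1n221 n) ⊆
    closure (locusII K n (hilb1n221 n)) := by
  intro I hI
  obtain ⟨D, rfl⟩ := exists_fam_eq I
  obtain ⟨h1, h2⟩ := D.fam_mem_locusI_iff.1 hI
  obtain ⟨z, hz⟩ := exists_zar_eq (K := K) ![D.s, D.t]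
  refine stratumII_describes.fam_mem_closure (z := z) fun i => ?_
  rw [Datum.disc] at h1
  fin_cases i <;> simp [stratumII, hz]
  linear_combination -h1 / 4

theorem locusI_subset_closure_locusIII : locusI K n (hilb1n221 n) ⊆
    closure (locusIII K n (hilb1n221 n)) := by
  intro I hI
  obtain ⟨D, rfl⟩ := exists_fam_eq I
  obtain ⟨h1, h2⟩ := D.fam_mem_locusI_iff.1 hI
  obtain ⟨z, hz⟩ := exists_zar_eq (K := K) ![D.s, D.t]
  refine stratumIII_describes.fam_mem_closure (z := z) fun i => ?_
  rw [Datum.nrm] at h2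
  fin_cases i <;> simp [stratumIII, hz]
  linear_combination h2

end Loci

/-! ### Irreducibility -/

section Universal

namespace Datum

variable {A : Type u} [CommRing A] {n : ℕ}

/-- The datum of vectors `u, v` and `a, b` with an invertible matrix of pairings. -/
def ofInverse (u v a b : Fin n → A) (r s t e : A)
    (he : e * ((∑ i, a i * u i) * (∑ i, b i * v i) - (∑ i, a i * v i) * ∑ i, b i * u i) = 1) :
    Datum A n where
  u := u
  v := v
  -- The inverse of the pairing matrix, as adjugate times `e`, replaces `a, b` by a dual pair. The
  -- four vectors then need no relations, so the base is open in an affine space.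
  a i := e * ((∑ i, b i * v i) * a i - (∑ i, a i * v i) * b i)
  b i := e * ((∑ i, a i * u i) * b i - (∑ i, b i * u i) * a i)
  r := r
  s := s
  t := t
  au := by
    simp only [mul_assoc, ← Finset.mul_sum, sub_mul, Finset.sum_sub_distrib]
    linear_combination he
  av := by
    simp only [mul_assoc, ← Finset.mul_sum, sub_mul, Finset.sum_sub_distrib]
    ring
  bu := by
    simp only [mul_assoc, ← Finset.mul_sum, sub_mul, Finset.sum_sub_distrib]
    ring
  bv := by
    simp only [mul_assoc, ← Finset.mul_sum, sub_mul, Finset.sum_sub_distrib]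
    linear_combination he

theorem map_ofInverse {B : Type u} [CommRing B] (φ : A →+* B) {u v a b : Fin n → A} {r s t e : A}
    (he : e * ((∑ i, a i * u i) * (∑ i, b i * v i) - (∑ i, a i * v i) * ∑ i, b i * u i) = 1)
    (D : Datum B n) (hu : ∀ i, φ (u i) = D.u i) (hv : ∀ i, φ (v i) = D.v i)
    (ha : ∀ i, φ (a i) = D.a i) (hb : ∀ i, φ (b i) = D.b i)
    (hr : φ r = D.r) (hs : φ s = D.s) (ht : φ t = D.t) :
    (ofInverse u v a b r s t e he).map φ = D := by
  have he' : φ e = 1 := by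
    simpa [hu, hv, ha, hb, D.au, D.av, D.bu, D.bv] using congrArg φ he
  refine Datum.ext (funext hu) (funext hv) (funext fun i => ?_) (funext fun i => ?_) hr hs ht
  · change φ (e * ((∑ i, b i * v i) * a i - (∑ i, a i * v i) * b i)) = _
    simp [he', hv, ha, hb, D.av, D.bv]
  · change φ (e * ((∑ i, a i * u i) * b i - (∑ i, b i * u i) * a i)) = _
    simp [he', hu, ha, hb, D.au, D.bu]

theorem nonempty_of_two_le (K : Type u) [Field K] {n : ℕ} (hn : 2 ≤ n) (r s t : K) :
    ∃ D : Datum K n, D.r = r ∧ D.s = s ∧ D.t = t := by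
  obtain ⟨i, j, hij⟩ : ∃ i j : Fin n, i ≠ j := ⟨⟨0, by omega⟩, ⟨1, by omega⟩, by simp⟩
  have h : ∀ i j : Fin n, ∑ k, (Pi.single i 1 : Fin n → K) k * (Pi.single j 1 : Fin n → K) k
      = if i = j then 1 else 0 := by
    intro i j
    simp [Pi.single_apply, eq_comm]
  exact ⟨⟨Pi.single i 1, Pi.single j 1, Pi.single i 1, Pi.single j 1, r, s, t,
    (h i i).trans (if_pos rfl), (h i j).trans (if_neg hij), (h j i).trans (if_neg hij.symm),
    (h j j).trans (if_pos rfl)⟩, rfl, rfl, rfl⟩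

end Datum

variable {K : Type u} [Field K] {n : ℕ}

/-- If neither closed set contains the image, each has an equation nonzero at some `K`-point; the
product is nonzero in the domain, so some `K`-point avoids both. -/
theorem isPreirreducible_range_map {A : Type u} [CommRing A] [Algebra K A] [IsDomain A]
    (hA : ∀ a : A, a ≠ 0 → ∃ φ : A →ₐ[K] K, φ a ≠ 0) {H : ℕ → ℕ} (J : Points A n H) :
    IsPreirreducible (Set.range fun φ : A →ₐ[K] K => (J.map φ.toRingHom : GradedHilb K n H)) := by
  rw [isPreirreducible_iff_isClosed_union_isClosed]
  intro Z W hZ hW hZW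
  obtain ⟨s, hs⟩ := isClosed_iff.1 hZ A J
  obtain ⟨t, ht⟩ := isClosed_iff.1 hW A J
  by_contra! h
  obtain ⟨⟨_, ⟨φ, rfl⟩, hφ⟩, ⟨_, ⟨ψ, rfl⟩, hψ⟩⟩ := And.imp Set.not_subset.1 Set.not_subset.1 h
  rw [hs] at hφ
  rw [ht] at hψ
  push Not at hφ hψ
  obtain ⟨a, has, ha⟩ := hφ
  obtain ⟨b, hbt, hb⟩ := hψ
  obtain ⟨χ, hχ⟩ := hA (a * b) (mul_ne_zero (fun h => ha (by rw [h, map_zero]))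
    (fun h => hb (by rw [h, map_zero])))
  rw [map_mul] at hχ
  rcases hZW ⟨χ, rfl⟩ with h1 | h1
  · exact left_ne_zero_of_mul hχ ((hs χ).1 h1 a has)
  · exact right_ne_zero_of_mul hχ ((ht χ).1 h1 b hbt)

/-! ### The universal datum of a stratum. -/

namespace Stratum

variable {k : ℕ} (S : Stratum K k) (n)

/-- Polynomials in the coordinates of four vectors and in the parameters of a stratum. -/
abbrev Base (K : Type u) [Field K] (k n : ℕ) : Type u :=
  MvPolynomial ((Fin 4 × Fin n) ⊕ Fin k) K

/-- The pairing of two of the vectors. -/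
def pairing (K : Type u) [Field K] (k n : ℕ) (c d : Fin 4) : Base K k n :=
  ∑ i, X (.inl (c, i)) * X (.inl (d, i))

/-- The determinant of the pairings. -/
def det (K : Type u) [Field K] (k n : ℕ) : Base K k n :=
  pairing K k n 2 0 * pairing K k n 3 1 - pairing K k n 2 1 * pairing K k n 3 0

/-- The function to invert to obtain the universal datum of a stratum. -/
def disc : Base K k n := det K k n * rename Sum.inr S.g

variable {n}

theorem disc_ne_zero (hn : 2 ≤ n) : S.disc n ≠ 0 := by
  refine mul_ne_zero (fun h => ?_) fun h =>
    S.g_ne (rename_injective _ Sum.inr_injective (h.trans (map_zero _).symm))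
  obtain ⟨D, -⟩ := Datum.nonempty_of_two_le K hn 0 0 0
  have h1 := congrArg (aeval (Sum.elim (fun p => ![D.u, D.v, D.a, D.b] p.1 p.2)
    (0 : Fin k → K))) h
  simp only [det, pairing, map_sub, map_mul, map_sum, aeval_X, map_zero] at h1
  simp [D.au, D.av, D.bu, D.bv] at h1

theorem isDomain_of_isLocalization (R : Type u) [CommRing R] [Algebra (Base K k n) R]
    [IsLocalization.Away (S.disc n) R] (hn : 2 ≤ n) : IsDomain R :=
  IsLocalization.isDomain_of_le_nonZeroDivisors _ (powers_le_nonZeroDivisors_of_noZeroDivisors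
    (S.disc_ne_zero hn))

theorem exists_algHom (R : Type u) [CommRing R] [Algebra (Base K k n) R]
    [IsLocalization.Away (S.disc n) R] [Algebra K R] [IsScalarTower K (Base K k n) R]
    {L : Type u} [Field L] [Algebra K L] (f : Base K k n →ₐ[K] L)
    (hf : f (S.disc n) ≠ 0) : ∃ φ : R →ₐ[K] L, ∀ p, φ (algebraMap (Base K k n) R p) = f p :=
  ⟨IsLocalization.Away.liftAlgHom (S.disc n) hf.isUnit,
    IsLocalization.Away.lift_eq _ hf.isUnit⟩

theorem exists_algHom_ne_zero (R : Type u) [CommRing R] [Algebra (Base K k n) R]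
    [IsLocalization.Away (S.disc n) R] [Algebra K R] [IsScalarTower K (Base K k n) R] [Infinite K] (hn : 2 ≤ n) {a : R} (ha : a ≠ 0) :
    ∃ φ : R →ₐ[K] K, φ a ≠ 0 := by
  obtain ⟨⟨p, q⟩, hq⟩ := IsLocalization.surj (Submonoid.powers (S.disc n)) a
  have hp : p ≠ 0 := by
    rintro rfl
    rw [map_zero] at hq
    exact ha ((IsLocalization.map_units R q).mul_left_eq_zero.1 hq)
  obtain ⟨x, hx⟩ := exists_evalAt_ne_zero (mul_ne_zero hp (S.disc_ne_zero hn))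
  rw [map_mul] at hx
  obtain ⟨φ, hφ⟩ := S.exists_algHom R (evalAt x) (right_ne_zero_of_mul hx)
  refine ⟨φ, fun h => left_ne_zero_of_mul hx ?_⟩
  have h1 := congrArg φ hq
  rw [map_mul, h, zero_mul, hφ] at h1
  exact h1.symm

section Univ

variable (R : Type u) [CommRing R] [Algebra (Base K k n) R] [IsLocalization.Away (S.disc n) R]

theorem isUnit_algebraMap : IsUnit (algebraMap (Base K k n) R (det K k n)) ∧
    IsUnit (algebraMap (Base K k n) R (rename Sum.inr S.g)) := by
  have h := IsLocalization.Away.algebraMap_isUnit (S := R) (S.disc n)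
  rw [disc, map_mul] at h
  exact ⟨isUnit_of_mul_isUnit_left h, isUnit_of_mul_isUnit_right h⟩

/-- The universal datum of a stratum. -/
def univ : Datum R n :=
  Datum.ofInverse (fun i => algebraMap (Base K k n) R (X (.inl (0, i))))
    (fun i => algebraMap (Base K k n) R (X (.inl (1, i))))
    (fun i => algebraMap (Base K k n) R (X (.inl (2, i))))
    (fun i => algebraMap (Base K k n) R (X (.inl (3, i))))
    (algebraMap (Base K k n) R (rename Sum.inr (S.rst 0)))
    (algebraMap (Base K k n) R (rename Sum.inr (S.rst 1)))
    (algebraMap (Base K k n) R (rename Sum.inr (S.rst 2)))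
    ↑(S.isUnit_algebraMap (n := n) R).1.unit⁻¹ (by
      refine Eq.trans ?_ (S.isUnit_algebraMap (n := n) R).1.val_inv_mul
      simp only [det, pairing, map_sub, map_mul, map_sum])

variable [Algebra K R] [IsScalarTower K (Base K k n) R]

/-- The vectors of a datum are already dual, so their pairing determinant is `1` and the evaluation
extends to the localization. The field `L` is arbitrary, since residue fields are needed for the
scheme. -/
theorem exists_univ_map_eq {L : Type u} [Field L] [Algebra K L] (D : Datum L n) (z : Fin k → L)
    (hg : aeval z S.g ≠ 0) (hz : ∀ i, aeval z (S.rst i) = ![D.r, D.s, D.t] i) :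
    ∃ φ : R →ₐ[K] L, (S.univ R).map φ.toRingHom = D := by
  let f : Base K k n →ₐ[K] L := aeval (Sum.elim (fun p => ![D.u, D.v, D.a, D.b] p.1 p.2) z)
  have hl : ∀ c i, f (X (.inl (c, i))) = ![D.u, D.v, D.a, D.b] c i := fun c i => aeval_X _ _
  have hr : ∀ p : MvPolynomial (Fin k) K, f (rename Sum.inr p) = aeval z p := fun p =>
    aeval_rename _ _ _
  have hdet : f (det K k n) = 1 := by
    simp only [det, pairing, map_sub, map_mul, map_sum, hl]
    simp [D.au, D.av, D.bu, D.bv]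
  obtain ⟨φ, hφ⟩ := S.exists_algHom R f (by rwa [disc, map_mul, hdet, one_mul, hr])
  exact ⟨φ, Datum.map_ofInverse _ _ D (fun i => (hφ _).trans (hl 0 i))
    (fun i => (hφ _).trans (hl 1 i)) (fun i => (hφ _).trans (hl 2 i))
    (fun i => (hφ _).trans (hl 3 i)) ((hφ _).trans ((hr _).trans (hz 0)))
    ((hφ _).trans ((hr _).trans (hz 1))) ((hφ _).trans ((hr _).trans (hz 2)))⟩

variable {S} {Y : Set (GradedHilb K n (hilb1n221 n))}

/-- Every ideal of the locus comes from a datum, which specializes the universal one; conversely,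
`g` is invertible in `R`, so its specializations stay in the stratum. -/
theorem Describes.eq_range_map [CharZero K] (hY : S.Describes Y) :
    Y = Set.range fun φ : R →ₐ[K] K => (S.univ R).fam.map φ.toRingHom := by
  ext I
  constructor
  · intro hI
    obtain ⟨D, rfl⟩ := exists_fam_eq I
    obtain ⟨z, hz, hz'⟩ := (hY D).1 hI
    obtain ⟨φ, hφ⟩ := S.exists_univ_map_eq R D z hz hz'
    exact ⟨φ, by rw [← hφ]; exact Datum.fam_map _ _⟩
  · rintro ⟨φ, rfl⟩
    simp only [Datum.fam_map]
    let ψ : MvPolynomial (Fin k) K →ₐ[K] K :=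
      (φ.comp (IsScalarTower.toAlgHom K (Base K k n) R)).comp (rename Sum.inr)
    obtain ⟨z, hz⟩ := exists_zar_eq fun j => ψ (X j)
    have h1 : evalAt z = ψ := algHom_ext fun j => by rw [evalAt_X, hz]
    refine (hY _).2 ⟨z, ?_, fun i => ?_⟩ <;> rw [h1]
    · exact ((S.isUnit_algebraMap R).2.map φ).ne_zero
    · fin_cases i <;> rfl

end Univ

variable {S} {Y : Set (GradedHilb K n (hilb1n221 n))}

theorem Describes.isIrreducible [CharZero K] (hY : S.Describes Y) (hn : 2 ≤ n) :
    IsIrreducible Y := by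
  constructor
  · obtain ⟨z, hz⟩ := exists_evalAt_ne_zero S.g_ne
    obtain ⟨D, hr, hs, ht⟩ := Datum.nonempty_of_two_le K hn (evalAt z (S.rst 0))
      (evalAt z (S.rst 1)) (evalAt z (S.rst 2))
    refine ⟨D.fam, (hY D).2 ⟨z, hz, fun i => ?_⟩⟩
    rw [hr, hs, ht]
    fin_cases i <;> rfl
  · rw [hY.eq_range_map (Localization.Away (S.disc n))]
    have := S.isDomain_of_isLocalization (Localization.Away (S.disc n)) hn
    exact isPreirreducible_range_map
      (fun a ha => S.exists_algHom_ne_zero (Localization.Away (S.disc n)) hn ha) _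

end Stratum

theorem irreducibleSpace_gradedHilb [CharZero K] (hn : 2 ≤ n) :
    IrreducibleSpace (GradedHilb K n (hilb1n221 n)) :=
  irreducibleSpace_def _ |>.2 (stratumUniv_describes.isIrreducible hn)

/-! ### Surjectivity of the universal datum onto the scheme. -/

section Classify

variable [CharZero K] {X : Over (Spec (.of K))}
  (e : (algSpec (.of K)).rightOp ⋙ yoneda.obj X ≅ functor K n (hilb1n221 n))
  (R : Type u) [CommRing R] [Algebra (Stratum.Base K 3 n) R]
  [IsLocalization.Away ((stratumUniv K).disc n) R] [Algebra K R]
  [IsScalarTower K (Stratum.Base K 3 n) R]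

theorem range_subset_range_classify_univ {L : Type u} [Field L] [Algebra K L]
    (f : Spec (.of L) ⟶ X.left)
    (hf : f ≫ X.hom = Spec.map (CommRingCat.ofHom (algebraMap K L))) :
    Set.range f ⊆ Set.range (classify e R ((stratumUniv K).univ R).fam) := by
  -- Existence of data needs characteristic zero but not algebraic closure, so it applies over `L`.
  have : CharZero L := charZero_of_injective_algebraMap (algebraMap K L).injective
  obtain ⟨J, rfl⟩ := exists_classify e f hf
  obtain ⟨D, rfl⟩ := exists_fam_eq J
  obtain ⟨φ, hφ⟩ := (stratumUniv K).exists_univ_map_eq (n := n) R D ![D.r, D.s, D.t]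
    (by simp [stratumUniv]) (fun i => aeval_X _ i)
  rw [← hφ]
  have h := classify_map e φ ((stratumUniv K).univ R).fam
  have h1 : (((stratumUniv K).univ (n := n) R).map φ.toRingHom).fam
      = ((stratumUniv K).univ R).fam.map φ.toRingHom := (Datum.fam_map _ _).symm
  rw [h1, h]
  rintro _ ⟨q, rfl⟩
  exact ⟨_, rfl⟩

/-- The classifying map of the universal datum is surjective. -/
theorem classify_univ_surjective :
    Function.Surjective (classify e R ((stratumUniv K).univ R).fam) := by
  intro p
  -- A point of the scheme is the image of the spectrum of its residue field, which is then regarded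
  -- as a `K`-algebra through `g`.
  obtain ⟨g, hg⟩ := Spec.map_surjective (X.left.fromSpecResidueField p ≫ X.hom)
  have h : p ∈ Set.range (X.left.fromSpecResidueField p) := by
    rw [Scheme.range_fromSpecResidueField]; rfl
  exact @range_subset_range_classify_univ K _ n _ X e R _ _ _ _ _ (X.left.residueField p) _
    (RingHom.toAlgebra (show K →+* X.left.residueField p from g.hom))
    (X.left.fromSpecResidueField p) hg.symm _ h

end Classify

/-- The scheme is the continuous image of the spectrum of a domain. -/
theorem irreducibleSpace_scheme [CharZero K] (hn : 2 ≤ n) {X : Over (Spec (.of K))}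
    (hX : IsGradedHilbertScheme K n (hilb1n221 n) X) : IrreducibleSpace X.left := by
  obtain ⟨e⟩ := hX
  let R := Localization.Away ((stratumUniv K).disc n)
  have := (stratumUniv K).isDomain_of_isLocalization R hn
  have h : IrreducibleSpace (Spec (.of R)) :=
    inferInstanceAs (IrreducibleSpace (PrimeSpectrum R))
  have h1 := ((irreducibleSpace_def _).1 h).image _
    (Scheme.Hom.continuous (classify e R ((stratumUniv K).univ R).fam)).continuousOn
  rw [irreducibleSpace_def]
  rw [Set.top_eq_univ] at h1 ⊢
  rwa [Set.image_univ, (classify_univ_surjective e R).range_eq] at h1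

end Universal

end

end GradedHilbert

theorem proposition14221 {K : Type u} [Field K] [IsAlgClosed K] [CharZero K]
    (n : ℕ) (hn : 2 ≤ n) :
    -- the graded Hilbert scheme is the union of the four loci
    (GradedHilbert.locusI K n (GradedHilbert.hilb1n221 n) ∪
      GradedHilbert.locusII K n (GradedHilbert.hilb1n221 n) ∪
      GradedHilbert.locusIII K n (GradedHilbert.hilb1n221 n) ∪
      GradedHilbert.locusIV K n (GradedHilbert.hilb1n221 n) = Set.univ) ∧
    -- each locus is irreducible, of the given dimension
    (IsIrreducible (GradedHilbert.locusI K n (GradedHilbert.hilb1n221 n)) ∧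
      topologicalKrullDim (GradedHilbert.locusI K n (GradedHilbert.hilb1n221 n))
        = ((2 * (n - 2) + 1 : ℕ) : WithBot ℕ∞)) ∧
    (IsIrreducible (GradedHilbert.locusII K n (GradedHilbert.hilb1n221 n)) ∧
      topologicalKrullDim (GradedHilbert.locusII K n (GradedHilbert.hilb1n221 n))
        = ((2 * (n - 2) + 2 : ℕ) : WithBot ℕ∞)) ∧
    (IsIrreducible (GradedHilbert.locusIII K n (GradedHilbert.hilb1n221 n)) ∧
      topologicalKrullDim (GradedHilbert.locusIII K n (GradedHilbert.hilb1n221 n))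
        = ((2 * (n - 2) + 2 : ℕ) : WithBot ℕ∞)) ∧
    (IsIrreducible (GradedHilbert.locusIV K n (GradedHilbert.hilb1n221 n)) ∧
      topologicalKrullDim (GradedHilbert.locusIV K n (GradedHilbert.hilb1n221 n))
        = ((2 * (n - 2) + 3 : ℕ) : WithBot ℕ∞)) ∧
    -- the degenerations IV → II, IV → III, II → I, III → I
    GradedHilbert.locusII K n (GradedHilbert.hilb1n221 n) ⊆
      closure (GradedHilbert.locusIV K n (GradedHilbert.hilb1n221 n)) ∧
    GradedHilbert.locusIII K n (GradedHilbert.hilb1n221 n) ⊆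
      closure (GradedHilbert.locusIV K n (GradedHilbert.hilb1n221 n)) ∧
    GradedHilbert.locusI K n (GradedHilbert.hilb1n221 n) ⊆
      closure (GradedHilbert.locusII K n (GradedHilbert.hilb1n221 n)) ∧
    GradedHilbert.locusI K n (GradedHilbert.hilb1n221 n) ⊆
      closure (GradedHilbert.locusIII K n (GradedHilbert.hilb1n221 n)) ∧
    -- the graded Hilbert scheme is irreducible, as a variety and as a scheme
    IrreducibleSpace (GradedHilbert.GradedHilb K n (GradedHilbert.hilb1n221 n)) ∧
    ∀ X : Over (Spec (.of K)),
      GradedHilbert.IsGradedHilbertScheme K n (GradedHilbert.hilb1n221 n) X →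
        IrreducibleSpace X.left := by
  have h1 := GradedHilbert.stratumI_describes (K := K) (n := n)
  have h2 := GradedHilbert.stratumII_describes (K := K) (n := n)
  have h3 := GradedHilbert.stratumIII_describes (K := K) (n := n)
  have h4 := GradedHilbert.stratumIV_describes (K := K) (n := n)
  exact ⟨GradedHilbert.union_loci_eq_univ,
    ⟨h1.isIrreducible hn, h1.topologicalKrullDim_eq (h1.isIrreducible hn).nonempty⟩,
    ⟨h2.isIrreducible hn, h2.topologicalKrullDim_eq (h2.isIrreducible hn).nonempty⟩,
    ⟨h3.isIrreducible hn, h3.topologicalKrullDim_eq (h3.isIrreducible hn).nonempty⟩,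
    ⟨h4.isIrreducible hn, h4.topologicalKrullDim_eq (h4.isIrreducible hn).nonempty⟩,
    GradedHilbert.locusII_subset_closure_locusIV, GradedHilbert.locusIII_subset_closure_locusIV,
    GradedHilbert.locusI_subset_closure_locusII, GradedHilbert.locusI_subset_closure_locusIII,
    GradedHilbert.irreducibleSpace_gradedHilb hn,
    fun _ hX => GradedHilbert.irreducibleSpace_scheme hn hX⟩
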